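/- Let $d\ge 2$ and write $\langle v\rangle=\sqrt{1+|v|^2}$ and $\|g\|_{L^\infty_m}=\operatorname{ess\,sup}_{x,v}\langle v\rangle^m|g(x,v)|$, $\|g\|_{L^\infty}=\|g\|_{L^\infty_0}$. Let $Q$ be one of the following collision operators. * (Landau) $Q(g,f)(v)=\nabla_v\cdot\int_{\mathbb R^d}|v-w|^{2+\gamma}\,\Pi(v-w)\,[g(w)\nabla f(v)-f(v)\nabla g(w)]\,dw$, where $\Pi(z)$ is the orthogonal projection onto $z^\perp$, $\gamma\in[-d,1]$, and $\gamma>-2$ if $d=2$. The integral is understood as the limit of the integrals over $|w|<R$ as $R\to\infty$. * (Boltzmann) $Q(g,f)(v)=\int_{\mathbb R^d}\int_{\mathbb S^{d-1}}|v-v_*|^\gamma\, b(\sin\tfrac\theta2)\,[f(v')g(v_*')-f(v)g(v_*)]\,d\sigma\,dv_*$, where $v'=\frac{v+v_*}2+\frac{|v-v_*|}2\sigma$, $v_*'=\frac{v+v_*}2-\frac{|v-v_*|}2\sigma$, $\cos\theta=\sigma\cdot\frac{v-v_*}{|v-v_*|}$ with $\theta\in[0,\pi]$, $\gamma>-d$,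 and $b\ge0$ is measurable with $\int_{\mathbb S^{d-1}}\sin^2(\tfrac\theta2)\,b(\sin\tfrac\theta2)\,d\sigma<\infty$ and $b(\sin\tfrac\theta2)$ not almost everywhere zero. The integral is understood as the limit as $\varepsilon\to0^+$ of the integrals restricted to $\sin\frac\theta2>\varepsilon$. Let $\Omega$ be $\mathbb R^d$ or a torus $(\mathbb R/L\mathbb Z)^d$, $L>0$. A *solution* on $[0,T)$, for an exponent $m$, is a continuous function $f\colon[0,T)\times\Omega\times\mathbb R^d\to[0,\infty)$ such that on $(0,T)\times\Omega\times\mathbb R^d$ the derivatives $D_v^2f$ and $(\partial_t+v\cdot\nabla_x)f$ (the latter along $s\mapsto(t+s,x+sv,v)$) exist and are continuous and $(\partial_t+v\cdot\nabla_x)f=Q(f,f)$, and such that for every $T'<T$: for some $\varepsilon>0$, $\langle v\rangle^{m+\varepsilon}f\to0$ as $|v|\to\infty$ uniformly in $(t,x)\in[0,T']\times\Omega$; and, if $\Omega=\mathbb R^d$, $\langle v\rangle^m f\to0$ as $|x|\to\infty$ uniformly in $(t,v)\in[0,T']\times\mathbb R^d$. Then there is $m_0$, depending only on $Q$ (and $d$),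 such that for every $m>m_0$ there is a constant $C>0$, depending only on $m$ and $Q$ (and $d$), with the following property. For every such $\Omega$, every $T>0$ and every solution $f$ on $[0,T)$ for the exponent $m$ with $\|f(0)\|_{L^\infty_m}<\infty$, $$\text{if}\quad \limsup_{t\to T^-}\|f(t)\|_{L^\infty}=+\infty,\quad\text{then}\quad \|f(t)\|_{L^\infty_m}\ge\frac1{C(T-t)}\quad\text{for all }t\in[0,T).$$ -/

import Mathlib

open MeasureTheory Filter Set
open scoped Topology

namespace Kinetic

/-- Euclidean space `ℝ^d`, used both for velocities and for positions. -/
abbrev Euc (d : ℕ) := EuclideanSpace ℝ (Fin d)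

/-- The unit sphere `S^{d-1}`. -/
abbrev UnitSphere (d : ℕ) := Metric.sphere (0 : Euc d) 1

/-- The surface measure `dσ` on `S^{d-1}`. -/
noncomputable def surfaceMeasure (d : ℕ) : Measure (UnitSphere d) :=
  (volume : Measure (Euc d)).toSphere

/-- The Japanese bracket `⟨v⟩ = √(1 + |v|²)`. -/
noncomputable def bracket {d : ℕ} (v : Euc d) : ℝ := Real.sqrt (1 + ‖v‖ ^ 2)

/-- The norm `‖g‖_{L^∞_m}`, the essential supremum over `(x, v)` of `⟨v⟩^m |g(x, v)|`, with values
in `[0, ∞]`. For `m = 0` it is the unweighted norm `‖g‖_{L^∞}`. -/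
noncomputable def weightedNorm {d : ℕ} (m : ℝ) (g : Euc d → Euc d → ℝ) : ENNReal :=
  eLpNorm (fun p : Euc d × Euc d => bracket p.2 ^ m * g p.1 p.2) ⊤ volume

/-! ### The Landau operator -/

/-- `Π(z) y = y - (ẑ · y) ẑ`: the projection onto the hyperplane orthogonal to `z`. -/
noncomputable def perpProj {d : ℕ} (z y : Euc d) : Euc d :=
  y - (inner ℝ z y / ‖z‖ ^ 2) • z

/-- The integrand `|u-w|^{2+γ} Π(u-w) [g(w) ∇f(u) - f(u) ∇g(w)]` of the Landau flux. -/
noncomputable def landauIntegrand {d : ℕ} (γ : ℝ) (g f : Euc d → ℝ) (u w : Euc d) : Euc d :=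
  ‖u - w‖ ^ (2 + γ) • perpProj (u - w) (g w • gradient f u - f u • gradient g w)

/-- `Q_L(g,f)(v)` exists and equals `q`. The flux `F(u)` is the integral over `w ∈ ℝ^d` of the
integrand above, taken as the limit of the integrals over balls `|w| < R` (this is the Lebesgue
integral whenever that converges absolutely; no decay is required of `∇g`), and `q` is the
divergence of `F` at `v`. -/
def IsLandauValue {d : ℕ} (γ : ℝ) (g f : Euc d → ℝ) (v : Euc d) (q : ℝ) : Prop :=
  ∃ F : Euc d → Euc d,
    (∀ u, Tendsto (fun R : ℝ => ∫ w in Metric.ball (0 : Euc d) R, landauIntegrand γ g f u w)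
      atTop (𝓝 (F u))) ∧
    ∃ F' : Euc d →L[ℝ] Euc d, HasFDerivAt F F' v ∧
      ∑ i : Fin d, F' (EuclideanSpace.single i 1) i = q

/-! ### The Boltzmann operator -/

/-- `sin(θ/2) = √((1 - cos θ)/2)`, where `cos θ = σ · z/|z|` and `θ ∈ [0, π]`. -/
noncomputable def sinHalf {d : ℕ} (z : Euc d) (σ : UnitSphere d) : ℝ :=
  Real.sqrt ((1 - inner ℝ (σ : Euc d) z / ‖z‖) / 2)

/-- The post-collisional velocity `v' = (v + v_*)/2 + (|v - v_*|/2) σ`. -/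
noncomputable def postVel {d : ℕ} (v vs : Euc d) (σ : UnitSphere d) : Euc d :=
  (1 / 2 : ℝ) • (v + vs) + (‖v - vs‖ / 2) • (σ : Euc d)

/-- The post-collisional velocity `v_*' = (v + v_*)/2 - (|v - v_*|/2) σ`. -/
noncomputable def postVelStar {d : ℕ} (v vs : Euc d) (σ : UnitSphere d) : Euc d :=
  (1 / 2 : ℝ) • (v + vs) - (‖v - vs‖ / 2) • (σ : Euc d)

/-- The collision kernel `B(z, σ) = |z|^γ b(sin(θ/2))`. -/
noncomputable def collisionKernel {d : ℕ} (γ : ℝ) (b : ℝ → ℝ) (z : Euc d) (σ : UnitSphere d) : ℝ :=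
  ‖z‖ ^ γ * b (sinHalf z σ)

/-- The Boltzmann operator `Q_B(g,f)(v)` with the angular integral restricted to
`sin(θ/2) > ε`. -/
noncomputable def boltzmannTruncated {d : ℕ} (γ : ℝ) (b : ℝ → ℝ) (ε : ℝ) (g f : Euc d → ℝ)
    (v : Euc d) : ℝ :=
  ∫ vs : Euc d, ∫ σ in {σ : UnitSphere d | ε < sinHalf (v - vs) σ},
    collisionKernel γ b (v - vs) σ *
      (f (postVel v vs σ) * g (postVelStar v vs σ) - f v * g vs) ∂(surfaceMeasure d)

/-- `Q_B(g,f)(v)` exists and equals `q`. The kernel may have a non-integrable singularity at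
`θ = 0`, so the integral is taken in the usual principal value sense, grazing collisions being
removed symmetrically. This is the ordinary integral whenever that converges absolutely, in
particular for cutoff kernels. -/
def IsBoltzmannValue {d : ℕ} (γ : ℝ) (b : ℝ → ℝ) (g f : Euc d → ℝ) (v : Euc d) (q : ℝ) : Prop :=
  Tendsto (fun ε : ℝ => boltzmannTruncated γ b ε g f v) (𝓝[>] 0) (𝓝 q)

/-- The assumptions on the angular function `b`, a function of `sin(θ/2)`: it is nonnegative and
measurable, `|sin(θ/2)|² b(sin(θ/2))` is integrable over the sphere, and `b(sin(θ/2))` is not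
(almost everywhere) zero. By rotation invariance the direction `e` is immaterial. -/
structure IsAngularKernel (d : ℕ) (b : ℝ → ℝ) : Prop where
  measurable : Measurable b
  nonneg : ∀ s ∈ Icc (0 : ℝ) 1, 0 ≤ b s
  integrable : ∀ e : Euc d, ‖e‖ = 1 →
    Integrable (fun σ : UnitSphere d => sinHalf e σ ^ 2 * b (sinHalf e σ)) (surfaceMeasure d)
  nontrivial : ∀ e : Euc d, ‖e‖ = 1 →
    ¬ ∀ᵐ σ : UnitSphere d ∂(surfaceMeasure d), b (sinHalf e σ) = 0

/-! ### The kinetic equation -/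

/-- The collision operators: Landau with exponent `γ`, or Boltzmann with kernel
`|z|^γ b(sin(θ/2))`. -/
inductive CollisionOperator where
  | landau (γ : ℝ)
  | boltzmann (γ : ℝ) (b : ℝ → ℝ)

/-- The admissible parameters in dimension `d`. -/
def CollisionOperator.Admissible (d : ℕ) : CollisionOperator → Prop
  | .landau γ => -(d : ℝ) ≤ γ ∧ γ ≤ 1 ∧ (d = 2 → -2 < γ)
  | .boltzmann γ b => -(d : ℝ) < γ ∧ IsAngularKernel d b

/-- `Q(g,g)(v)` exists and equals `q`. -/
def CollisionOperator.IsValue {d : ℕ} (Q : CollisionOperator) (g : Euc d → ℝ) (v : Euc d)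
    (q : ℝ) : Prop :=
  match Q with
  | .landau γ => IsLandauValue γ g g v q
  | .boltzmann γ b => IsBoltzmannValue γ b g g v q

/-- The spatial domain: `ℝ^d`, or the torus `(ℝ/Lℤ)^d` with side length `L > 0`. -/
inductive SpatialDomain where
  | wholeSpace
  | torus (L : ℝ) (hL : 0 < L)

/-- The requirement that the spatial domain makes on `f : [0,T) × ℝ^d × ℝ^d → ℝ`. Functions on the
torus are functions on `ℝ^d` that are `L`-periodic in every coordinate of `x`. On the whole space,
`⟨v⟩^m f` tends to zero as `|x| → ∞`, uniformly in `v` and in `t ∈ [0,T']` for every `T' < T`. -/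
def SpatialDomain.Compatible {d : ℕ} (Ω : SpatialDomain) (m T : ℝ)
    (f : ℝ → Euc d → Euc d → ℝ) : Prop :=
  match Ω with
  | .wholeSpace => ∀ T' < T, ∀ η > 0, ∃ R : ℝ, ∀ t ∈ Icc 0 T', ∀ x v : Euc d, R ≤ ‖x‖ →
      bracket v ^ m * f t x v ≤ η
  | .torus L _ => ∀ t ∈ Ico 0 T, ∀ (x v : Euc d) (i : Fin d),
      f t (x + EuclideanSpace.single i L) v = f t x v

/-- Nonnegative classical solutions on `[0,T)` of `(∂_t + v·∇_x) f = Q(f,f)` with the qualitative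
decay associated with the exponent `m`. The transport derivative `(∂_t + v·∇_x) f` is the derivative
along `s ↦ (t + s, x + s v, v)`. -/
structure IsSolution {d : ℕ} (Q : CollisionOperator) (Ω : SpatialDomain) (m T : ℝ)
    (f : ℝ → Euc d → Euc d → ℝ) : Prop where
  nonneg : ∀ t ∈ Ico 0 T, ∀ x v, 0 ≤ f t x v
  continuousOn : ContinuousOn (fun p : ℝ × Euc d × Euc d => f p.1 p.2.1 p.2.2) (Ico 0 T ×ˢ univ)
  contDiff : ∀ t ∈ Ioo 0 T, ∀ x, ContDiff ℝ 2 (f t x)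
  continuousOn_hessian : ContinuousOn
    (fun p : ℝ × Euc d × Euc d => iteratedFDeriv ℝ 2 (f p.1 p.2.1) p.2.2) (Ioo 0 T ×ˢ univ)
  equation : ∃ q : ℝ × Euc d × Euc d → ℝ, ContinuousOn q (Ioo 0 T ×ˢ univ) ∧
    ∀ t ∈ Ioo 0 T, ∀ x v : Euc d,
      HasDerivAt (fun s : ℝ => f (t + s) (x + s • v) v) (q (t, x, v)) 0 ∧
      Q.IsValue (f t x) v (q (t, x, v))
  decay : ∀ T' < T, ∃ ε > 0, ∀ η > 0, ∃ R : ℝ, ∀ t ∈ Icc 0 T', ∀ x v : Euc d, R ≤ ‖v‖ →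
    bracket v ^ (m + ε) * f t x v ≤ η
  compatible : Ω.Compatible m T f

end Kinetic

namespace Kinetic

variable {d : ℕ}

/-! ### The bracket and integrals of powers -/

/-! The theorem rests on a pointwise estimate at contact points, `HasContactEstimate`: if 0 ≤ g ≤
N⟨v⟩^{-m} with equality at v₀, then Q(g,g)(v₀) ≤ K N² ⟨v₀⟩^{-m}. Given this, let ψ solve ψ' = 2Kψ²
with ψ(t) slightly above ‖f(t)‖_{L^∞_m}. At a first contact of f with ψ⟨v⟩^{-m} (it is attained,
because of the decay assumptions) the transport derivative of ⟨v⟩^m f would be at least ψ' > Kψ²,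
against the estimate (`IsSolution.lt_barrier`). If ‖f(t)‖_{L^∞_m} < 1/(2K(T-t)), then ψ is still
finite at time T, so f stays bounded and there is no blow-up (`IsSolution.blowup_rate`).

Boltzmann. The loss term can be much larger than N²⟨v⟩^{-m}, and its angular mass may diverge as the
truncation is removed, so the gain has to be dominated by the loss with constant exactly one, up to
an admissible error. In the product of the two outgoing values one factor f(v-y) is kept and the
other is bounded by the barrier at v-w, where w ⊥ y and |w| = |y| tan α, α = θ/2. In the variables
(y, σ) the angular density is that of the half angle times cos^{-(d+γ)} α. If v-y is small compared
with v, the mean of the barrier over ±w is at most cos^{d+γ+2} α times its value at v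
(`exists_low_velocity_bound`). This leaves cos² α, and exchanging the outgoing velocities supplies
the missing sin² α, which gives exactly the loss (`lintegral_symm_cos_sq`). If v-y is not small, a
Taylor expansion leaves an extra error O(sin² α), which is integrable against b, and the decay of
f(v-y) makes this error quadratic in N, uniformly in v. See `exists_gain_le_loss_add` and
`hasContactEstimate_boltzmann`.

Landau. With the kernel regularized at scale ε, and all derivatives under the integral moved onto
it, the divergence of the flux is ∫ g(u-z)[A_ε(z):D²g(u) - g(u) div div A_ε(z)] dz
(`divergence_landauFlux`). Near a contact point D²g is at most the Hessian of the barrier plus τ,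
and A_ε ≥ 0, so g may be replaced by the barrier in the bracket. The resulting symbol is nonpositive
when u-z is small compared with u (`landauSymbol_nonpos`); elsewhere it is controlled, uniformly in
ε, by functions integrable against ⟨u-z⟩^{-m} (`landauSymbol_le`), including an approximate delta of
bounded mass. The true flux is only a pointwise limit, differentiable at v; the upper bound on the
divergence passes to it by testing with bump functions (`divergence_le_of_tendsto`). Since the flux
is a limit over balls and ∇g need not decay, it is identified by averaging over radii and
integrating by parts (`landauFlux_eq_of_tendsto`). -/

lemma bracket_sq (v : Euc d) : bracket v ^ 2 = 1 + ‖v‖ ^ 2 :=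
  Real.sq_sqrt (by positivity)

lemma one_le_bracket (v : Euc d) : 1 ≤ bracket v :=
  Real.one_le_sqrt.2 (by nlinarith [sq_nonneg ‖v‖])

lemma bracket_pos (v : Euc d) : 0 < bracket v := zero_lt_one.trans_le (one_le_bracket v)

lemma norm_le_bracket (v : Euc d) : ‖v‖ ≤ bracket v :=
  Real.le_sqrt_of_sq_le (by linarith)

lemma bracket_le_one_add_norm (v : Euc d) : bracket v ≤ 1 + ‖v‖ :=
  sqrt_one_add_norm_sq_le v

lemma continuous_bracket : Continuous (bracket : Euc d → ℝ) := by
  unfold bracket; fun_prop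

@[fun_prop]
lemma continuous_bracket_rpow (m : ℝ) : Continuous (fun v : Euc d => bracket v ^ m) :=
  continuous_bracket.rpow_const fun v => Or.inl (bracket_pos v).ne'

lemma bracket_rpow_neg_le_one (v : Euc d) {m : ℝ} (hm : 0 ≤ m) : bracket v ^ (-m) ≤ 1 :=
  Real.rpow_le_one_of_one_le_of_nonpos (one_le_bracket v) (by linarith)

lemma bracket_rpow_eq (v : Euc d) (m : ℝ) : bracket v ^ m = (1 + ‖v‖ ^ 2) ^ (m / 2) := by
  rw [bracket, Real.sqrt_eq_rpow, ← Real.rpow_mul (by positivity)]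
  congr 1; ring

lemma lintegral_bracket_rpow_lt_top {r : ℝ} (hr : (d : ℝ) < r) :
    ∫⁻ v : Euc d, ENNReal.ofReal (bracket v ^ (-r)) < ⊤ := by
  have h := integrable_rpow_neg_one_add_norm_sq (E := Euc d) (μ := volume) (r := r)
    (by simpa using hr)
  have := h.lintegral_lt_top
  simpa only [bracket_rpow_eq] using this

lemma lintegral_ball_norm_rpow_lt_top (hd : 1 ≤ d) {γ : ℝ} (hγ : -(d : ℝ) < γ) :
    ∫⁻ y in Metric.ball (0 : Euc d) 1, ENNReal.ofReal (‖y‖ ^ γ) < ⊤ := by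
  have h := integrableOn_ball_of_norm_le_rpow (E := Euc d) (μ := volume) (F := ℝ)
    (f := fun y => ‖y‖ ^ γ) (C := 1) (α := -γ) (r := 1) (by simpa using hd)
    (by simp; linarith) ?_ ?_
  · exact h.lintegral_lt_top
  · exact Eventually.of_forall fun y => by
      rw [Real.norm_of_nonneg (by positivity)]; simp
  · exact (by fun_prop : Measurable fun y : Euc d => ‖y‖ ^ γ).aestronglyMeasurable

/-- Weighted integrals of `‖y‖ ^ γ ⟨v - y⟩ ^ (-m)` over the region where `⟨y⟩ ≤ a ⟨v - y⟩` are
bounded uniformly in `v`. -/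
lemma lintegral_norm_rpow_bracket_le (hd : 1 ≤ d) {γ : ℝ} (hγ : -(d : ℝ) < γ) {j m : ℝ}
    (hj : 0 ≤ j) (hm : d + |γ| + j < m) (a : ℝ) (ha : 0 ≤ a) :
    ∃ C : ℝ, 0 ≤ C ∧ ∀ (v : Euc d) (s : Set (Euc d)), MeasurableSet s →
      (∀ y ∈ s, bracket y ≤ a * bracket (v - y)) →
      ∫⁻ y in s, ENNReal.ofReal (‖y‖ ^ γ * bracket y ^ j * bracket (v - y) ^ (-m))
        ≤ ENNReal.ofReal C := by
  set I₁ := ∫⁻ y in Metric.ball (0 : Euc d) 1, ENNReal.ofReal (‖y‖ ^ γ) with hI₁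
  set I₂ := ∫⁻ y : Euc d, ENNReal.ofReal (bracket y ^ (-(m - (|γ| + j)))) with hI₂
  have h₁ : I₁ < ⊤ := lintegral_ball_norm_rpow_lt_top hd hγ
  have h₂ : I₂ < ⊤ := lintegral_bracket_rpow_lt_top (by linarith)
  have hγ0 := abs_nonneg γ
  have hd0 : (0 : ℝ) ≤ d := Nat.cast_nonneg d
  set C' : ENNReal := ENNReal.ofReal (2 ^ j) * I₁ + ENNReal.ofReal (a ^ (|γ| + j)) * I₂ with hC'
  have hC'top : C' < ⊤ := ENNReal.add_lt_top.2
    ⟨ENNReal.mul_lt_top ENNReal.ofReal_lt_top h₁, ENNReal.mul_lt_top ENNReal.ofReal_lt_top h₂⟩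
  refine ⟨C'.toReal, ENNReal.toReal_nonneg, fun v s hs hsa => ?_⟩
  rw [ENNReal.ofReal_toReal hC'top.ne]
  -- For |y| < 1 the singularity |y|^γ is locally integrable and every weight is bounded. For |y| ≥
  -- 1 the assumption on s turns the growth ⟨y⟩^{|γ|+j} into ⟨v-y⟩^{|γ|+j}, which m absorbs.
  have hpt : ∀ y ∈ s, ENNReal.ofReal (‖y‖ ^ γ * bracket y ^ j * bracket (v - y) ^ (-m)) ≤
      ENNReal.ofReal (2 ^ j) * (Metric.ball (0 : Euc d) 1).indicator
        (fun y => ENNReal.ofReal (‖y‖ ^ γ)) y +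
      ENNReal.ofReal (a ^ (|γ| + j)) * ENNReal.ofReal (bracket (v - y) ^ (-(m - (|γ| + j)))) := by
    intro y hy
    have hb := bracket_pos y
    have hb' := bracket_pos (v - y)
    by_cases hy1 : ‖y‖ < 1
    · refine le_add_right ?_
      rw [indicator_of_mem (by simpa using hy1), ← ENNReal.ofReal_mul (by positivity)]
      apply ENNReal.ofReal_le_ofReal
      have e1 : bracket y ^ j ≤ 2 ^ j :=
        Real.rpow_le_rpow hb.le ((bracket_le_one_add_norm y).trans (by linarith)) hj
      have e2 : bracket (v - y) ^ (-m) ≤ 1 := bracket_rpow_neg_le_one _ (by linarith)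
      have e3 : 0 ≤ ‖y‖ ^ γ := by positivity
      calc _ ≤ ‖y‖ ^ γ * 2 ^ j * 1 := by gcongr
        _ = _ := by ring
    · refine le_add_left ?_
      rw [← ENNReal.ofReal_mul (by positivity)]
      apply ENNReal.ofReal_le_ofReal
      have e1 : ‖y‖ ^ γ ≤ bracket y ^ |γ| :=
        (Real.rpow_le_rpow_of_exponent_le (not_lt.1 hy1) (le_abs_self γ)).trans
          (Real.rpow_le_rpow (norm_nonneg _) (norm_le_bracket y) hγ0)
      calc _ ≤ bracket y ^ |γ| * bracket y ^ j * bracket (v - y) ^ (-m) := by gcongr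
        _ = bracket y ^ (|γ| + j) * bracket (v - y) ^ (-m) := by rw [Real.rpow_add hb]
        _ ≤ (a * bracket (v - y)) ^ (|γ| + j) * bracket (v - y) ^ (-m) := by
          gcongr; exact hsa y hy
        _ = _ := by
          rw [Real.mul_rpow ha hb'.le, mul_assoc, ← Real.rpow_add hb']
          congr 2; ring
  calc _ ≤ ∫⁻ y in s, (ENNReal.ofReal (2 ^ j) * (Metric.ball (0 : Euc d) 1).indicator
        (fun y => ENNReal.ofReal (‖y‖ ^ γ)) y +
      ENNReal.ofReal (a ^ (|γ| + j)) * ENNReal.ofReal (bracket (v - y) ^ (-(m - (|γ| + j))))) :=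
        setLIntegral_mono' hs hpt
    _ ≤ ∫⁻ y, (ENNReal.ofReal (2 ^ j) * (Metric.ball (0 : Euc d) 1).indicator
        (fun y => ENNReal.ofReal (‖y‖ ^ γ)) y +
      ENNReal.ofReal (a ^ (|γ| + j)) * ENNReal.ofReal (bracket (v - y) ^ (-(m - (|γ| + j))))) :=
        setLIntegral_le_lintegral _ _
    _ = C' := by
      have hm1 : Measurable fun y : Euc d => ENNReal.ofReal (‖y‖ ^ γ) := by fun_prop
      have hm2 : Measurable fun y : Euc d =>
          ENNReal.ofReal (bracket (v - y) ^ (-(m - (|γ| + j)))) := by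
        refine ENNReal.measurable_ofReal.comp (Continuous.measurable ?_)
        exact (continuous_bracket_rpow _).comp (by fun_prop)
      rw [lintegral_add_left ((hm1.indicator Metric.isOpen_ball.measurableSet).const_mul _),
        lintegral_const_mul _ (hm1.indicator Metric.isOpen_ball.measurableSet),
        lintegral_const_mul _ hm2, lintegral_indicator Metric.isOpen_ball.measurableSet,
        lintegral_sub_left_eq_self
          (fun y : Euc d => ENNReal.ofReal (bracket y ^ (-(m - (|γ| + j))))) v]

/-- A Peetre-type inequality. Its constant depends on v, so it serves only for finiteness and for
locally uniform bounds. -/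
lemma bracket_le_mul_bracket_sub (v y : Euc d) :
    bracket y ≤ 3 * bracket v * bracket (v - y) := by
  have h1 := bracket_le_one_add_norm y
  have h2 : ‖y‖ ≤ ‖v‖ + ‖v - y‖ := by
    calc ‖y‖ = ‖v - (v - y)‖ := by simp
      _ ≤ _ := norm_sub_le _ _
  have h3 := norm_le_bracket v
  have h4 := norm_le_bracket (v - y)
  have h5 := one_le_bracket v
  have h6 := one_le_bracket (v - y)
  nlinarith [mul_nonneg (sub_nonneg.2 h5) (sub_nonneg.2 h6)]

/-- On the region where v - y is not small compared with v, the constant no longer depends on v.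
This is the source of the uniform constants in both contact estimates. -/
lemma bracket_le_of_le_bracket_sub {k : ℝ} (hk : 0 < k) (v y : Euc d)
    (h : k * bracket v ≤ bracket (v - y)) : bracket y ≤ (2 + 1 / k) * bracket (v - y) := by
  have h1 := bracket_le_one_add_norm y
  have h2 : ‖y‖ ≤ ‖v‖ + ‖v - y‖ := by
    calc ‖y‖ = ‖v - (v - y)‖ := by simp
      _ ≤ _ := norm_sub_le _ _
  have h3 := norm_le_bracket v
  have h4 := norm_le_bracket (v - y)
  have h6 := one_le_bracket (v - y)
  have h7 : bracket v ≤ 1 / k * bracket (v - y) := by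
    rw [one_div, ← div_eq_inv_mul, le_div_iff₀ hk]; linarith
  linarith

/-! ### From a pointwise estimate at contact points to the growth estimate -/

/-- At a point where a nonnegative `g` touches the barrier `N ⟨v⟩ ^ (-m)` from below, the collision
operator is at most `K N² ⟨v⟩ ^ (-m)`. -/
def HasContactEstimate (d : ℕ) (Q : CollisionOperator) (m K : ℝ) : Prop :=
  ∀ N : ℝ, 0 < N → ∀ g : Euc d → ℝ, ContDiff ℝ 2 g → (∀ v, 0 ≤ g v) →
    (∀ v, g v ≤ N * bracket v ^ (-m)) → ∀ v₀ q, g v₀ = N * bracket v₀ ^ (-m) →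
    Q.IsValue g v₀ q → q ≤ K * N ^ 2 * bracket v₀ ^ (-m)

/-- Continuity upgrades the essential supremum to a pointwise bound: a strict violation would
persist on a nonempty open set, which has positive measure. -/
lemma mul_le_toReal_weightedNorm {m : ℝ} {g : Euc d → Euc d → ℝ}
    (hg : Continuous fun p : Euc d × Euc d => g p.1 p.2) (hfin : weightedNorm m g ≠ ⊤)
    (x v : Euc d) : bracket v ^ m * g x v ≤ (weightedNorm m g).toReal := by
  set h : Euc d × Euc d → ℝ := fun p => bracket p.2 ^ m * g p.1 p.2 with hh
  have hcont : Continuous h := ((continuous_bracket_rpow m).comp continuous_snd).mul hg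
  have hae : ∀ᵐ p ∂(volume : Measure (Euc d × Euc d)), ‖h p‖ₑ ≤ weightedNorm m g := by
    have := enorm_ae_le_eLpNormEssSup h (volume : Measure (Euc d × Euc d))
    simpa [weightedNorm, eLpNorm_exponent_top] using this
  by_contra! hcon
  have hopen : IsOpen {p : Euc d × Euc d | (weightedNorm m g).toReal < h p} :=
    isOpen_lt continuous_const hcont
  have hpos := hopen.measure_pos (volume : Measure (Euc d × Euc d)) ⟨(x, v), hcon⟩
  refine hpos.ne' (measure_mono_null (fun p hp => ?_) (ae_iff.1 hae))
  simp only [mem_ofPred_eq, not_le] at hp ⊢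
  rw [Real.enorm_eq_ofReal_abs, ENNReal.lt_ofReal_iff_toReal_lt hfin]
  exact hp.trans_le (le_abs_self _)

lemma weightedNorm_le_ofReal {m M : ℝ} {g : Euc d → Euc d → ℝ}
    (h : ∀ x v, |bracket v ^ m * g x v| ≤ M) : weightedNorm m g ≤ ENNReal.ofReal M := by
  rw [weightedNorm, eLpNorm_exponent_top]
  refine eLpNormEssSup_le_of_ae_enorm_bound (Eventually.of_forall fun p => ?_)
  rw [Real.enorm_eq_ofReal_abs]
  exact ENNReal.ofReal_le_ofReal (h _ _)

lemma IsSolution.continuous_slice {Q : CollisionOperator} {Ω : SpatialDomain} {m T : ℝ}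
    {f : ℝ → Euc d → Euc d → ℝ} (hf : IsSolution Q Ω m T f) {t : ℝ} (ht : t ∈ Ico 0 T) :
    Continuous fun p : Euc d × Euc d => f t p.1 p.2 := by
  have := hf.continuousOn.comp_continuous (f := fun p : Euc d × Euc d => (t, p.1, p.2))
    (by fun_prop) (fun p => ⟨ht, mem_univ _⟩)
  exact this

lemma isCompact_cube (L : ℝ) : IsCompact {x : Euc d | ∀ i, x i ∈ Icc 0 L} := by
  have h : IsCompact (Set.pi univ fun _ : Fin d => Icc (0 : ℝ) L) :=
    isCompact_univ_pi fun _ => isCompact_Icc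
  have h2 := h.image (PiLp.continuous_toLp 2 (fun _ : Fin d => ℝ))
  convert h2 using 1
  ext x
  simp only [mem_ofPred_eq, mem_image, Set.mem_pi, mem_univ, true_implies]
  constructor
  · intro hx
    exact ⟨fun i => x i, hx, rfl⟩
  · rintro ⟨y, hy, rfl⟩ i
    exact hy i

lemma exists_mem_cube_eq {L : ℝ} (hL : 0 < L) {h : Euc d → ℝ}
    (hper : ∀ x i, h (x + EuclideanSpace.single i L) = h x) (x : Euc d) :
    ∃ x' ∈ {x : Euc d | ∀ i, x i ∈ Icc 0 L}, h x' = h x := by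
  have hz : ∀ (n : Fin d → ℤ) (s : Finset (Fin d)) (y : Euc d),
      h (y + ∑ i ∈ s, n i • EuclideanSpace.single i L) = h y := by
    intro n s
    induction s using Finset.induction_on with
    | empty => intro y; simp
    | insert a s ha ih =>
      intro y
      rw [Finset.sum_insert ha, add_comm (n a • _), ← add_assoc]
      have hp : Function.Periodic h (EuclideanSpace.single a L) := fun y => hper y a
      rw [hp.zsmul (n a), ih]
  refine ⟨x + ∑ i, (-⌊x i / L⌋) • EuclideanSpace.single i L, fun j => ?_, hz _ _ _⟩
  have : (x + ∑ i, (-⌊x i / L⌋) • EuclideanSpace.single i L : Euc d) j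
      = x j - ⌊x j / L⌋ * L := by
    simp [Finset.sum_apply, Pi.single_apply, sub_eq_add_neg]
  rw [this]
  have h1 := Int.floor_le (x j / L)
  have h2 := Int.lt_floor_add_one (x j / L)
  rw [le_div_iff₀ hL] at h1
  rw [div_lt_iff₀ hL] at h2
  constructor <;> nlinarith

/-- The compactness needed for a first contact. Decay in v confines the velocities; positions are
confined by decay in x on the whole space, and by translation into a period cell on the torus, which
is why x may have to be replaced by x'. -/
lemma IsSolution.exists_isCompact {Q : CollisionOperator} {Ω : SpatialDomain} {m T : ℝ}
    {f : ℝ → Euc d → Euc d → ℝ} (hf : IsSolution Q Ω m T f) {T' η : ℝ} (hT' : T' < T)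
    (hη : 0 < η) : ∃ B : Set (Euc d × Euc d), IsCompact B ∧
      ∀ t ∈ Icc 0 T', ∀ x v, η ≤ bracket v ^ m * f t x v → ∃ x', (x', v) ∈ B ∧
        f t x' v = f t x v := by
  obtain ⟨ε, hε, hdec⟩ := hf.decay T' hT'
  obtain ⟨R, hR⟩ := hdec (η / 2) (by positivity)
  have hv : ∀ t ∈ Icc 0 T', ∀ x v, η ≤ bracket v ^ m * f t x v →
      v ∈ Metric.closedBall (0 : Euc d) R := by
    intro t ht x v h
    rw [mem_closedBall_zero_iff]
    by_contra! hcon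
    have h1 := hR t ht x v hcon.le
    have h2 : bracket v ^ m ≤ bracket v ^ (m + ε) :=
      Real.rpow_le_rpow_of_exponent_le (one_le_bracket v) (by linarith)
    have h3 := hf.nonneg t ⟨ht.1, ht.2.trans_lt hT'⟩ x v
    nlinarith [mul_le_mul_of_nonneg_right h2 h3]
  cases Ω with
  | wholeSpace =>
    obtain ⟨R', hR'⟩ := hf.compatible T' hT' (η / 2) (by positivity)
    refine ⟨Metric.closedBall 0 R' ×ˢ Metric.closedBall 0 R,
      (isCompact_closedBall _ _).prod (isCompact_closedBall _ _),
      fun t ht x v h => ⟨x, ⟨?_, hv t ht x v h⟩, rfl⟩⟩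
    rw [mem_closedBall_zero_iff]
    by_contra! hcon
    have := hR' t ht x v hcon.le
    linarith
  | torus L hL =>
    refine ⟨{x : Euc d | ∀ i, x i ∈ Icc 0 L} ×ˢ Metric.closedBall 0 R,
      (isCompact_cube L).prod (isCompact_closedBall _ _), fun t ht x v h => ?_⟩
    obtain ⟨x', hx', he⟩ := exists_mem_cube_eq hL (h := fun x => f t x v)
      (fun x i => hf.compatible t ⟨ht.1, ht.2.trans_lt hT'⟩ x v i) x
    exact ⟨x', ⟨hx', hv t ht x v h⟩, he⟩

/-! ### First contact with a moving barrier -/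

lemma nonneg_of_hasDerivAt_of_nonpos_left {h : ℝ → ℝ} {h' : ℝ} (hh : HasDerivAt h h' 0)
    (h0 : h 0 = 0) (hneg : ∀ᶠ s in 𝓝[<] (0 : ℝ), h s ≤ 0) : 0 ≤ h' := by
  have ht := (hasDerivAt_iff_tendsto_slope.1 hh).mono_left
    (nhdsWithin_mono (0 : ℝ) (fun s (hs : s < 0) => hs.ne) : 𝓝[<] (0 : ℝ) ≤ _)
  refine ge_of_tendsto ht ?_
  filter_upwards [hneg, self_mem_nhdsWithin] with s hs hs0
  rw [slope_def_field, h0]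
  exact div_nonneg_of_nonpos (by linarith) (by simpa using (mem_Iio.1 hs0).le)

/-- A solution lying below the barrier `ψ(t) ⟨v⟩ ^ (-m)` at time `t₀`, where `K ψ² < ψ'`, stays
below it. -/
lemma IsSolution.lt_barrier {Q : CollisionOperator} {Ω : SpatialDomain} {m T K : ℝ}
    (hK : HasContactEstimate d Q m K) {f : ℝ → Euc d → Euc d → ℝ} (hf : IsSolution Q Ω m T f)
    {t₀ : ℝ} (ht₀ : t₀ ∈ Ico 0 T) {ψ ψ' : ℝ → ℝ} {η : ℝ} (hη : 0 < η)
    (hψη : ∀ t ∈ Ico t₀ T, η ≤ ψ t) (hψ : ∀ t ∈ Ico t₀ T, HasDerivAt ψ (ψ' t) t)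
    (hψ' : ∀ t ∈ Ico t₀ T, K * ψ t ^ 2 < ψ' t)
    (h0 : ∀ x v, bracket v ^ m * f t₀ x v < ψ t₀) :
    ∀ t ∈ Ico t₀ T, ∀ x v, bracket v ^ m * f t x v < ψ t := by
  by_contra! hcon
  obtain ⟨ts, hts, xs, vs, hs⟩ := hcon
  obtain ⟨B, hB, hBf⟩ := hf.exists_isCompact hts.2 hη
  set G : ℝ × Euc d × Euc d → ℝ := fun p => bracket p.2.2 ^ m * f p.1 p.2.1 p.2.2 - ψ p.1 with hG
  have hsub : Icc t₀ ts ⊆ Ico t₀ T := fun t ht => ⟨ht.1, ht.2.trans_lt hts.2⟩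
  have hGc : ContinuousOn G (Ico t₀ T ×ˢ univ) := by
    refine ContinuousOn.sub (ContinuousOn.mul ?_ ?_) ?_
    · exact ((continuous_bracket_rpow m).comp (continuous_snd.comp continuous_snd)).continuousOn
    · exact hf.continuousOn.mono (prod_mono (Ico_subset_Ico_left ht₀.1) Subset.rfl)
    · have : ContinuousOn ψ (Ico t₀ T) := fun t ht => (hψ t ht).continuousAt.continuousWithinAt
      exact this.comp continuousOn_fst (fun p hp => hp.1)
  set S : Set (ℝ × Euc d × Euc d) := (Icc t₀ ts ×ˢ B) ∩ G ⁻¹' Ici 0 with hS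
  have hScomp : IsCompact S := by
    have hc : IsCompact (Icc t₀ ts ×ˢ B) := isCompact_Icc.prod hB
    exact hc.of_isClosed_subset ((hGc.mono (prod_mono hsub (subset_univ B))).preimage_isClosed_of_isClosed
      hc.isClosed isClosed_Ici) inter_subset_left
  have hmem : ∀ t ∈ Icc t₀ ts, ∀ x v, ψ t ≤ bracket v ^ m * f t x v → ∃ x', (t, x', v) ∈ S := by
    intro t ht x v h
    obtain ⟨x', hx', he⟩ := hBf t ⟨ht₀.1.trans ht.1, ht.2⟩ x v ((hψη t (hsub ht)).trans h)
    refine ⟨x', ⟨⟨ht, hx'⟩, ?_⟩⟩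
    simp only [hG, mem_preimage, mem_Ici, he]
    linarith
  obtain ⟨y, hy⟩ := hmem ts ⟨hts.1, le_rfl⟩ xs vs hs
  -- A point of earliest contact: the time coordinate attains its minimum on the compact set S.
  obtain ⟨⟨t₁, x₁, v₁⟩, h1S, h1min⟩ := hScomp.exists_isMinOn ⟨_, hy⟩ continuousOn_fst
  have ht1 : t₁ ∈ Icc t₀ ts := h1S.1.1
  have hG1 : ψ t₁ ≤ bracket v₁ ^ m * f t₁ x₁ v₁ := by
    have := h1S.2
    simp only [hG, mem_preimage, mem_Ici] at this
    linarith
  have hlt : ∀ t ∈ Ico t₀ t₁, ∀ x v, bracket v ^ m * f t x v < ψ t := by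
    intro t ht x v
    by_contra! h
    obtain ⟨x', hx'⟩ := hmem t ⟨ht.1, ht.2.le.trans ht1.2⟩ x v h
    exact absurd (h1min hx') (not_le.2 ht.2)
  have h01 : t₀ < t₁ := by
    rcases ht1.1.lt_or_eq with h | h
    · exact h
    · subst h
      exact absurd (h0 x₁ v₁) (not_lt.2 hG1)
  have hT1 : t₁ ∈ Ico t₀ T := hsub ht1
  -- The strict inequality before t₁ passes to t₁ as a weak one, so f really touches the barrier
  -- from below at (x₁, v₁).
  have hle : ∀ x v, bracket v ^ m * f t₁ x v ≤ ψ t₁ := by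
    intro x v
    have hc : ContinuousWithinAt (fun t => G (t, x, v)) (Ico t₀ T) t₁ :=
      (hGc.comp (f := fun t => ((t, x, v) : ℝ × Euc d × Euc d)) (by fun_prop)
        (fun t ht => ⟨ht, mem_univ _⟩)) t₁ hT1
    have hc' : Tendsto (fun t => G (t, x, v)) (𝓝[Ico t₀ t₁] t₁) (𝓝 (G (t₁, x, v))) :=
      hc.mono (Ico_subset_Ico_right hT1.2.le)
    have : (𝓝[Ico t₀ t₁] t₁).NeBot := by
      rw [← mem_closure_iff_nhdsWithin_neBot, closure_Ico h01.ne]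
      exact ⟨h01.le, le_rfl⟩
    have : G (t₁, x, v) ≤ 0 := by
      refine le_of_tendsto hc' ?_
      filter_upwards [self_mem_nhdsWithin] with t ht
      have := hlt t ht x v
      simp only [hG]; linarith
    simp only [hG] at this; linarith
  have ht1' : t₁ ∈ Ioo 0 T := ⟨ht₀.1.trans_lt h01, hT1.2⟩
  obtain ⟨q, -, hq⟩ := hf.equation
  obtain ⟨hder, hval⟩ := hq t₁ ht1' x₁ v₁
  have hbp : ∀ v : Euc d, 0 < bracket v ^ m := fun v => Real.rpow_pos_of_pos (bracket_pos v) m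
  have hψpos : 0 < ψ t₁ := hη.trans_le (hψη t₁ hT1)
  have hinv : ∀ v : Euc d, bracket v ^ (-m) = (bracket v ^ m)⁻¹ := fun v =>
    Real.rpow_neg (bracket_pos v).le m
  have heq : bracket v₁ ^ m * f t₁ x₁ v₁ = ψ t₁ := le_antisymm (hle _ _) hG1
  have hqK : q (t₁, x₁, v₁) ≤ K * ψ t₁ ^ 2 * bracket v₁ ^ (-m) := by
    refine hK (ψ t₁) hψpos (f t₁ x₁) (hf.contDiff t₁ ht1' x₁)
      (hf.nonneg t₁ ⟨ht1'.1.le, ht1'.2⟩ x₁) (fun v => ?_) v₁ _ ?_ hval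
    · rw [hinv, ← div_eq_mul_inv, le_div_iff₀ (hbp v), mul_comm]; exact hle x₁ v
    · rw [hinv, ← div_eq_mul_inv, eq_div_iff (hbp v₁).ne', mul_comm]; exact heq
  have hderψ : HasDerivAt (fun s => ψ (t₁ + s)) (ψ' t₁) 0 := by
    have := hψ t₁ hT1
    rw [show t₁ = t₁ + 0 by simp] at this
    simpa using this.comp_const_add t₁ 0
  -- Along the characteristic through the contact point the velocity, hence the weight, is constant.
  -- The difference vanishes at s = 0 and is negative for s slightly below 0, so its derivative
  -- there is nonnegative.
  have hdd := (hder.const_mul (bracket v₁ ^ m)).sub hderψ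
  have hpos : 0 ≤ bracket v₁ ^ m * q (t₁, x₁, v₁) - ψ' t₁ := by
    refine nonneg_of_hasDerivAt_of_nonpos_left hdd (by simp [heq]) ?_
    have : Ioo (t₀ - t₁) 0 ∈ 𝓝[<] (0 : ℝ) := Ioo_mem_nhdsLT (by linarith)
    filter_upwards [this] with s hs
    have := hlt (t₁ + s) ⟨by linarith [hs.1], by linarith [hs.2]⟩ (x₁ + s • v₁) v₁
    simp only [Pi.sub_apply]
    linarith
  have := hψ' t₁ hT1
  have h5 : bracket v₁ ^ m * q (t₁, x₁, v₁) ≤ K * ψ t₁ ^ 2 := by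
    rw [hinv, ← div_eq_mul_inv, le_div_iff₀ (hbp v₁)] at hqK
    linarith
  linarith

/-- The lower bound on the blow-up rate, given the contact estimate. -/
lemma IsSolution.blowup_rate {Q : CollisionOperator} {Ω : SpatialDomain} {m T K : ℝ} (hm : 0 ≤ m)
    (hK0 : 0 < K) (hK : HasContactEstimate d Q m K) {f : ℝ → Euc d → Euc d → ℝ}
    (hf : IsSolution Q Ω m T f)
    (hlim : limsup (fun t : ℝ => weightedNorm 0 (f t)) (𝓝[<] T) = ⊤) {t : ℝ} (ht : t ∈ Ico 0 T) :
    ENNReal.ofReal (1 / (2 * K * (T - t))) ≤ weightedNorm m (f t) := by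
  by_contra! hcon
  have hfin : weightedNorm m (f t) ≠ ⊤ := hcon.ne_top
  set n := (weightedNorm m (f t)).toReal with hn
  have hn0 : 0 ≤ n := ENNReal.toReal_nonneg
  have hTt : 0 < T - t := by linarith [ht.2]
  have hlt : n < 1 / (2 * K * (T - t)) := (ENNReal.lt_ofReal_iff_toReal_lt hfin).1 hcon
  -- M is the starting value of the barrier: strictly above the norm, so that f lies strictly below
  -- at time t, and small enough for the barrier to survive up to time T included.
  obtain ⟨M, hM1, hM2⟩ := exists_between hlt
  have hMpos : 0 < M := hn0.trans_lt hM1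
  set A := 1 / M with hA
  have hAgt : 2 * K * (T - t) < A := by
    rw [hA, lt_div_iff₀ hMpos]
    rw [lt_div_iff₀ (by positivity)] at hM2
    linarith
  have hden : ∀ s ∈ Icc t T, 0 < A - 2 * K * (s - t) := by
    intro s hs
    have : 2 * K * (s - t) ≤ 2 * K * (T - t) := by
      have := hs.2
      gcongr
    linarith
  -- The solution of ψ' = 2Kψ² with ψ(t) = M. The factor 2 provides the strict inequality Kψ² < ψ'.
  set ψ : ℝ → ℝ := fun s => (A - 2 * K * (s - t))⁻¹ with hψdef
  have hmain := hf.lt_barrier hK ht (ψ := ψ) (ψ' := fun s => 2 * K * ψ s ^ 2) (η := M) hMpos ?_ ?_ ?_ ?_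
  · have hb : ∀ s ∈ Ico t T, weightedNorm 0 (f s) ≤ ENNReal.ofReal (ψ T) := by
      intro s hs
      refine weightedNorm_le_ofReal fun x v => ?_
      have h1 := hmain s hs x v
      have h2 := hf.nonneg s ⟨ht.1.trans hs.1, hs.2⟩ x v
      have h3 : 1 ≤ bracket v ^ m := Real.one_le_rpow (one_le_bracket v) hm
      have h4 : ψ s ≤ ψ T := by
        refine inv_anti₀ (hden T ⟨ht.2.le, le_rfl⟩) ?_
        have := hs.2.le
        gcongr
      rw [Real.rpow_zero, one_mul, abs_of_nonneg h2]
      nlinarith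
    have : limsup (fun t : ℝ => weightedNorm 0 (f t)) (𝓝[<] T) ≤ ENNReal.ofReal (ψ T) := by
      refine limsup_le_of_le (by isBoundedDefault) ?_
      filter_upwards [Ico_mem_nhdsLT ht.2] with s hs using hb s hs
    rw [hlim] at this
    exact absurd this (by simp)
  · intro s hs
    rw [hψdef, le_inv_comm₀ hMpos (hden s ⟨hs.1, hs.2.le⟩), ← one_div]
    have : 0 ≤ 2 * K * (s - t) := mul_nonneg (by positivity) (by linarith [hs.1])
    linarith
  · intro s hs
    have hne := (hden s ⟨hs.1, hs.2.le⟩).ne'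
    have h1 : HasDerivAt (fun s => A - 2 * K * (s - t)) (-(2 * K)) s := by
      simpa using (((hasDerivAt_id s).sub_const t).const_mul (2 * K)).const_sub A
    refine (h1.fun_inv hne).congr_deriv ?_
    have hne2 : A - 2 * K * (s - t) ≠ 0 := hne
    change _ = 2 * K * ((A - 2 * K * (s - t))⁻¹) ^ 2
    field_simp
  · intro s hs
    have : 0 < ψ s := inv_pos.2 (hden s ⟨hs.1, hs.2.le⟩)
    have : 0 < K * ψ s ^ 2 := by positivity
    linarith
  · intro x v
    refine (mul_le_toReal_weightedNorm (hf.continuous_slice ht) hfin x v).trans_lt ?_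
    simpa [hψdef, hA] using hM1

/-! ### Polar coordinates and the half-angle change of variables -/

lemma lintegral_polar (hd : 1 ≤ d) {h : Euc d → ENNReal} (hh : Measurable h) :
    ∫⁻ x, h x = ∫⁻ σ : UnitSphere d, ∫⁻ r in Ioi (0 : ℝ),
      ENNReal.ofReal (r ^ (d - 1)) * h (r • (σ : Euc d)) ∂volume ∂(surfaceMeasure d) := by
  have : Nonempty (Fin d) := ⟨⟨0, hd⟩⟩
  have hmp := (volume : Measure (Euc d)).measurePreserving_homeomorphUnitSphereProd
  have hdim : Module.finrank ℝ (Euc d) = d := by simp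
  rw [hdim] at hmp
  have hH : Measurable fun p : UnitSphere d × Ioi (0 : ℝ) => h ((p.2 : ℝ) • (p.1 : Euc d)) :=
    hh.comp (by fun_prop)
  calc ∫⁻ x, h x = ∫⁻ x in ({0}ᶜ : Set (Euc d)), h x := by
        rw [restrict_compl_singleton]
    _ = ∫⁻ x : ({0}ᶜ : Set (Euc d)), h x ∂(volume.comap (Subtype.val : ({0}ᶜ : Set (Euc d)) → Euc d)) := by
        rw [lintegral_subtype_comap (measurableSet_singleton _).compl]
    _ = ∫⁻ x : ({0}ᶜ : Set (Euc d)), (fun p : UnitSphere d × Ioi (0 : ℝ) =>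
          h ((p.2 : ℝ) • (p.1 : Euc d))) (homeomorphUnitSphereProd (Euc d) x)
          ∂(volume.comap (Subtype.val : ({0}ᶜ : Set (Euc d)) → Euc d)) := by
        refine lintegral_congr fun x => ?_
        have hx : ‖(x : Euc d)‖ ≠ 0 := norm_ne_zero_iff.2 x.2
        simp [smul_smul, mul_inv_cancel₀ hx]
    _ = ∫⁻ p, (fun p : UnitSphere d × Ioi (0 : ℝ) => h ((p.2 : ℝ) • (p.1 : Euc d))) p
          ∂((volume : Measure (Euc d)).toSphere.prod (Measure.volumeIoiPow (d - 1))) := by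
        rw [← hmp.lintegral_comp hH]
    _ = _ := by
        rw [lintegral_prod _ hH.aemeasurable]
        refine lintegral_congr fun σ => ?_
        have hm1 : Measurable fun r : Ioi (0 : ℝ) => h ((r : ℝ) • (σ : Euc d)) :=
          hh.comp (by fun_prop)
        have hm2 : Measurable fun r : Ioi (0 : ℝ) => ENNReal.ofReal ((r : ℝ) ^ (d - 1)) := by
          fun_prop
        rw [Measure.volumeIoiPow, lintegral_withDensity_eq_lintegral_mul _ hm2 hm1,
          ← lintegral_subtype_comap measurableSet_Ioi
            (fun r : ℝ => ENNReal.ofReal (r ^ (d - 1)) * h (r • (σ : Euc d)))]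
        rfl

lemma setLIntegral_Ioi_pow_mul_indicator (hd : 1 ≤ d) {c : ℝ} (hc : 0 ≤ c) :
    ∫⁻ r in Ioi (0 : ℝ), ENNReal.ofReal (r ^ (d - 1)) * (Iio c).indicator 1 r
      = ENNReal.ofReal (c ^ d / d) := by
  have h1 : ∀ r : ℝ, ENNReal.ofReal (r ^ (d - 1)) * (Iio c).indicator 1 r
      = (Iio c).indicator (fun r => ENNReal.ofReal (r ^ (d - 1))) r := by
    intro r; by_cases hr : r ∈ Iio c <;> simp [hr]
  simp_rw [h1]
  rw [setLIntegral_indicator measurableSet_Iio, Iio_inter_Ioi, Measure.restrict_congr_set Ioo_ae_eq_Ioc,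
    ← ofReal_integral_eq_lintegral_ofReal
      (intervalIntegral.intervalIntegrable_pow (d - 1)).1, ← intervalIntegral.integral_of_le hc]
  · have hd' : d - 1 + 1 = d := Nat.sub_add_cancel hd
    rw [integral_pow, hd']
    congr 2
    · rw [zero_pow (by omega), sub_zero]
    · rw [← hd']; push_cast; ring_nf
  · filter_upwards [ae_restrict_mem measurableSet_Ioc] with y hy
    exact pow_nonneg hy.1.le _

/-- The average of a degree zero homogeneous function over the unit ball. -/
lemma lintegral_ball_homogeneous (hd : 1 ≤ d) {g : Euc d → ENNReal} (hg : Measurable g) :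
    ∫⁻ x, g (‖x‖⁻¹ • x) * (Iio (1 : ℝ)).indicator 1 ‖x‖
      = (∫⁻ σ : UnitSphere d, g σ ∂(surfaceMeasure d)) * ENNReal.ofReal (1 / d) := by
  have hm : Measurable fun x : Euc d => g (‖x‖⁻¹ • x) * (Iio (1 : ℝ)).indicator 1 ‖x‖ :=
    (hg.comp (by fun_prop)).mul ((measurable_one.indicator measurableSet_Iio).comp measurable_norm)
  rw [lintegral_polar hd hm]
  have hg' : Measurable fun σ : UnitSphere d => g σ := hg.comp measurable_subtype_coe
  rw [← lintegral_mul_const _ hg']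
  refine lintegral_congr fun σ => ?_
  have hσ : ‖(σ : Euc d)‖ = 1 := by simp
  have : ∀ r ∈ Ioi (0 : ℝ), ENNReal.ofReal (r ^ (d - 1)) * (g (‖r • (σ : Euc d)‖⁻¹ • r • (σ : Euc d)) *
      (Iio (1 : ℝ)).indicator 1 ‖r • (σ : Euc d)‖) =
      g σ * (ENNReal.ofReal (r ^ (d - 1)) * (Iio (1 : ℝ)).indicator 1 r) := by
    intro r hr
    have hr0 : (0 : ℝ) < r := hr
    rw [norm_smul, hσ, mul_one, Real.norm_of_nonneg hr0.le, smul_smul, inv_mul_cancel₀ hr0.ne',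
      one_smul]
    ring
  rw [setLIntegral_congr_fun measurableSet_Ioi this, lintegral_const_mul _ ?_,
    setLIntegral_Ioi_pow_mul_indicator hd zero_le_one, one_pow]
  exact Measurable.mul (by fun_prop) (measurable_one.indicator measurableSet_Iio)

lemma ofReal_one_div_ne (hd : 1 ≤ d) : ENNReal.ofReal (1 / (d : ℝ)) ≠ 0 := by
  have : (0 : ℝ) < d := by exact_mod_cast hd
  exact (ENNReal.ofReal_pos.2 (by positivity)).ne'

/-- The surface measure is invariant under linear isometries. -/
lemma lintegral_sphere_comp_isometry (hd : 1 ≤ d) (U : Euc d ≃ₗᵢ[ℝ] Euc d) {g : Euc d → ENNReal}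
    (hg : Measurable g) :
    ∫⁻ σ : UnitSphere d, g (U σ) ∂(surfaceMeasure d)
      = ∫⁻ σ : UnitSphere d, g σ ∂(surfaceMeasure d) := by
  have hU : Measurable fun x => g (U x) := hg.comp U.continuous.measurable
  have h1 := lintegral_ball_homogeneous hd hg
  have h2 := lintegral_ball_homogeneous hd hU
  -- The degree-zero extension to the unit ball transfers the rotation invariance of Lebesgue
  -- measure to the sphere.
  have h3 := U.measurePreserving.lintegral_comp_emb U.toHomeomorph.measurableEmbedding
    (fun x => g (‖x‖⁻¹ • x) * (Iio (1 : ℝ)).indicator 1 ‖x‖)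
  simp only [LinearIsometryEquiv.norm_map] at h3
  simp only [map_smul] at h2
  rw [h2, h1] at h3
  exact (ENNReal.mul_left_inj (ofReal_one_div_ne hd) ENNReal.ofReal_ne_top).1 h3

/-- The inverse of the map `z ↦ (z + |z| σ) / 2`. -/
noncomputable def unfoldVel (σ y : Euc d) : Euc d :=
  (2 : ℝ) • y - (‖y‖ ^ 2 / inner ℝ y σ) • σ

lemma norm_sq_unfoldVel {σ y : Euc d} (hσ : ‖σ‖ = 1) (hy : 0 < inner ℝ y σ) :
    ‖unfoldVel σ y‖ = ‖y‖ ^ 2 / inner ℝ y σ := by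
  have h : ‖unfoldVel σ y‖ ^ 2 = (‖y‖ ^ 2 / inner ℝ y σ) ^ 2 := by
    rw [unfoldVel, norm_sub_sq_real, norm_smul, norm_smul, inner_smul_left, inner_smul_right, hσ]
    simp only [Real.norm_eq_abs, mul_one, sq_abs, mul_pow, RCLike.conj_to_real]
    field_simp
    ring
  exact (sq_eq_sq₀ (norm_nonneg _) (by positivity)).1 h

lemma half_unfoldVel_add {σ y : Euc d} (hσ : ‖σ‖ = 1) (hy : 0 < inner ℝ y σ) :
    (1 / 2 : ℝ) • (unfoldVel σ y + ‖unfoldVel σ y‖ • σ) = y := by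
  rw [norm_sq_unfoldVel hσ hy, unfoldVel, sub_add_cancel, smul_smul]
  norm_num

lemma inner_unfoldVel {σ y : Euc d} (hσ : ‖σ‖ = 1) :
    inner ℝ σ (unfoldVel σ y) = 2 * inner ℝ y σ - ‖y‖ ^ 2 / inner ℝ y σ := by
  rw [unfoldVel, inner_sub_right, inner_smul_right, inner_smul_right, real_inner_self_eq_norm_sq,
    hσ, real_inner_comm]
  ring

/-- The derivative is 2·id minus a rank-one map with range in ℝσ, that is, twice a transvection.
Hence its determinant is 2^d (1 - k'(σ)/2), and k'(σ) = 2 - |y|²/⟨y,σ⟩². -/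
lemma hasFDerivAt_unfoldVel {σ y : Euc d} (hσ : ‖σ‖ = 1) (hy : 0 < inner ℝ y σ) :
    ∃ L : Euc d →L[ℝ] Euc d, HasFDerivAt (unfoldVel σ) L y ∧
      |L.det| = 2 ^ (d - 1) * (‖y‖ / inner ℝ y σ) ^ 2 := by
  have hd : 1 ≤ d := by
    rcases Nat.eq_zero_or_pos d with h | h
    · subst h
      rw [Subsingleton.elim σ 0] at hσ
      simp at hσ
    · exact h
  have h1 : HasFDerivAt (fun y : Euc d => ‖y‖ ^ 2) (2 • innerSL ℝ y) y :=
    (hasStrictFDerivAt_norm_sq y).hasFDerivAt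
  have h2 : HasFDerivAt (fun y : Euc d => inner ℝ y σ) (innerSL ℝ σ) y := by
    have := (innerSL ℝ σ).hasFDerivAt (x := y)
    refine this.congr_of_eventuallyEq (Eventually.of_forall fun x => ?_)
    simp [real_inner_comm]
  set k' : Euc d →L[ℝ] ℝ := (‖y‖ ^ 2) • (-(inner ℝ y σ ^ 2)⁻¹ • innerSL ℝ σ) +
    (inner ℝ y σ)⁻¹ • (2 • innerSL ℝ y) with hk'
  have h3 : HasFDerivAt (fun y : Euc d => ‖y‖ ^ 2 / inner ℝ y σ) k' y := by
    simp only [div_eq_mul_inv]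
    exact h1.mul ((hasDerivAt_inv hy.ne').comp_hasFDerivAt y h2)
  have h4 := ((hasFDerivAt_id y).const_smul (2 : ℝ)).sub (h3.smul_const σ)
  refine ⟨_, h4, ?_⟩
  have hdet : (((2 : ℝ) • ContinuousLinearMap.id ℝ (Euc d) - ContinuousLinearMap.smulRight k' σ :
      Euc d →L[ℝ] Euc d) : Euc d →ₗ[ℝ] Euc d)
      = (2 : ℝ) • LinearMap.transvection ((-(1 / 2 : ℝ)) • (k' : Euc d →ₗ[ℝ] ℝ)) σ := by
    ext1 x
    simp [LinearMap.transvection.apply, smul_smul, smul_add, sub_eq_add_neg]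
  have hval : k' σ = 2 - ‖y‖ ^ 2 / (inner ℝ y σ) ^ 2 := by
    simp only [hk', _root_.smul_apply, _root_.add_apply, innerSL_apply_apply,
      real_inner_self_eq_norm_sq, hσ, smul_eq_mul, nsmul_eq_mul]
    push_cast
    field_simp
    ring
  change |LinearMap.det (((2 : ℝ) • ContinuousLinearMap.id ℝ (Euc d) -
    ContinuousLinearMap.smulRight k' σ : Euc d →L[ℝ] Euc d) : Euc d →ₗ[ℝ] Euc d)| = _
  rw [hdet, LinearMap.det_smul, LinearMap.transvection.det]
  have hv2 : (1 : ℝ) + ((-(1 / 2 : ℝ)) • (k' : Euc d →ₗ[ℝ] ℝ)) σ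
      = (‖y‖ / inner ℝ y σ) ^ 2 / 2 := by
    simp only [LinearMap.smul_apply, ContinuousLinearMap.coe_coe, hval, smul_eq_mul]
    field_simp; ring
  rw [hv2, abs_of_nonneg (by positivity)]
  simp only [finrank_euclideanSpace, Fintype.card_fin]
  have hp : (2 : ℝ) ^ d = 2 ^ (d - 1) * 2 := by rw [← pow_succ, Nat.sub_add_cancel hd]
  rw [hp]; ring

/-- The change of variables `z = unfoldVel σ y`. -/
lemma lintegral_eq_lintegral_unfoldVel (hd : 2 ≤ d) {σ : Euc d} (hσ : ‖σ‖ = 1)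
    (h : Euc d → ENNReal) :
    ∫⁻ z, h z = ∫⁻ y in {y : Euc d | 0 < inner ℝ y σ},
      ENNReal.ofReal (2 ^ (d - 1) * (‖y‖ / inner ℝ y σ) ^ 2) * h (unfoldVel σ y) := by
  have hopen : MeasurableSet {y : Euc d | 0 < inner ℝ y σ} :=
    (isOpen_lt continuous_const (by fun_prop)).measurableSet
  have hL : ∀ y : {y : Euc d | 0 < inner ℝ y σ}, ∃ L : Euc d →L[ℝ] Euc d,
      HasFDerivAt (unfoldVel σ) L y ∧
      |L.det| = 2 ^ (d - 1) * (‖(y : Euc d)‖ / inner ℝ (y : Euc d) σ) ^ 2 :=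
    fun y => hasFDerivAt_unfoldVel hσ y.2
  choose L hL1 hL2 using hL
  classical
  set L' : Euc d → (Euc d →L[ℝ] Euc d) := fun y =>
    if hy : y ∈ {y : Euc d | 0 < inner ℝ y σ} then L ⟨y, hy⟩ else 0 with hL'
  have hinj : InjOn (unfoldVel σ) {y : Euc d | 0 < inner ℝ y σ} := by
    intro y hy y' hy' he
    rw [← half_unfoldVel_add hσ hy, he, half_unfoldVel_add hσ hy']
  have hcov := lintegral_image_eq_lintegral_abs_det_fderiv_mul (volume : Measure (Euc d)) hopen
    (f := unfoldVel σ) (f' := L') (fun y hy => by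
      have := hL1 ⟨y, hy⟩
      simp only [hL', dif_pos hy]
      exact this.hasFDerivWithinAt) hinj h
  -- Every z off the line ℝσ is the image of y = (z + |z|σ)/2. The line is a null set because d ≥ 2.
  have himage : ∀ z : Euc d, z ∉ Submodule.span ℝ {σ} →
      z ∈ unfoldVel σ '' {y : Euc d | 0 < inner ℝ y σ} := by
    intro z hz
    set y : Euc d := (1 / 2 : ℝ) • (z + ‖z‖ • σ) with hy
    have hz0 : z ≠ 0 := fun h => hz (h ▸ Submodule.zero_mem _)
    have hne : z + ‖z‖ • σ ≠ 0 := by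
      intro h
      apply hz
      rw [eq_neg_of_add_eq_zero_left h]
      exact Submodule.neg_mem _ (Submodule.smul_mem _ _ (Submodule.mem_span_singleton_self σ))
    have hn : ‖y‖ ^ 2 = (1 / 2) * (‖z‖ * (‖z‖ + inner ℝ z σ)) := by
      rw [hy, norm_smul, mul_pow, norm_add_sq_real, norm_smul, inner_smul_right, hσ]
      simp; ring
    have hi : inner ℝ y σ = (1 / 2) * (‖z‖ + inner ℝ z σ) := by
      rw [hy, inner_smul_left, inner_add_left, inner_smul_left, real_inner_self_eq_norm_sq, hσ]
      simp; ring
    have hzp : 0 < ‖z‖ := norm_pos_iff.2 hz0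
    have hyp : 0 < ‖y‖ ^ 2 := by
      have : y ≠ 0 := by
        rw [hy]; exact smul_ne_zero (by norm_num) hne
      positivity
    have hsum : 0 < ‖z‖ + inner ℝ z σ := by
      rw [hn] at hyp
      by_contra! hcon
      nlinarith [mul_nonneg hzp.le (neg_nonneg.2 hcon)]
    refine ⟨y, ?_, ?_⟩
    · change 0 < inner ℝ y σ
      rw [hi]; positivity
    · rw [unfoldVel, hn, hi, mul_div_mul_left _ _ (by norm_num), mul_div_cancel_right₀ _ hsum.ne', hy,
        smul_smul]
      norm_num
  have hnull : volume ((Submodule.span ℝ {σ} : Submodule ℝ (Euc d)) : Set (Euc d)) = 0 := by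
    refine Measure.addHaar_submodule _ _ fun htop => ?_
    have h1 : Module.finrank ℝ (Submodule.span ℝ {σ}) ≤ 1 := by
      simpa using finrank_span_le_card ({σ} : Set (Euc d))
    rw [htop, finrank_top] at h1
    simp at h1
    omega
  have hae : (unfoldVel σ '' {y : Euc d | 0 < inner ℝ y σ} : Set (Euc d)) =ᵐ[volume] univ := by
    rw [eventuallyEq_univ, mem_ae_iff]
    exact measure_mono_null (fun z hz => by
      by_contra hcon
      exact hz (himage z hcon)) hnull
  rw [← setLIntegral_univ, ← setLIntegral_congr hae, hcov]
  refine setLIntegral_congr_fun hopen fun y hy => ?_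
  simp only [hL', dif_pos hy, hL2]

/-! ### The half-angle identity on the sphere -/

/-- The half-angle formula: y bisects the angle θ between σ and its preimage, so cos(θ/2) =
⟨y,σ⟩/|y|. -/
lemma cos_unfoldVel {σ y : Euc d} (hσ : ‖σ‖ = 1) (hy : 0 < inner ℝ y σ) :
    (1 - inner ℝ σ (unfoldVel σ y) / ‖unfoldVel σ y‖) / 2 = 1 - (inner ℝ y σ / ‖y‖) ^ 2 := by
  have hy0 : ‖y‖ ≠ 0 := by
    intro h
    rw [norm_eq_zero.1 h] at hy
    simp at hy
  rw [inner_unfoldVel hσ, norm_sq_unfoldVel hσ hy]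
  field_simp
  ring

lemma sinHalf_unfoldVel (σ : UnitSphere d) {y : Euc d} (hy : 0 < inner ℝ y (σ : Euc d)) :
    sinHalf (unfoldVel σ y) σ = Real.sqrt (1 - (inner ℝ y (σ : Euc d) / ‖y‖) ^ 2) := by
  rw [sinHalf, cos_unfoldVel (by simp) hy]

lemma measurable_sinHalf : Measurable fun p : Euc d × UnitSphere d => sinHalf p.1 p.2 := by
  unfold sinHalf; fun_prop

lemma sinHalf_nonneg (z : Euc d) (σ : UnitSphere d) : 0 ≤ sinHalf z σ := Real.sqrt_nonneg _

lemma abs_inner_div_norm_le (z : Euc d) (σ : UnitSphere d) :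
    |inner ℝ (σ : Euc d) z / ‖z‖| ≤ 1 := by
  have := abs_real_inner_div_norm_mul_norm_le_one (σ : Euc d) z
  simpa using this

lemma sinHalf_sq (z : Euc d) (σ : UnitSphere d) :
    sinHalf z σ ^ 2 = (1 - inner ℝ (σ : Euc d) z / ‖z‖) / 2 := by
  have := abs_le.1 (abs_inner_div_norm_le z σ)
  exact Real.sq_sqrt (by linarith)

lemma sinHalf_le_one (z : Euc d) (σ : UnitSphere d) : sinHalf z σ ≤ 1 := by
  have := abs_le.1 (abs_inner_div_norm_le z σ)
  exact Real.sqrt_le_one.2 (by linarith)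

/-- Reversing σ replaces θ by π - θ, which turns sin(θ/2) into cos(θ/2). -/
lemma sinHalf_neg (z : Euc d) (σ : UnitSphere d) :
    sinHalf z (-σ) = Real.sqrt (1 - sinHalf z σ ^ 2) := by
  rw [sinHalf_sq, sinHalf]
  congr 1
  simp only [coe_neg_sphere, inner_neg_left]
  ring

/-- The density of the half-angle map: with `σ` at angle `θ` from `e`, the bisector is at angle
`θ / 2`. -/
lemma lintegral_sinHalf_eq (hd : 2 ≤ d) {e : Euc d} (he : ‖e‖ = 1) {G : ℝ → ENNReal}
    (hG : Measurable G) :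
    ∫⁻ σ : UnitSphere d, G (sinHalf e σ) ∂(surfaceMeasure d) =
      ∫⁻ σ : UnitSphere d, {σ : UnitSphere d | 0 < inner ℝ e (σ : Euc d)}.indicator (fun σ =>
        ENNReal.ofReal (2 ^ (d - 1) * (1 / inner ℝ e (σ : Euc d)) ^ 2 * inner ℝ e (σ : Euc d) ^ d) *
          G (Real.sqrt (1 - inner ℝ e (σ : Euc d) ^ 2))) σ ∂(surfaceMeasure d) := by
  have hd1 : 1 ≤ d := by omega
  set g : Euc d → ENNReal := fun x => G (Real.sqrt ((1 - inner ℝ e x) / 2)) with hg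
  have hgm : Measurable g := hG.comp (by fun_prop)
  have h1 := lintegral_ball_homogeneous hd1 hgm
  have h2 : ∀ σ : UnitSphere d, g σ = G (sinHalf e σ) := by
    intro σ; simp [hg, sinHalf, he, real_inner_comm]
  simp_rw [h2] at h1
  -- The half-angle substitution is performed on the degree-zero extension, with e as the fixed
  -- direction. The unit ball becomes |y|² < ⟨y,e⟩, i.e. r < c in polar coordinates, and the radial
  -- integral produces the factor c^d.
  rw [lintegral_eq_lintegral_unfoldVel hd he] at h1
  set s : Set (Euc d) := {y : Euc d | 0 < inner ℝ y e} with hs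
  have hsm : MeasurableSet s := (isOpen_lt continuous_const (by fun_prop)).measurableSet
  set F : Euc d → ENNReal := fun y => ENNReal.ofReal (2 ^ (d - 1) * (‖y‖ / inner ℝ y e) ^ 2) *
    (G (Real.sqrt (1 - (inner ℝ y e / ‖y‖) ^ 2)) *
      (Iio (1 : ℝ)).indicator 1 (‖y‖ ^ 2 / inner ℝ y e)) with hF
  have hFm : Measurable F := by
    refine Measurable.mul (by fun_prop) (Measurable.mul (hG.comp (by fun_prop)) ?_)
    exact (measurable_one.indicator measurableSet_Iio).comp
      (by fun_prop : Measurable fun y : Euc d => ‖y‖ ^ 2 / inner ℝ y e)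
  have h3 : ∫⁻ y in s, ENNReal.ofReal (2 ^ (d - 1) * (‖y‖ / inner ℝ y e) ^ 2) *
      (g (‖unfoldVel e y‖⁻¹ • unfoldVel e y) * (Iio (1 : ℝ)).indicator 1 ‖unfoldVel e y‖)
      = ∫⁻ y, s.indicator F y := by
    rw [lintegral_indicator hsm]
    refine setLIntegral_congr_fun hsm fun y hy => ?_
    have hy' : 0 < inner ℝ y e := hy
    simp only [hF, hg]
    rw [inner_smul_right, ← div_eq_inv_mul, cos_unfoldVel he hy', norm_sq_unfoldVel he hy']
  rw [h3, lintegral_polar hd1 (hFm.indicator hsm)] at h1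
  have h4 : ∀ σ : UnitSphere d, ∫⁻ r in Ioi (0 : ℝ),
      ENNReal.ofReal (r ^ (d - 1)) * s.indicator F (r • (σ : Euc d)) =
      {σ : UnitSphere d | 0 < inner ℝ e (σ : Euc d)}.indicator (fun σ : UnitSphere d =>
        ENNReal.ofReal (2 ^ (d - 1) * (1 / inner ℝ e (σ : Euc d)) ^ 2 * inner ℝ e (σ : Euc d) ^ d) *
          G (Real.sqrt (1 - inner ℝ e (σ : Euc d) ^ 2))) σ * ENNReal.ofReal (1 / d) := by
    intro σ
    have hσ : ‖(σ : Euc d)‖ = 1 := by simp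
    by_cases hc : 0 < inner ℝ e (σ : Euc d)
    · set c := inner ℝ e (σ : Euc d) with hcdef
      have hc' : inner ℝ (σ : Euc d) e = c := real_inner_comm _ _
      have h5 : ∀ r ∈ Ioi (0 : ℝ), ENNReal.ofReal (r ^ (d - 1)) * s.indicator F (r • (σ : Euc d)) =
          ENNReal.ofReal (2 ^ (d - 1) * (1 / c) ^ 2) * G (Real.sqrt (1 - c ^ 2)) *
            (ENNReal.ofReal (r ^ (d - 1)) * (Iio c).indicator 1 r) := by
        intro r hr
        have hr0 : (0 : ℝ) < r := hr
        have hmem : r • (σ : Euc d) ∈ s := by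
          simp only [hs, mem_ofPred_eq, inner_smul_left, hc']
          exact mul_pos hr0 hc
        rw [indicator_of_mem hmem]
        simp only [hF, norm_smul, hσ, mul_one, Real.norm_of_nonneg hr0.le, inner_smul_left, hc',
          RCLike.conj_to_real]
        have e1 : r / (r * c) = 1 / c := by field_simp
        have e2 : r * c / r = c := by field_simp
        have e3 : r ^ 2 / (r * c) = r / c := by field_simp
        rw [e1, e2, e3]
        have e4 : (Iio (1 : ℝ)).indicator (1 : ℝ → ENNReal) (r / c) = (Iio c).indicator 1 r := by
          simp only [indicator_apply, mem_Iio, div_lt_one hc]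
          rfl
        rw [e4]
        ring
      rw [setLIntegral_congr_fun measurableSet_Ioi h5, lintegral_const_mul _ ?_,
        setLIntegral_Ioi_pow_mul_indicator hd1 hc.le, indicator_of_mem (by exact hc)]
      · rw [← hcdef, div_eq_mul_one_div (c ^ d), ENNReal.ofReal_mul (p := c ^ d) (by positivity),
          ENNReal.ofReal_mul (p := 2 ^ (d - 1) * (1 / c) ^ 2) (by positivity)]
        ring
      · exact Measurable.mul (by fun_prop) (measurable_one.indicator measurableSet_Iio)
    · rw [indicator_of_notMem (by exact hc), zero_mul]
      rw [setLIntegral_congr_fun (g := 0) measurableSet_Ioi]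
      · simp
      · intro r hr
        have : r • (σ : Euc d) ∉ s := by
          simp only [hs, mem_ofPred_eq, inner_smul_left]
          rw [real_inner_comm]
          exact fun h => hc (pos_of_mul_pos_right h (le_of_lt hr))
        simp [indicator_of_notMem this]
  simp_rw [h4] at h1
  rw [lintegral_mul_const'' _ ?_] at h1
  · exact ((ENNReal.mul_left_inj (ofReal_one_div_ne hd1) ENNReal.ofReal_ne_top).1 h1).symm
  · refine (Measurable.indicator ?_ ?_).aemeasurable
    · exact Measurable.mul (by fun_prop) (hG.comp (by fun_prop))
    · exact (isOpen_lt continuous_const (by fun_prop)).measurableSet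

/-! ### Integrals over collisions -/

instance : IsFiniteMeasure (surfaceMeasure d) := by
  unfold surfaceMeasure; infer_instance

/-- The half sum `(z + |z| σ) / 2`; it is `v - v_*'` for `z = v - v_*`, and `v - v'` is obtained by
changing the sign of `σ`. -/
noncomputable def halfSum (z σ : Euc d) : Euc d := (1 / 2 : ℝ) • (z + ‖z‖ • σ)

/-- The integral of `|z|^γ β(sin(θ/2)) H(v - v_*', v - v')` over all collisions. -/
noncomputable def kineticIntegral (γ : ℝ) (β : ℝ → ENNReal) (H : Euc d → Euc d → ENNReal) :
    ENNReal :=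
  ∫⁻ z : Euc d, ∫⁻ σ : UnitSphere d, ENNReal.ofReal (‖z‖ ^ γ) * β (sinHalf z σ) *
    H (halfSum z σ) (halfSum z (-σ)) ∂(surfaceMeasure d)

lemma measurable_kineticIntegrand {γ : ℝ} {β : ℝ → ENNReal} (hβ : Measurable β)
    {H : Euc d → Euc d → ENNReal} (hH : Measurable (Function.uncurry H)) :
    Measurable fun p : Euc d × UnitSphere d => ENNReal.ofReal (‖p.1‖ ^ γ) * β (sinHalf p.1 p.2) *
      H (halfSum p.1 p.2) (halfSum p.1 (-p.2)) := by
  refine Measurable.mul (Measurable.mul (by fun_prop) (hβ.comp measurable_sinHalf)) ?_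
  have h1 : Measurable fun p : Euc d × UnitSphere d => halfSum p.1 p.2 := by
    unfold halfSum; fun_prop
  have h2 : Measurable fun p : Euc d × UnitSphere d => halfSum p.1 (-p.2) := by
    unfold halfSum; fun_prop
  exact hH.comp (h1.prodMk h2)

lemma kineticIntegral_add_left {γ : ℝ} {β β' : ℝ → ENNReal} (hβ : Measurable β)
    {H : Euc d → Euc d → ENNReal} (hH : Measurable (Function.uncurry H)) :
    kineticIntegral γ (fun s => β s + β' s) H
      = kineticIntegral γ β H + kineticIntegral γ β' H := by
  have hm := measurable_kineticIntegrand (γ := γ) hβ hH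
  unfold kineticIntegral
  rw [← lintegral_add_left hm.lintegral_prod_right']
  refine lintegral_congr fun z => ?_
  have hz := hm.comp (measurable_prodMk_left (x := z))
  simp only [Function.comp_def] at hz
  rw [← lintegral_add_left hz]
  refine lintegral_congr fun σ => ?_
  ring

lemma kineticIntegral_add_right {γ : ℝ} {β : ℝ → ENNReal} (hβ : Measurable β)
    {H H' : Euc d → Euc d → ENNReal} (hH : Measurable (Function.uncurry H)) :
    kineticIntegral γ β (fun y w => H y w + H' y w)
      = kineticIntegral γ β H + kineticIntegral γ β H' := by
  have hm := measurable_kineticIntegrand (γ := γ) hβ hH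
  unfold kineticIntegral
  rw [← lintegral_add_left hm.lintegral_prod_right']
  refine lintegral_congr fun z => ?_
  have hz := hm.comp (measurable_prodMk_left (x := z))
  simp only [Function.comp_def] at hz
  rw [← lintegral_add_left hz]
  refine lintegral_congr fun σ => ?_
  ring

lemma kineticIntegral_mono {γ : ℝ} {β : ℝ → ENNReal} {H H' : Euc d → Euc d → ENNReal}
    (h : ∀ y w, H y w ≤ H' y w) : kineticIntegral γ β H ≤ kineticIntegral γ β H' :=
  lintegral_mono fun _ => lintegral_mono fun _ => mul_le_mul_right (h _ _) _

lemma lintegral_sphere_neg (hd : 1 ≤ d) {g : UnitSphere d → ENNReal} (hg : Measurable g) :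
    ∫⁻ σ, g (-σ) ∂(surfaceMeasure d) = ∫⁻ σ, g σ ∂(surfaceMeasure d) := by
  classical
  set g' : Euc d → ENNReal := fun x => if hx : x ∈ Metric.sphere (0 : Euc d) 1 then g ⟨x, hx⟩ else 0
    with hg'
  have hm : Measurable g' := by
    refine Measurable.dite (s := Metric.sphere (0 : Euc d) 1) (f := fun x => g x) (g := fun _ => 0)
      hg measurable_const Metric.isClosed_sphere.measurableSet
  refine Eq.trans (lintegral_congr fun σ => ?_)
    ((lintegral_sphere_comp_isometry hd (LinearIsometryEquiv.neg ℝ) hm).trans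
      (lintegral_congr fun σ => ?_))
  · have : (LinearIsometryEquiv.neg ℝ (σ : Euc d)) ∈ Metric.sphere (0 : Euc d) 1 := by simp
    simp only [hg', dif_pos this]
    rfl
  · simp only [hg', dif_pos σ.2]

/-- Exchanging the two outgoing velocities. -/
lemma kineticIntegral_swap (hd : 1 ≤ d) {γ : ℝ} {β : ℝ → ENNReal} (hβ : Measurable β)
    {H : Euc d → Euc d → ENNReal} (hH : Measurable (Function.uncurry H)) :
    kineticIntegral γ β (fun y w => H w y)
      = kineticIntegral γ (fun s => β (Real.sqrt (1 - s ^ 2))) H := by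
  unfold kineticIntegral
  refine lintegral_congr fun z => ?_
  have hβ' : Measurable fun s : ℝ => β (Real.sqrt (1 - s ^ 2)) := hβ.comp (by fun_prop)
  have hm := (measurable_kineticIntegrand (γ := γ) hβ' hH).comp (measurable_prodMk_left (x := z))
  simp only [Function.comp_def] at hm
  refine Eq.trans (lintegral_congr fun σ => ?_) (lintegral_sphere_neg hd hm)
  have h1 : Real.sqrt (1 - sinHalf z (-σ) ^ 2) = sinHalf z σ := by
    rw [← sinHalf_neg, neg_neg]
  simp only [h1]
  simp

/-- The component `y - (|y|² / ⟨y, σ⟩) σ` of the preimage of `y`, orthogonal to `y`. -/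
noncomputable def perpVel (y σ : Euc d) : Euc d := y - (‖y‖ ^ 2 / inner ℝ y σ) • σ

/-- The collision integral in the variables `y = v - v_*'` and `σ`. -/
lemma kineticIntegral_eq (hd : 2 ≤ d) {γ : ℝ} {β : ℝ → ENNReal} (hβ : Measurable β)
    {H : Euc d → Euc d → ENNReal} (hH : Measurable (Function.uncurry H)) :
    kineticIntegral γ β H = ∫⁻ y : Euc d, ∫⁻ σ : UnitSphere d,
      {p : Euc d × UnitSphere d | 0 < inner ℝ p.1 (p.2 : Euc d)}.indicator (fun p =>
        ENNReal.ofReal (2 ^ (d - 1) * (‖p.1‖ / inner ℝ p.1 (p.2 : Euc d)) ^ 2 *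
          (‖p.1‖ ^ 2 / inner ℝ p.1 (p.2 : Euc d)) ^ γ) *
        β (Real.sqrt (1 - (inner ℝ p.1 (p.2 : Euc d) / ‖p.1‖) ^ 2)) *
        H p.1 (perpVel p.1 p.2)) (y, σ) ∂(surfaceMeasure d) := by
  have hopen : MeasurableSet {p : Euc d × UnitSphere d | 0 < inner ℝ p.1 (p.2 : Euc d)} :=
    (isOpen_lt continuous_const (by fun_prop)).measurableSet
  have hm := measurable_kineticIntegrand (γ := γ) hβ hH
  unfold kineticIntegral
  have hperp : Measurable fun p : Euc d × UnitSphere d => perpVel p.1 p.2 := by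
    unfold perpVel; fun_prop
  have hm' : Measurable fun p : Euc d × UnitSphere d =>
      {p : Euc d × UnitSphere d | 0 < inner ℝ p.1 (p.2 : Euc d)}.indicator (fun p =>
        ENNReal.ofReal (2 ^ (d - 1) * (‖p.1‖ / inner ℝ p.1 (p.2 : Euc d)) ^ 2 *
          (‖p.1‖ ^ 2 / inner ℝ p.1 (p.2 : Euc d)) ^ γ) *
        β (Real.sqrt (1 - (inner ℝ p.1 (p.2 : Euc d) / ‖p.1‖) ^ 2)) *
        H p.1 (perpVel p.1 p.2)) p := by
    refine Measurable.indicator (Measurable.mul (Measurable.mul (by fun_prop)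
      (hβ.comp (by fun_prop))) ?_) hopen
    exact hH.comp (measurable_fst.prodMk hperp)
  -- The substitution acts on z at fixed σ, so the order of integration is exchanged before it and
  -- restored after it.
  refine (lintegral_lintegral_swap hm.aemeasurable).trans (Eq.trans ?_
    (lintegral_lintegral_swap hm'.aemeasurable).symm)
  refine lintegral_congr fun σ => ?_
  have hσ : ‖(σ : Euc d)‖ = 1 := by simp
  have hs : MeasurableSet {y : Euc d | 0 < inner ℝ y (σ : Euc d)} :=
    (isOpen_lt continuous_const (by fun_prop)).measurableSet
  rw [lintegral_eq_lintegral_unfoldVel hd hσ, ← lintegral_indicator hs]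
  refine lintegral_congr fun y => ?_
  by_cases hy : 0 < inner ℝ y (σ : Euc d)
  · rw [indicator_of_mem (by exact hy), indicator_of_mem (by exact hy)]
    have h1 : halfSum (unfoldVel σ y) σ = y := half_unfoldVel_add hσ hy
    have h2 : halfSum (unfoldVel σ y) (-σ) = perpVel y σ := by
      rw [halfSum, norm_sq_unfoldVel hσ hy, unfoldVel, perpVel]
      module
    simp only [h1, h2, sinHalf_unfoldVel σ hy, norm_sq_unfoldVel hσ hy]
    rw [ENNReal.ofReal_mul (p := 2 ^ (d - 1) * (‖y‖ / inner ℝ y (σ : Euc d)) ^ 2)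
      (q := (‖y‖ ^ 2 / inner ℝ y (σ : Euc d)) ^ γ) (by positivity)]
    ring
  · rw [indicator_of_notMem (by exact hy), indicator_of_notMem (by exact hy)]

lemma inner_perpVel (y σ : Euc d) (h : inner ℝ y σ ≠ 0) : inner ℝ y (perpVel y σ) = 0 := by
  rw [perpVel, inner_sub_right, inner_smul_right, real_inner_self_eq_norm_sq]
  field_simp
  ring

lemma norm_perpVel_sq (y σ : Euc d) (hσ : ‖σ‖ = 1) (h : 0 < inner ℝ y σ) :
    ‖perpVel y σ‖ ^ 2 = ‖y‖ ^ 2 * (1 / (inner ℝ y σ / ‖y‖) ^ 2 - 1) := by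
  have hy0 : ‖y‖ ≠ 0 := by
    intro h0
    rw [norm_eq_zero.1 h0] at h
    simp at h
  rw [perpVel, norm_sub_sq_real, inner_smul_right, norm_smul, hσ, mul_one, Real.norm_eq_abs, sq_abs]
  field_simp
  ring

/-- Averages over the sphere of functions of the angle to `y` and of `perpVel y σ` may be
symmetrized in the latter. -/
lemma lintegral_perpVel_neg (hd : 1 ≤ d) (y : Euc d) {G : ℝ → Euc d → ENNReal}
    (hG : Measurable (Function.uncurry G)) (h0 : ∀ w, G 0 w = 0) :
    ∫⁻ σ : UnitSphere d, G (inner ℝ y (σ : Euc d)) (-perpVel y σ) ∂(surfaceMeasure d)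
      = ∫⁻ σ : UnitSphere d, G (inner ℝ y (σ : Euc d)) (perpVel y σ) ∂(surfaceMeasure d) := by
  -- This reflection fixes the line ℝy and changes the sign on its orthogonal complement, so it
  -- preserves ⟨y,σ⟩ and reverses `perpVel y σ`.
  set U := (Submodule.span ℝ {y}).reflection with hU
  have hUy : U y = y := Submodule.reflection_mem_subspace_eq_self
    (Submodule.mem_span_singleton_self y)
  have hinner : ∀ σ, inner ℝ y (U σ) = inner ℝ y σ := fun σ => by
    conv_lhs => rw [← hUy]
    exact U.inner_map_map y σ
  have hm : Measurable fun σ : Euc d => G (inner ℝ y σ) (perpVel y σ) := by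
    refine hG.comp (Measurable.prodMk (by fun_prop) ?_)
    exact (by fun_prop : Measurable fun σ : Euc d => y - (‖y‖ ^ 2 / inner ℝ y σ) • σ)
  rcases eq_or_ne y 0 with rfl | hy
  · simp [perpVel]
  refine Eq.trans (lintegral_congr fun σ => ?_) (lintegral_sphere_comp_isometry hd U hm)
  rw [hinner]
  -- Here division by zero gives `perpVel y σ` = y, which is not orthogonal to y; the assumption
  -- `h0` removes this case.
  by_cases hi : inner ℝ y (σ : Euc d) = 0
  · simp only [h0, hi]
  congr 1
  have hy' : ‖y‖ ≠ 0 := norm_ne_zero_iff.2 hy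
  have hUσ : U σ = (2 * (inner ℝ y (σ : Euc d) / ‖y‖ ^ 2)) • y - (σ : Euc d) := by
    rw [hU, Submodule.reflection_singleton_apply, mul_smul, ← ofNat_smul_eq_nsmul ℝ]
    simp
  rw [perpVel, perpVel, hinner, hUσ, smul_sub, smul_smul]
  have : ‖y‖ ^ 2 / inner ℝ y (σ : Euc d) * (2 * (inner ℝ y (σ : Euc d) / ‖y‖ ^ 2)) = 2 := by
    field_simp
  rw [this]
  module

/-! ### Pointwise inequalities for polynomial weights -/

/-- A second-order Taylor bound with explicit remainder, from log(1+t) ≥ t - 2t² and e^x ≤ 1 + x +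
x² for |x| ≤ 1; the range of t ensures the latter. The linear term is kept exact because it cancels
in symmetric means. -/
lemma one_add_rpow_neg_le {s t : ℝ} (hs : 0 ≤ s) (ht : |t| ≤ 1 / (2 * s + 2)) :
    (1 + t) ^ (-s) ≤ 1 - s * t + (2 * s + 4 * s ^ 2) * t ^ 2 := by
  have hs2 : 0 < 2 * s + 2 := by linarith
  have h1 : 1 / (2 * s + 2) ≤ 1 / 2 := one_div_le_one_div_of_le (by norm_num) (by linarith)
  have htabs := abs_le.1 (ht.trans h1)
  have htp : 0 < 1 + t := by linarith [htabs.1]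
  have hlog : t - 2 * t ^ 2 ≤ Real.log (1 + t) := by
    refine le_trans ?_ (Real.one_sub_inv_le_log_of_pos htp)
    have : 1 - (1 + t)⁻¹ = t / (1 + t) := by field_simp; ring
    rw [this, le_div_iff₀ htp]
    nlinarith [sq_nonneg t, mul_nonneg (sq_nonneg t) (by linarith [htabs.1] : 0 ≤ 1 + 2 * t)]
  set x := -s * t + 2 * s * t ^ 2 with hx
  have hxabs : |x| ≤ 2 * s * |t| := by
    have h2 : x = -(s * t) * (1 - 2 * t) := by rw [hx]; ring
    rw [h2, abs_mul, abs_neg, abs_mul, abs_of_nonneg hs]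
    have : |1 - 2 * t| ≤ 2 := abs_le.2 ⟨by linarith [htabs.2], by linarith [htabs.1]⟩
    have h0 : 0 ≤ s * |t| := by positivity
    nlinarith
  have hx1 : |x| ≤ 1 := by
    refine hxabs.trans ?_
    calc 2 * s * |t| ≤ 2 * s * (1 / (2 * s + 2)) := by gcongr
      _ ≤ 1 := by rw [mul_one_div, div_le_one hs2]; linarith
  have hx2 : x ^ 2 ≤ 4 * s ^ 2 * t ^ 2 := by
    have := mul_self_le_mul_self (abs_nonneg x) hxabs
    rw [abs_mul_abs_self] at this
    calc x ^ 2 = x * x := sq x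
      _ ≤ _ := this
      _ = 4 * s ^ 2 * (|t| * |t|) := by ring
      _ = _ := by rw [abs_mul_abs_self]; ring
  have hexp := abs_le.1 (Real.abs_exp_sub_one_sub_id_le hx1)
  calc (1 + t) ^ (-s) = Real.exp (Real.log (1 + t) * -s) := Real.rpow_def_of_pos htp _
    _ ≤ Real.exp x := by
      apply Real.exp_le_exp.2
      have := mul_le_mul_of_nonneg_left hlog hs
      rw [hx]; linarith
    _ ≤ 1 + x + x ^ 2 := by linarith [hexp.2]
    _ ≤ _ := by rw [hx] at hx2 ⊢; linarith

/-- Serves to absorb a small multiplicative error into a small power of 1 + X. -/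
lemma one_add_mul_div_le_rpow {X η : ℝ} (hX : 0 ≤ X) (hη : 0 ≤ η) :
    1 + η * (X / (1 + X)) ≤ (1 + X) ^ η := by
  have hp : 0 < 1 + X := by linarith
  have h1 := Real.one_sub_inv_le_log_of_pos hp
  have h2 : 1 - (1 + X)⁻¹ = X / (1 + X) := by field_simp; ring
  rw [h2] at h1
  rw [Real.rpow_def_of_pos hp]
  have := Real.add_one_le_exp (Real.log (1 + X) * η)
  nlinarith

lemma bracket_rpow_neg_eq (v : Euc d) (m : ℝ) : bracket v ^ (-m) = (bracket v ^ 2) ^ (-(m / 2)) := by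
  rw [← Real.rpow_natCast, ← Real.rpow_mul (bracket_pos v).le]
  congr 1; push_cast; ring

lemma bracket_sub_sq (v w : Euc d) : bracket (v - w) ^ 2 =
    bracket v ^ 2 * (1 + ‖w‖ ^ 2 / bracket v ^ 2 + -(2 * inner ℝ v w / bracket v ^ 2)) := by
  have := bracket_pos v
  rw [bracket_sq (v - w), norm_sub_sq_real]
  field_simp
  rw [bracket_sq]; ring

lemma bracket_add_sq (v w : Euc d) : bracket (v + w) ^ 2 =
    bracket v ^ 2 * (1 + ‖w‖ ^ 2 / bracket v ^ 2 + 2 * inner ℝ v w / bracket v ^ 2) := by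
  have := bracket_pos v
  rw [bracket_sq (v + w), norm_add_sq_real]
  field_simp
  rw [bracket_sq]; ring

/-- Since ⟨v-y⟩ ≥ 1, the hypothesis forces κ⟨v⟩ > 1, so |v| is comparable to ⟨v⟩ with constant near
one; the triangle inequality then does the same for |y|. -/
lemma norm_sq_ge_of_bracket_sub_lt {κ : ℝ} (hκ0 : 0 < κ) (hκ4 : κ < 1 / 4) (v y : Euc d)
    (hlow : bracket (v - y) < κ * bracket v) : (1 - 4 * κ) * bracket v ^ 2 ≤ ‖y‖ ^ 2 := by
  have hbv := bracket_pos v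
  have h1 : 1 < κ * bracket v := (one_le_bracket _).trans_lt hlow
  have h2 : ‖v‖ ^ 2 = bracket v ^ 2 - 1 := by rw [bracket_sq]; ring
  have h3 : (1 - κ) * bracket v ≤ ‖v‖ := by
    refine (sq_le_sq₀ (mul_nonneg (by linarith) hbv.le) (norm_nonneg _)).1 ?_
    rw [h2]
    have e1 : 1 ≤ (κ * bracket v) ^ 2 := one_le_pow₀ h1.le
    have e2 : (κ * bracket v) ^ 2 ≤ κ * bracket v ^ 2 := by
      rw [mul_pow]; gcongr; nlinarith
    calc ((1 - κ) * bracket v) ^ 2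
        = bracket v ^ 2 - 2 * (κ * bracket v ^ 2) + (κ * bracket v) ^ 2 := by ring
      _ ≤ _ := by linarith
  have h4 : (1 - 2 * κ) * bracket v ≤ ‖y‖ := by
    have h5 : ‖v‖ ≤ ‖v - y‖ + ‖y‖ := by simpa using norm_add_le (v - y) y
    have h6 := norm_le_bracket (v - y)
    linarith
  have h5 : 0 ≤ (1 - 2 * κ) * bracket v := mul_nonneg (by linarith) hbv.le
  calc (1 - 4 * κ) * bracket v ^ 2 ≤ ((1 - 2 * κ) * bracket v) ^ 2 := by
        rw [mul_pow]; gcongr; linarith [sq_nonneg κ]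
    _ ≤ _ := by gcongr

/-- If `v - y` is much smaller than `v` and `w ⊥ y` has size `|y| tan α`, the mean of the weight at
`v ± w` is at most `(cos α)^k` times the weight at `v`, for any `k < m`. -/
lemma exists_low_velocity_bound {m k : ℝ} (hk : 0 < k) (hkm : k < m) :
    ∃ κ : ℝ, 0 < κ ∧ κ < 1 / 4 ∧ ∀ (d : ℕ) (v y w : Euc d) (c : ℝ), 0 < c → c ≤ 1 →
      inner ℝ y w = 0 → ‖w‖ ^ 2 = ‖y‖ ^ 2 * (1 / c ^ 2 - 1) →
      bracket (v - y) < κ * bracket v →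
      (bracket (v - w) ^ (-m) + bracket (v + w) ^ (-m)) / 2 ≤ c ^ k * bracket v ^ (-m) := by
  set s := m / 2 with hs
  have hs0 : 0 < s := by rw [hs]; linarith
  set K := 2 * s + 4 * s ^ 2 with hK
  have hK0 : 0 < K := by positivity
  -- All these conditions hold as κ → 0⁺; the last one because its right-hand side tends to 2s = m >
  -- k.
  obtain ⟨κ, hκ0, hκ4, hκs, hκη, hκk⟩ : ∃ κ : ℝ, 0 < κ ∧ κ < 1 / 4 ∧ κ < 1 / (2 * s + 2) ∧
      4 * K * κ ^ 2 < s ∧ k < 2 * (1 - 4 * κ) * (s - 4 * K * κ ^ 2) := by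
    have h1 : ∀ᶠ κ : ℝ in 𝓝[>] 0, 0 < κ := self_mem_nhdsWithin
    have h2 : ∀ᶠ κ : ℝ in 𝓝[>] 0, κ < 1 / 4 :=
      nhdsWithin_le_nhds (gt_mem_nhds (by norm_num))
    have h3 : ∀ᶠ κ : ℝ in 𝓝[>] 0, κ < 1 / (2 * s + 2) :=
      nhdsWithin_le_nhds (gt_mem_nhds (by positivity))
    have h4 : ∀ᶠ κ : ℝ in 𝓝[>] 0, 4 * K * κ ^ 2 < s := by
      have : Tendsto (fun κ : ℝ => 4 * K * κ ^ 2) (𝓝[>] 0) (𝓝 (4 * K * 0 ^ 2)) :=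
        ((by fun_prop : Continuous fun κ : ℝ => 4 * K * κ ^ 2).tendsto 0).mono_left nhdsWithin_le_nhds
      exact this.eventually_lt_const (by simpa using hs0)
    have h5 : ∀ᶠ κ : ℝ in 𝓝[>] 0, k < 2 * (1 - 4 * κ) * (s - 4 * K * κ ^ 2) := by
      have : Tendsto (fun κ : ℝ => 2 * (1 - 4 * κ) * (s - 4 * K * κ ^ 2)) (𝓝[>] 0)
          (𝓝 (2 * (1 - 4 * 0) * (s - 4 * K * 0 ^ 2))) :=
        ((by fun_prop : Continuous fun κ : ℝ => 2 * (1 - 4 * κ) * (s - 4 * K * κ ^ 2)).tendsto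
          0).mono_left nhdsWithin_le_nhds
      exact this.eventually_const_lt (by rw [hs]; linarith)
    obtain ⟨κ, hκ⟩ := (h1.and (h2.and (h3.and (h4.and h5)))).exists
    exact ⟨κ, hκ⟩
  refine ⟨κ, hκ0, hκ4, fun d v y w c hc0 hc1 hyw hw hlow => ?_⟩
  set p := bracket v ^ 2 with hp
  have hbv := bracket_pos v
  have hp0 : 0 < p := by positivity
  set X := ‖w‖ ^ 2 / p with hX
  set Y := 2 * inner ℝ v w / p with hY
  have hX0 : 0 ≤ X := by positivity
  set A := 1 + X with hA
  have hA0 : 0 < A := by positivity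
  have hu : ‖v - y‖ ≤ κ * bracket v := (norm_le_bracket _).trans hlow.le
  -- Since w ⊥ y, the cross term ⟨v,w⟩ equals ⟨v-y,w⟩, which is small because v - y is.
  have hYsq : Y ^ 2 ≤ 4 * κ ^ 2 * X := by
    have h1 : inner ℝ v w = inner ℝ (v - y) w := by rw [inner_sub_left, hyw, sub_zero]
    have h2 : |inner ℝ (v - y) w| ≤ κ * bracket v * ‖w‖ :=
      (abs_real_inner_le_norm _ _).trans (by gcongr)
    have h3 : inner ℝ (v - y) w ^ 2 ≤ (κ * bracket v * ‖w‖) ^ 2 := sq_le_sq.2 (by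
      rwa [abs_of_nonneg (by positivity : 0 ≤ κ * bracket v * ‖w‖)])
    rw [hY, h1, hX, div_pow, mul_pow, ← mul_div_assoc, div_le_div_iff₀ (by positivity) hp0]
    calc 2 ^ 2 * inner ℝ (v - y) w ^ 2 * p ≤ 2 ^ 2 * (κ * bracket v * ‖w‖) ^ 2 * p := by gcongr
      _ = _ := by rw [hp]; ring
  set t := Y / A with ht
  have htsq : t ^ 2 ≤ 4 * κ ^ 2 * (X / A) := by
    rw [ht, div_pow, ← mul_div_assoc, div_le_div_iff₀ (by positivity) hA0]
    have : 4 * κ ^ 2 * X * A ^ 2 = 4 * κ ^ 2 * X * A * A := by ring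
    have hA1 : 1 ≤ A := by rw [hA]; linarith
    have h0 : 0 ≤ 4 * κ ^ 2 * X := by positivity
    calc Y ^ 2 * A ≤ 4 * κ ^ 2 * X * A := by gcongr
      _ ≤ 4 * κ ^ 2 * X * A * A := le_mul_of_one_le_right (by positivity) hA1
      _ = _ := by ring
  have htabs : |t| ≤ κ := by
    have h1 : X / A ^ 2 ≤ 1 / 4 := by
      rw [div_le_div_iff₀ (by positivity) (by norm_num), hA]
      nlinarith [sq_nonneg (1 - X)]
    have h2 : t ^ 2 ≤ κ ^ 2 := by
      rw [ht, div_pow]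
      calc Y ^ 2 / A ^ 2 ≤ 4 * κ ^ 2 * X / A ^ 2 := by gcongr
        _ = 4 * κ ^ 2 * (X / A ^ 2) := by ring
        _ ≤ 4 * κ ^ 2 * (1 / 4) := by gcongr
        _ = κ ^ 2 := by ring
    exact abs_le_of_sq_le_sq h2 hκ0.le
  have hT1 := one_add_rpow_neg_le hs0.le (htabs.trans hκs.le)
  have hT2 := one_add_rpow_neg_le (t := -t) hs0.le (by rw [abs_neg]; exact htabs.trans hκs.le)
  have htlt := abs_le.1 htabs
  have hsub : bracket (v - w) ^ 2 = p * (A * (1 + -t)) := by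
    have : A * (1 + -t) = A + -Y := by rw [ht]; field_simp
    rw [this]; exact bracket_sub_sq v w
  have hadd : bracket (v + w) ^ 2 = p * (A * (1 + t)) := by
    have : A * (1 + t) = A + Y := by rw [ht]; field_simp
    rw [this]; exact bracket_add_sq v w
  have ht1 : 0 ≤ 1 + -t := by linarith only [htlt.2, hκ4]
  have ht2 : 0 ≤ 1 + t := by linarith only [htlt.1, hκ4]
  have e1 : bracket (v - w) ^ (-m) = bracket v ^ (-m) * (A ^ (-s) * (1 + -t) ^ (-s)) := by
    rw [bracket_rpow_neg_eq, hsub, bracket_rpow_neg_eq v, ← hp,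
      Real.mul_rpow hp0.le (mul_nonneg hA0.le ht1), Real.mul_rpow hA0.le ht1]
  have e2 : bracket (v + w) ^ (-m) = bracket v ^ (-m) * (A ^ (-s) * (1 + t) ^ (-s)) := by
    rw [bracket_rpow_neg_eq, hadd, bracket_rpow_neg_eq v, ← hp,
      Real.mul_rpow hp0.le (mul_nonneg hA0.le ht2), Real.mul_rpow hA0.le ht2]
  set η := 4 * K * κ ^ 2 with hη
  have hη0 : 0 ≤ η := by positivity
  -- Averaging over ±w cancels the linear term, and the quadratic remainder costs only the small
  -- power η of A.
  have havg : ((1 + -t) ^ (-s) + (1 + t) ^ (-s)) / 2 ≤ A ^ η := by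
    refine le_trans ?_ (one_add_mul_div_le_rpow hX0 hη0)
    have : ((1 + -t) ^ (-s) + (1 + t) ^ (-s)) / 2 ≤ 1 + K * t ^ 2 := by
      have : (-t) ^ 2 = t ^ 2 := by ring
      rw [this] at hT2
      linarith
    refine this.trans ?_
    have := mul_le_mul_of_nonneg_left htsq hK0.le
    rw [hη]
    linarith
  have hylow : (1 - 4 * κ) * p ≤ ‖y‖ ^ 2 := norm_sq_ge_of_bracket_sub_lt hκ0 hκ4 v y hlow
  -- Bernoulli's inequality with exponent 1 - 4κ converts |w|² = |y|² tan² α and |y|² ≥ (1-4κ)⟨v⟩²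
  -- into a power of 1/cos² α = 1 + tan² α.
  have hcpow : (c ^ 2)⁻¹ ^ (1 - 4 * κ) ≤ A := by
    set τ := 1 / c ^ 2 - 1 with hτ
    have hτ0 : 0 ≤ τ := by
      rw [hτ, sub_nonneg, one_le_div (by positivity)]
      exact pow_le_one₀ hc0.le hc1
    have h1 : (c ^ 2)⁻¹ = 1 + τ := by rw [hτ]; ring
    rw [h1]
    refine (rpow_one_add_le_one_add_mul_self (by linarith) (by linarith) (by linarith)).trans ?_
    have : (1 - 4 * κ) * τ ≤ X := by
      rw [hX, le_div_iff₀ hp0, hw]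
      calc (1 - 4 * κ) * τ * p = (1 - 4 * κ) * p * τ := by ring
        _ ≤ ‖y‖ ^ 2 * τ := by gcongr
    rw [hA]; linarith
  have hfin : A ^ (-s) * A ^ η ≤ c ^ k := by
    rw [← Real.rpow_add hA0]
    have hneg : -s + η ≤ 0 := by linarith
    calc A ^ (-s + η) ≤ ((c ^ 2)⁻¹ ^ (1 - 4 * κ)) ^ (-s + η) :=
          Real.rpow_le_rpow_of_nonpos (by positivity) hcpow hneg
      _ = c ^ (2 * (1 - 4 * κ) * (s - η)) := by
          rw [← Real.rpow_natCast c 2, ← Real.rpow_neg hc0.le, ← Real.rpow_mul hc0.le,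
            ← Real.rpow_mul hc0.le]
          congr 1; push_cast; ring
      _ ≤ c ^ k := Real.rpow_le_rpow_of_exponent_ge hc0 hc1 hκk.le
  rw [e1, e2]
  have hb : 0 ≤ bracket v ^ (-m) := by positivity
  calc (bracket v ^ (-m) * (A ^ (-s) * (1 + -t) ^ (-s)) +
        bracket v ^ (-m) * (A ^ (-s) * (1 + t) ^ (-s))) / 2
      = bracket v ^ (-m) * (A ^ (-s) * (((1 + -t) ^ (-s) + (1 + t) ^ (-s)) / 2)) := by ring
    _ ≤ bracket v ^ (-m) * (A ^ (-s) * A ^ η) := by gcongr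
    _ ≤ bracket v ^ (-m) * c ^ k := by gcongr
    _ = _ := by ring

/-- The weight restricted to velocities that are not much smaller than `v`. -/
noncomputable def highWeight (κ m : ℝ) (v u : Euc d) : ℝ :=
  open Classical in if κ * bracket v ≤ bracket u then bracket u ^ (-m) else 0

lemma highWeight_nonneg (κ m : ℝ) (v u : Euc d) : 0 ≤ highWeight κ m v u := by
  unfold highWeight
  have := bracket_pos u
  split_ifs <;> positivity

lemma highWeight_le (κ m : ℝ) (v u : Euc d) : highWeight κ m v u ≤ bracket u ^ (-m) := by
  unfold highWeight
  have := bracket_pos u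
  split_ifs
  · exact le_rfl
  · positivity

lemma highWeight_le_mul {κ m : ℝ} (hκ : 0 < κ) (hm : 0 ≤ m) (v u : Euc d) :
    highWeight κ m v u ≤ κ ^ (-m) * bracket v ^ (-m) := by
  unfold highWeight
  have hv := bracket_pos v
  split_ifs with h
  · rw [← Real.mul_rpow hκ.le hv.le]
    exact Real.rpow_le_rpow_of_nonpos (by positivity) h (by linarith)
  · positivity

/-- For |w| ≤ δ⟨v⟩ the linear Taylor terms cancel. For larger w the ratio |w|²/⟨v⟩² is at least δ²,
while the truncation keeps the weight below κ^{-m}⟨v⟩^{-m}. -/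
lemma exists_highWeight_mean_le {m κ : ℝ} (hm : 0 ≤ m) (hκ : 0 < κ) :
    ∃ K : ℝ, 0 ≤ K ∧ ∀ (d : ℕ) (v w : Euc d),
      (highWeight κ m v (v - w) + highWeight κ m v (v + w)) / 2 ≤
        (1 + K * (‖w‖ ^ 2 / bracket v ^ 2)) * bracket v ^ (-m) := by
  set s := m / 2 with hs
  have hs0 : 0 ≤ s := by positivity
  set K₀ := 2 * s + 4 * s ^ 2 with hK
  have hK0 : 0 ≤ K₀ := by positivity
  -- The relative perturbation of the squared bracket is at most 3δ, which puts it exactly in the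
  -- range of the Taylor bound.
  set δ := 1 / (2 * s + 2) / 3 with hδ
  have hδ0 : 0 < δ := by positivity
  have hδ1 : δ ≤ 1 := by
    rw [hδ, div_div, div_le_one (by positivity)]; linarith
  refine ⟨9 * K₀ + κ ^ (-m) / δ ^ 2, by positivity, fun d v w => ?_⟩
  have hbv := bracket_pos v
  set p := bracket v ^ 2 with hp
  have hp0 : 0 < p := by positivity
  set X := ‖w‖ ^ 2 / p with hX
  set Y := 2 * inner ℝ v w / p with hY
  have hX0 : 0 ≤ X := by positivity
  have hφ : 0 ≤ bracket v ^ (-m) := by positivity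
  have hκm : 0 ≤ κ ^ (-m) := by positivity
  by_cases hw : ‖w‖ ≤ δ * bracket v
  · set r := ‖w‖ / bracket v with hr
    have hr0 : 0 ≤ r := by positivity
    have hXr : X = r ^ 2 := by rw [hX, hr, hp, div_pow]
    have hrδ : r ≤ δ := by rw [hr, div_le_iff₀ hbv]; exact hw
    have hYabs : |Y| ≤ 2 * r := by
      rw [hY, abs_div, abs_of_pos hp0, div_le_iff₀ hp0, abs_mul, abs_of_pos (by norm_num : (0:ℝ) < 2)]
      calc 2 * |inner ℝ v w| ≤ 2 * (‖v‖ * ‖w‖) := by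
            gcongr; exact abs_real_inner_le_norm _ _
        _ ≤ 2 * (bracket v * ‖w‖) := by gcongr; exact norm_le_bracket v
        _ = 2 * r * p := by rw [hr, hp]; field_simp
    have hr2 : r ^ 2 ≤ r := by nlinarith
    have h1 : ∀ Z : ℝ, |Z| ≤ 2 * r → |X + Z| ≤ 3 * r := fun Z hZ => by
      refine (abs_add_le _ _).trans ?_
      rw [abs_of_nonneg hX0, hXr]; linarith
    have h3r : 3 * r ≤ 1 / (2 * s + 2) := by rw [hδ] at hrδ; linarith
    have h2 : ∀ Z : ℝ, |Z| ≤ 2 * r → (1 + X + Z) ^ (-s) ≤ 1 - s * (X + Z) + 9 * K₀ * X := by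
      intro Z hZ
      have h3 := h1 Z hZ
      have h4 := one_add_rpow_neg_le hs0 (h3.trans h3r)
      have h5 : (X + Z) ^ 2 ≤ 9 * X := by
        have : (X + Z) ^ 2 ≤ (3 * r) ^ 2 := sq_le_sq.2 (by
          rwa [abs_of_nonneg (by positivity : 0 ≤ 3 * r)])
        rw [hXr] at this ⊢; linarith
      rw [← add_assoc] at h4
      have := mul_le_mul_of_nonneg_left h5 hK0
      linarith
    have hlt : 3 * r < 1 := h3r.trans_lt (by
      rw [div_lt_one (by positivity)]; linarith)
    have e1 : bracket (v - w) ^ (-m) = bracket v ^ (-m) * (1 + X + -Y) ^ (-s) := by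
      rw [bracket_rpow_neg_eq, bracket_sub_sq, bracket_rpow_neg_eq v, ← hp, Real.mul_rpow hp0.le]
      have := abs_le.1 (h1 (-Y) (by rwa [abs_neg]))
      change 0 ≤ 1 + X + -Y
      linarith [this.1]
    have e2 : bracket (v + w) ^ (-m) = bracket v ^ (-m) * (1 + X + Y) ^ (-s) := by
      rw [bracket_rpow_neg_eq, bracket_add_sq, bracket_rpow_neg_eq v, ← hp, Real.mul_rpow hp0.le]
      have := abs_le.1 (h1 Y hYabs)
      change 0 ≤ 1 + X + Y
      linarith [this.1]
    have h6 := h2 Y hYabs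
    have h7 := h2 (-Y) (by rwa [abs_neg])
    have h8 : ((1 + X + -Y) ^ (-s) + (1 + X + Y) ^ (-s)) / 2 ≤ 1 + 9 * K₀ * X := by
      have : 0 ≤ s * X := by positivity
      linarith
    calc _ ≤ (bracket (v - w) ^ (-m) + bracket (v + w) ^ (-m)) / 2 := by
          gcongr <;> exact highWeight_le _ _ _ _
      _ = bracket v ^ (-m) * (((1 + X + -Y) ^ (-s) + (1 + X + Y) ^ (-s)) / 2) := by
          rw [e1, e2]; ring
      _ ≤ bracket v ^ (-m) * (1 + 9 * K₀ * X) := by gcongr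
      _ ≤ bracket v ^ (-m) * (1 + (9 * K₀ + κ ^ (-m) / δ ^ 2) * X) := by
          gcongr; exact le_add_of_nonneg_right (by positivity)
      _ = _ := by ring
  · have hX1 : 1 ≤ X / δ ^ 2 := by
      rw [hX, le_div_iff₀ (by positivity), one_mul, le_div_iff₀ hp0, hp, ← mul_pow]
      have := (not_le.1 hw).le
      gcongr
    have h1 := highWeight_le_mul hκ hm v (v - w)
    have h2 := highWeight_le_mul hκ hm v (v + w)
    calc _ ≤ κ ^ (-m) * bracket v ^ (-m) := by linarith
      _ ≤ κ ^ (-m) * bracket v ^ (-m) * (X / δ ^ 2) := le_mul_of_one_le_right (by positivity) hX1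
      _ = (κ ^ (-m) / δ ^ 2 * X) * bracket v ^ (-m) := by ring
      _ ≤ _ := by
        gcongr
        have : 0 ≤ 9 * K₀ * X := by positivity
        linarith

lemma exists_rpow_neg_le (a : ℝ) (ha : 0 ≤ a) : ∃ K : ℝ, 0 ≤ K ∧ ∀ c : ℝ, 0 < c → c ≤ 1 →
    1 / 2 ≤ c ^ 2 → c ^ (-a) ≤ 1 + K * (1 - c ^ 2) := by
  refine ⟨a * Real.exp a, by positivity, fun c hc0 hc1 hc2 => ?_⟩
  set x := 1 - c ^ 2 with hx
  have hx0 : 0 ≤ x := by rw [hx]; nlinarith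
  have hx1 : x ≤ 1 / 2 := by rw [hx]; linarith
  have hlog : -(2 * x) ≤ 2 * Real.log c := by
    have h1 := Real.one_sub_inv_le_log_of_pos (by positivity : 0 < c ^ 2)
    rw [Real.log_pow] at h1
    have h2 : -(2 * x) ≤ 1 - (c ^ 2)⁻¹ := by
      have : 1 - (c ^ 2)⁻¹ = -(x / c ^ 2) := by rw [hx]; field_simp; ring
      rw [this, neg_le_neg_iff, div_le_iff₀ (by positivity)]
      nlinarith
    push_cast at h1
    linarith
  have h3 : c ^ (-a) ≤ Real.exp (a * x) := by
    rw [Real.rpow_def_of_pos hc0]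
    apply Real.exp_le_exp.2
    nlinarith
  have h4 : Real.exp (a * x) ≤ 1 + a * x * Real.exp (a * x) := by
    have h5 := Real.add_one_le_exp (-(a * x))
    have h6 : Real.exp (-(a * x)) * Real.exp (a * x) = 1 := by rw [← Real.exp_add]; simp
    nlinarith [Real.exp_pos (a * x)]
  have h5 : Real.exp (a * x) ≤ Real.exp a := Real.exp_le_exp.2 (by nlinarith)
  have h6 : 0 ≤ a * x := by positivity
  nlinarith

/-- The condition c² ≥ 1/2 means |w| ≤ |y|. There both c^{-a} - 1 and |w|²/|y|² are O(1 - c²), so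
the total error carries a factor sin² α = 1 - c², which the angular kernel can integrate. The
leading 1 is split as c² + (1 - c²). -/
lemma exists_high_velocity_bound {m κ a : ℝ} (hm : 0 ≤ m) (hκ : 0 < κ) (ha : 0 ≤ a) :
    ∃ K : ℝ, 0 ≤ K ∧ ∀ (d : ℕ) (v y w : Euc d) (c : ℝ), 0 < c → c ≤ 1 → 1 / 2 ≤ c ^ 2 →
      ‖w‖ ^ 2 = ‖y‖ ^ 2 * (1 / c ^ 2 - 1) →
      c ^ (-a) * ((highWeight κ m v (v - w) + highWeight κ m v (v + w)) / 2) ≤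
        (c ^ 2 + K * (1 + ‖y‖ ^ 2 / bracket v ^ 2) * (1 - c ^ 2)) * bracket v ^ (-m) := by
  obtain ⟨K₁, hK₁, h₁⟩ := exists_highWeight_mean_le hm hκ
  obtain ⟨K₂, hK₂, h₂⟩ := exists_rpow_neg_le a ha
  refine ⟨1 + K₂ + 2 * K₁ + 2 * K₁ * K₂, by positivity, fun d v y w c hc0 hc1 hc2 hw => ?_⟩
  have hbv := bracket_pos v
  set x := 1 - c ^ 2 with hx
  have hx0 : 0 ≤ x := by rw [hx]; nlinarith
  have hx1 : x ≤ 1 := by rw [hx]; nlinarith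
  set q := ‖y‖ ^ 2 / bracket v ^ 2 with hq
  have hq0 : 0 ≤ q := by positivity
  have hwq : ‖w‖ ^ 2 / bracket v ^ 2 ≤ 2 * q * x := by
    rw [hw, hq]
    have : 1 / c ^ 2 - 1 ≤ 2 * x := by
      have : 1 / c ^ 2 - 1 = x / c ^ 2 := by rw [hx]; field_simp
      rw [this, div_le_iff₀ (by positivity)]
      nlinarith
    calc ‖y‖ ^ 2 * (1 / c ^ 2 - 1) / bracket v ^ 2 ≤ ‖y‖ ^ 2 * (2 * x) / bracket v ^ 2 := by gcongr
      _ = _ := by ring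
  have hφ : 0 ≤ bracket v ^ (-m) := by positivity
  have e1 : (highWeight κ m v (v - w) + highWeight κ m v (v + w)) / 2 ≤
      (1 + 2 * K₁ * q * x) * bracket v ^ (-m) := by
    refine (h₁ d v w).trans (mul_le_mul_of_nonneg_right ?_ hφ)
    have := mul_le_mul_of_nonneg_left hwq hK₁
    linarith
  have e2 := h₂ c hc0 hc1 hc2
  have e3 : 0 ≤ (highWeight κ m v (v - w) + highWeight κ m v (v + w)) / 2 := by
    have := highWeight_nonneg κ m v (v - w)
    have := highWeight_nonneg κ m v (v + w)
    positivity
  calc _ ≤ (1 + K₂ * x) * ((1 + 2 * K₁ * q * x) * bracket v ^ (-m)) := by gcongr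
    _ = ((1 + K₂ * x) * (1 + 2 * K₁ * q * x)) * bracket v ^ (-m) := by ring
    _ ≤ _ := by
      gcongr
      have hc : c ^ 2 = 1 - x := by rw [hx]; ring
      rw [hc]
      have h3 : 0 ≤ K₁ * K₂ * q * x := by positivity
      have h4 : K₁ * K₂ * q * x * x ≤ K₁ * K₂ * q * x := mul_le_of_le_one_right h3 hx1
      have h5 : 0 ≤ K₂ * q * x := by positivity
      have h6 : 0 ≤ K₁ * x := by positivity
      have h7 : 0 ≤ K₁ * K₂ * x := by positivity
      have h8 : 0 ≤ q * x := by positivity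
      nlinarith

/-! ### The gain term is dominated by the loss term -/

/-- The weight of the outgoing velocity `v - w`, restricted to the collisions in which the other
outgoing velocity `v - y` is much smaller than `v`, or in which neither is and `|w| ≤ |y|`. -/
noncomputable def gainWeight (κ m : ℝ) (v y w : Euc d) : ℝ :=
  open Classical in if bracket (v - y) < κ * bracket v then bracket (v - w) ^ (-m)
    else if ‖w‖ ≤ ‖y‖ then highWeight κ m v (v - w) else 0

lemma gainWeight_nonneg (κ m : ℝ) (v y w : Euc d) : 0 ≤ gainWeight κ m v y w := by
  unfold gainWeight
  have := bracket_pos (v - w)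
  split_ifs
  · positivity
  · exact highWeight_nonneg _ _ _ _
  · exact le_rfl

lemma measurable_gainWeight (κ m : ℝ) (v : Euc d) :
    Measurable fun p : Euc d × Euc d => gainWeight κ m v p.1 p.2 := by
  unfold gainWeight highWeight
  have hb : Continuous (bracket : Euc d → ℝ) := continuous_bracket
  have h1 : Measurable fun p : Euc d × Euc d => bracket (v - p.1) := by fun_prop
  have h2 : Measurable fun p : Euc d × Euc d => bracket (v - p.2) := by fun_prop
  refine Measurable.ite (measurableSet_lt h1 measurable_const) (h2.pow_const _) ?_
  refine Measurable.ite (measurableSet_le (by fun_prop) (by fun_prop)) ?_ measurable_const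
  exact Measurable.ite (measurableSet_le measurable_const h2) (h2.pow_const _) measurable_const

/-- Only one factor is replaced by the barrier. The factor kept is one at a velocity small compared
with v or, if there is none, the one displaced further from v; after integration the kept factor
becomes the one in the loss term. -/
lemma mul_le_gainWeight {κ m N : ℝ} {f : Euc d → ℝ} (hf0 : ∀ u, 0 ≤ f u)
    (hf : ∀ u, f u ≤ N * bracket u ^ (-m)) (hN : 0 ≤ N) (v y w : Euc d) :
    f (v - y) * f (v - w) ≤ f (v - y) * (N * gainWeight κ m v y w) +
      f (v - w) * (N * gainWeight κ m v w y) := by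
  have h1 : 0 ≤ f (v - y) * (N * gainWeight κ m v y w) :=
    mul_nonneg (hf0 _) (mul_nonneg hN (gainWeight_nonneg _ _ _ _ _))
  have h2 : 0 ≤ f (v - w) * (N * gainWeight κ m v w y) :=
    mul_nonneg (hf0 _) (mul_nonneg hN (gainWeight_nonneg _ _ _ _ _))
  have a1 := mul_le_mul_of_nonneg_left (hf (v - w)) (hf0 (v - y))
  have a2 := mul_le_mul_of_nonneg_left (hf (v - y)) (hf0 (v - w))
  by_cases hy : bracket (v - y) < κ * bracket v
  · have : gainWeight κ m v y w = bracket (v - w) ^ (-m) := by rw [gainWeight, if_pos hy]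
    rw [this] at h1 ⊢; linarith
  by_cases hw : bracket (v - w) < κ * bracket v
  · have : gainWeight κ m v w y = bracket (v - y) ^ (-m) := by rw [gainWeight, if_pos hw]
    rw [this] at h2 ⊢; linarith
  rcases le_total ‖w‖ ‖y‖ with h | h
  · have : gainWeight κ m v y w = bracket (v - w) ^ (-m) := by
      rw [gainWeight, if_neg hy, if_pos h, highWeight, if_pos (not_lt.1 hw)]
    rw [this] at h1 ⊢; linarith
  · have : gainWeight κ m v w y = bracket (v - y) ^ (-m) := by
      rw [gainWeight, if_neg hw, if_pos h, highWeight, if_pos (not_lt.1 hy)]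
    rw [this] at h2 ⊢; linarith

-- The low-velocity regime produces no error at all, and the other one an error proportional to sin²
-- α away from α = π/2. This separation is what keeps the coefficient of the loss equal to one.
open Classical in
lemma exists_gainWeight_mean_le (d : ℕ) {m γ : ℝ} (hγ : -(d : ℝ) < γ) (hm : d + γ + 2 < m) :
    ∃ κ K : ℝ, 0 < κ ∧ 0 ≤ K ∧ ∀ (v y σ : Euc d), ‖σ‖ = 1 → 0 < inner ℝ y σ →
      (inner ℝ y σ / ‖y‖) ^ (-(d + γ)) *
        ((gainWeight κ m v y (perpVel y σ) + gainWeight κ m v y (-perpVel y σ)) / 2) ≤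
      ((inner ℝ y σ / ‖y‖) ^ 2 +
        (if κ * bracket v ≤ bracket (v - y) then K * (1 + ‖y‖ ^ 2 / bracket v ^ 2) else 0) *
        (if 1 / 2 ≤ (inner ℝ y σ / ‖y‖) ^ 2 then 1 - (inner ℝ y σ / ‖y‖) ^ 2 else 0)) *
        bracket v ^ (-m) := by
  -- The exponent k = d + γ + 2 compensates the singular factor c^{-(d+γ)} and leaves c².
  obtain ⟨κ, hκ, -, hlow⟩ := exists_low_velocity_bound (m := m) (k := d + γ + 2) (by linarith) hm
  obtain ⟨K, hK, hhigh⟩ := exists_high_velocity_bound (m := m) (κ := κ) (a := d + γ)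
    (by linarith) hκ (by linarith)
  refine ⟨κ, K, hκ, hK, fun v y σ hσ hy => ?_⟩
  have hy0 : 0 < ‖y‖ := by
    rw [norm_pos_iff]
    rintro rfl
    simp at hy
  have hw := norm_perpVel_sq y σ hσ hy
  have hperp := inner_perpVel y σ hy.ne'
  set c := inner ℝ y σ / ‖y‖ with hc
  set w := perpVel y σ with hwdef
  have hc0 : 0 < c := by positivity
  have hc1 : c ≤ 1 := by
    rw [hc, div_le_one hy0]
    have := real_inner_le_norm y σ
    rwa [hσ, mul_one] at this
  have hφ : 0 ≤ bracket v ^ (-m) := (Real.rpow_pos_of_pos (bracket_pos v) _).le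
  by_cases hyl : bracket (v - y) < κ * bracket v
  · rw [gainWeight, gainWeight, if_pos hyl, if_pos hyl, sub_neg_eq_add, if_neg (not_le.2 hyl),
      zero_mul, add_zero]
    calc _ ≤ c ^ (-(d + γ)) * (c ^ (d + γ + 2) * bracket v ^ (-m)) := by
          gcongr
          exact hlow d v y w c hc0 hc1 hperp hw hyl
      _ = _ := by
          rw [← mul_assoc, ← Real.rpow_add hc0, ← Real.rpow_natCast]
          congr 2; push_cast; ring
  · rw [gainWeight, gainWeight, if_neg hyl, if_neg hyl, norm_neg, sub_neg_eq_add,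
      if_pos (not_lt.1 hyl)]
    have hiff : ‖w‖ ≤ ‖y‖ ↔ 1 / 2 ≤ c ^ 2 := by
      rw [← sq_le_sq₀ (norm_nonneg _) (norm_nonneg _), hw, mul_le_iff_le_one_right (by positivity),
        sub_le_iff_le_add, div_le_iff₀ (by positivity), div_le_iff₀ (by norm_num)]
      constructor <;> intro h <;> linarith
    by_cases hwy : ‖w‖ ≤ ‖y‖
    · rw [if_pos hwy, if_pos hwy, if_pos (hiff.1 hwy)]
      exact hhigh d v y w c hc0 hc1 (hiff.1 hwy) hw
    · rw [if_neg hwy, if_neg hwy, if_neg (fun h => hwy (hiff.2 h))]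
      simp only [add_zero, zero_div, mul_zero]
      positivity

/-! ### Angular integrals -/

/-- The reflection in the hyperplane orthogonal to e - e' carries e to e'. -/
lemma lintegral_sinHalf_const (hd : 1 ≤ d) {e e' : Euc d} (he : ‖e‖ = ‖e'‖) {G : ℝ → ENNReal}
    (hG : Measurable G) :
    ∫⁻ σ : UnitSphere d, G (sinHalf e σ) ∂(surfaceMeasure d)
      = ∫⁻ σ : UnitSphere d, G (sinHalf e' σ) ∂(surfaceMeasure d) := by
  set U := (Submodule.span ℝ {e - e'})ᗮ.reflection
  have hU : U e = e' := Submodule.reflection_sub he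
  have hm : Measurable fun x : Euc d => G (Real.sqrt ((1 - inner ℝ x e' / ‖e'‖) / 2)) :=
    hG.comp (by fun_prop)
  refine Eq.trans (lintegral_congr fun σ => ?_) (lintegral_sphere_comp_isometry hd U hm)
  rw [← hU, U.inner_map_map, U.norm_map]
  rfl

lemma sinHalf_smul {r : ℝ} (hr : 0 < r) (y : Euc d) (σ : UnitSphere d) :
    sinHalf (r • y) σ = sinHalf y σ := by
  rw [sinHalf, sinHalf, inner_smul_right, norm_smul, Real.norm_of_nonneg hr.le,
    mul_div_mul_left _ _ hr.ne']

lemma measurable_sinHalf_right (e : Euc d) : Measurable fun σ : UnitSphere d => sinHalf e σ := by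
  unfold sinHalf; fun_prop

/-- In the second summand σ ↦ -σ exchanges cos² and sin² of the half angle, and the two summands add
up to β. This identity makes the main part of the gain equal to the loss. -/
lemma lintegral_symm_cos_sq (hd : 1 ≤ d) (e : Euc d) {β : ℝ → ENNReal} (hβ : Measurable β) :
    ∫⁻ σ : UnitSphere d, (β (sinHalf e σ) + β (Real.sqrt (1 - sinHalf e σ ^ 2))) *
        ENNReal.ofReal (1 - sinHalf e σ ^ 2) ∂(surfaceMeasure d)
      = ∫⁻ σ : UnitSphere d, β (sinHalf e σ) ∂(surfaceMeasure d) := by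
  have hs := measurable_sinHalf_right e
  have h1 : Measurable fun σ : UnitSphere d => β (sinHalf e σ) * ENNReal.ofReal (1 - sinHalf e σ ^ 2) :=
    (hβ.comp hs).mul (by fun_prop)
  have h2 : Measurable fun σ : UnitSphere d => β (sinHalf e σ) * ENNReal.ofReal (sinHalf e σ ^ 2) :=
    (hβ.comp hs).mul (by fun_prop)
  simp_rw [add_mul]
  rw [lintegral_add_left h1]
  have h3 : ∫⁻ σ : UnitSphere d, β (Real.sqrt (1 - sinHalf e σ ^ 2)) *
      ENNReal.ofReal (1 - sinHalf e σ ^ 2) ∂(surfaceMeasure d) =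
      ∫⁻ σ : UnitSphere d, β (sinHalf e σ) * ENNReal.ofReal (sinHalf e σ ^ 2)
        ∂(surfaceMeasure d) := by
    rw [← lintegral_sphere_neg hd h2]
    refine lintegral_congr fun σ => ?_
    rw [sinHalf_neg, Real.sq_sqrt]
    have := sinHalf_le_one e σ
    have := sinHalf_nonneg e σ
    nlinarith
  rw [h3, ← lintegral_add_left h1]
  refine lintegral_congr fun σ => ?_
  have := sinHalf_le_one e σ
  have := sinHalf_nonneg e σ
  rw [← mul_add, ← ENNReal.ofReal_add (by nlinarith) (by positivity)]
  simp

-- Where cos² ≥ 1/2 one has sin² ≤ cos²; on the exchanged kernel, σ ↦ -σ turns this cos² into sin².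
-- So the exchanged kernel is also controlled by the second angular moment.
open Classical in
lemma lintegral_symm_sin_sq_le (hd : 1 ≤ d) (e : Euc d) {β : ℝ → ENNReal} (hβ : Measurable β) :
    ∫⁻ σ : UnitSphere d, (β (sinHalf e σ) + β (Real.sqrt (1 - sinHalf e σ ^ 2))) *
        ENNReal.ofReal (if 1 / 2 ≤ 1 - sinHalf e σ ^ 2 then sinHalf e σ ^ 2 else 0)
          ∂(surfaceMeasure d)
      ≤ 2 * ∫⁻ σ : UnitSphere d, β (sinHalf e σ) * ENNReal.ofReal (sinHalf e σ ^ 2)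
          ∂(surfaceMeasure d) := by
  have hs := measurable_sinHalf_right e
  have h2 : Measurable fun σ : UnitSphere d => β (sinHalf e σ) * ENNReal.ofReal (sinHalf e σ ^ 2) :=
    (hβ.comp hs).mul (by fun_prop)
  have hneg := lintegral_sphere_neg hd h2
  rw [two_mul]
  nth_rewrite 2 [← hneg]
  rw [← lintegral_add_left h2]
  refine lintegral_mono fun σ => ?_
  have h0 := sinHalf_le_one e σ
  have h1 := sinHalf_nonneg e σ
  simp only [add_mul]
  rw [sinHalf_neg, Real.sq_sqrt (by nlinarith)]
  gcongr
  · split_ifs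
    · exact le_rfl
    · positivity
  · split_ifs with h
    · linarith
    · nlinarith

-- The gain at fixed y: symmetrize over ±`perpVel y σ`, insert the bound on the mean, and recognize
-- the remaining angular factor as the half-angle density, which brings back integrals of β itself.
open Classical in
lemma lintegral_gainWeight_le (hd : 2 ≤ d) {m γ κ A F N : ℝ} {v y : Euc d} (hy0 : y ≠ 0)
    (hA : 0 ≤ A) (hF : 0 ≤ F) (hN : 0 ≤ N)
    (hmean : ∀ σ : Euc d, ‖σ‖ = 1 → 0 < inner ℝ y σ →
      (inner ℝ y σ / ‖y‖) ^ (-(d + γ)) *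
        ((gainWeight κ m v y (perpVel y σ) + gainWeight κ m v y (-perpVel y σ)) / 2) ≤
      ((inner ℝ y σ / ‖y‖) ^ 2 + A *
        (if 1 / 2 ≤ (inner ℝ y σ / ‖y‖) ^ 2 then 1 - (inner ℝ y σ / ‖y‖) ^ 2 else 0)) *
        bracket v ^ (-m))
    {β : ℝ → ENNReal} (hβ : Measurable β) :
    ∫⁻ σ : UnitSphere d, {p : Euc d × UnitSphere d | 0 < inner ℝ p.1 (p.2 : Euc d)}.indicator
        (fun p => ENNReal.ofReal (2 ^ (d - 1) * (‖p.1‖ / inner ℝ p.1 (p.2 : Euc d)) ^ 2 *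
          (‖p.1‖ ^ 2 / inner ℝ p.1 (p.2 : Euc d)) ^ γ) *
        (β (Real.sqrt (1 - (inner ℝ p.1 (p.2 : Euc d) / ‖p.1‖) ^ 2)) +
          β (Real.sqrt (1 - Real.sqrt (1 - (inner ℝ p.1 (p.2 : Euc d) / ‖p.1‖) ^ 2) ^ 2))) *
        ENNReal.ofReal (F * (N * gainWeight κ m v p.1 (perpVel p.1 p.2)))) (y, σ)
          ∂(surfaceMeasure d)
      ≤ ENNReal.ofReal (‖y‖ ^ γ * (F * (N * bracket v ^ (-m)))) *
        (∫⁻ σ : UnitSphere d, β (sinHalf y σ) ∂(surfaceMeasure d) +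
          ENNReal.ofReal A * (2 * ∫⁻ σ : UnitSphere d, β (sinHalf y σ) *
            ENNReal.ofReal (sinHalf y σ ^ 2) ∂(surfaceMeasure d))) := by
  have hd1 : 1 ≤ d := by omega
  have hyp : 0 < ‖y‖ := norm_pos_iff.2 hy0
  have hbv : 0 ≤ bracket v ^ (-m) := (Real.rpow_pos_of_pos (bracket_pos v) _).le
  set B : ℝ → ENNReal := fun s => β s + β (Real.sqrt (1 - s ^ 2)) with hB
  have hBm : Measurable B := hβ.add (hβ.comp (by fun_prop))
  set Z : ENNReal := ENNReal.ofReal (‖y‖ ^ γ * (F * (N * bracket v ^ (-m)))) with hZ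
  set G : ℝ → Euc d → ENNReal := fun t w => if 0 < t then
    ENNReal.ofReal (2 ^ (d - 1) * (‖y‖ / t) ^ 2 * (‖y‖ ^ 2 / t) ^ γ) *
      B (Real.sqrt (1 - (t / ‖y‖) ^ 2)) * ENNReal.ofReal (F * (N * gainWeight κ m v y w)) else 0
    with hG
  have hGm : Measurable (Function.uncurry G) := by
    refine Measurable.ite (measurableSet_lt measurable_const measurable_fst) ?_ measurable_const
    refine Measurable.mul (Measurable.mul (by fun_prop) (hBm.comp (by fun_prop))) ?_
    have : Measurable fun p : ℝ × Euc d => gainWeight κ m v y p.2 :=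
      (measurable_gainWeight κ m v).comp (f := fun p : ℝ × Euc d => (y, p.2)) (by fun_prop)
    fun_prop
  set G₂ : ℝ → ENNReal := fun s => B s * ENNReal.ofReal (1 - s ^ 2) +
    ENNReal.ofReal A * (B s * ENNReal.ofReal (if 1 / 2 ≤ 1 - s ^ 2 then s ^ 2 else 0)) with hG₂
  have hite : Measurable fun s : ℝ => if 1 / 2 ≤ 1 - s ^ 2 then s ^ 2 else 0 :=
    Measurable.ite (measurableSet_le measurable_const (by fun_prop)) (by fun_prop) measurable_const
  have hG₂m : Measurable G₂ := by
    refine Measurable.add (hBm.mul (by fun_prop)) (Measurable.const_mul (hBm.mul ?_) _)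
    exact hite.ennreal_ofReal
  have hint := lintegral_perpVel_neg hd1 y hGm (fun w => by simp [hG])
  set e : Euc d := ‖y‖⁻¹ • y with he
  have he1 : ‖e‖ = 1 := by
    rw [he, norm_smul, norm_inv, norm_norm, inv_mul_cancel₀ hyp.ne']
  have hes : ∀ σ : UnitSphere d, sinHalf e σ = sinHalf y σ := sinHalf_smul (inv_pos.2 hyp) y
  have hsph := lintegral_sinHalf_eq hd he1 hG₂m
  have hpt : ∀ σ : UnitSphere d, G (inner ℝ y (σ : Euc d)) (perpVel y σ) +
      G (inner ℝ y (σ : Euc d)) (-perpVel y σ) ≤ 2 * (Z *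
      {σ : UnitSphere d | 0 < inner ℝ e (σ : Euc d)}.indicator (fun σ =>
        ENNReal.ofReal (2 ^ (d - 1) * (1 / inner ℝ e (σ : Euc d)) ^ 2 * inner ℝ e (σ : Euc d) ^ d) *
          G₂ (Real.sqrt (1 - inner ℝ e (σ : Euc d) ^ 2))) σ) := by
    intro σ
    have hσ : ‖(σ : Euc d)‖ = 1 := by simp
    by_cases ht : 0 < inner ℝ y (σ : Euc d)
    · have hm := hmean σ hσ ht
      have hec : inner ℝ e (σ : Euc d) = inner ℝ y (σ : Euc d) / ‖y‖ := by
        rw [he, inner_smul_left]; simp; ring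
      set c := inner ℝ y (σ : Euc d) / ‖y‖ with hc
      have hc0 : 0 < c := by positivity
      have hc1 : c ≤ 1 := by
        rw [hc, div_le_one hyp]
        have := real_inner_le_norm y (σ : Euc d)
        rwa [hσ, mul_one] at this
      have hcsq : Real.sqrt (1 - c ^ 2) ^ 2 = 1 - c ^ 2 := Real.sq_sqrt (by nlinarith)
      rw [indicator_of_mem (by change 0 < inner ℝ e (σ : Euc d); rw [hec]; exact hc0)]
      have hg1 := gainWeight_nonneg κ m v y (perpVel y σ)
      have hg2 := gainWeight_nonneg κ m v y (-perpVel y σ)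
      set g1 := gainWeight κ m v y (perpVel y σ)
      set g2 := gainWeight κ m v y (-perpVel y σ)
      have e1 : ‖y‖ / inner ℝ y (σ : Euc d) = 1 / c := by rw [hc]; field_simp
      -- The power c^{-γ} is split so that c^d joins the half-angle density; what remains is exactly
      -- the factor in `hmean`.
      have e2 : (‖y‖ ^ 2 / inner ℝ y (σ : Euc d)) ^ γ = ‖y‖ ^ γ * (c ^ d * c ^ (-(d + γ))) := by
        have : ‖y‖ ^ 2 / inner ℝ y (σ : Euc d) = ‖y‖ * c⁻¹ := by rw [hc]; field_simp
        rw [this, Real.mul_rpow hyp.le (by positivity), Real.inv_rpow hc0.le, ← Real.rpow_neg hc0.le,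
          ← Real.rpow_natCast c d, ← Real.rpow_add hc0]
        congr 2; ring
      simp only [hG, if_pos ht, hec, e1, e2]
      rw [← mul_add, ← ENNReal.ofReal_add (by positivity) (by positivity)]
      set b := B (Real.sqrt (1 - c ^ 2)) with hb
      have hG₂c : G₂ (Real.sqrt (1 - c ^ 2)) = b * ENNReal.ofReal (c ^ 2 + A *
          (if 1 / 2 ≤ c ^ 2 then 1 - c ^ 2 else 0)) := by
        have hnn : 0 ≤ (if 1 / 2 ≤ c ^ 2 then 1 - c ^ 2 else 0) := by
          split_ifs
          · nlinarith
          · exact le_rfl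
        simp only [hG₂, hcsq, sub_sub_cancel]
        rw [ENNReal.ofReal_add (by positivity) (by positivity), ENNReal.ofReal_mul hA]
        ring
      rw [hG₂c]
      have hfin : (2 ^ (d - 1) * (1 / c) ^ 2 * (‖y‖ ^ γ * (c ^ d * c ^ (-(d + γ))))) *
          (F * (N * g1) + F * (N * g2)) ≤ 2 * (‖y‖ ^ γ * (F * (N * bracket v ^ (-m))) *
          (2 ^ (d - 1) * (1 / c) ^ 2 * c ^ d * (c ^ 2 + A *
          (if 1 / 2 ≤ c ^ 2 then 1 - c ^ 2 else 0)))) := by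
        have hq : 0 ≤ 2 * (2 ^ (d - 1) * (1 / c) ^ 2 * c ^ d * ‖y‖ ^ γ * F * N) := by positivity
        have := mul_le_mul_of_nonneg_left hm hq
        calc _ = 2 * (2 ^ (d - 1) * (1 / c) ^ 2 * c ^ d * ‖y‖ ^ γ * F * N) *
              (c ^ (-(d + γ)) * ((g1 + g2) / 2)) := by ring
          _ ≤ _ := this
          _ = _ := by ring
      have hof := ENNReal.ofReal_le_ofReal hfin
      have hnn2 : 0 ≤ c ^ 2 + A * (if 1 / 2 ≤ c ^ 2 then 1 - c ^ 2 else 0) := by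
        have : 0 ≤ (if 1 / 2 ≤ c ^ 2 then 1 - c ^ 2 else 0) := by
          split_ifs
          · nlinarith
          · exact le_rfl
        exact add_nonneg (sq_nonneg c) (mul_nonneg hA this)
      rw [ENNReal.ofReal_mul (p := 2 ^ (d - 1) * (1 / c) ^ 2 * (‖y‖ ^ γ * (c ^ d * c ^ (-(d + γ)))))
          (by positivity), ENNReal.ofReal_mul (p := 2) (by norm_num),
        ENNReal.ofReal_mul (p := ‖y‖ ^ γ * (F * (N * bracket v ^ (-m)))) (by positivity),
        ENNReal.ofReal_mul (p := 2 ^ (d - 1) * (1 / c) ^ 2 * c ^ d) (by positivity)] at hof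
      have h2 : ENNReal.ofReal 2 = 2 := by simp
      rw [h2] at hof
      calc _ = b * (ENNReal.ofReal (2 ^ (d - 1) * (1 / c) ^ 2 * (‖y‖ ^ γ * (c ^ d * c ^ (-(d + γ)))))
            * ENNReal.ofReal (F * (N * g1) + F * (N * g2))) := by ring
        _ ≤ b * _ := mul_le_mul_right hof b
        _ = _ := by rw [hZ]; ring
    · simp [hG, ht]
  have hI : ∫⁻ σ : UnitSphere d, G (inner ℝ y (σ : Euc d)) (perpVel y σ) ∂(surfaceMeasure d) ≤
      Z * ∫⁻ σ : UnitSphere d, G₂ (sinHalf e σ) ∂(surfaceMeasure d) := by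
    have hperp : Measurable fun σ : UnitSphere d => perpVel y σ := by
      unfold perpVel; fun_prop
    have hGσ : Measurable fun σ : UnitSphere d => G (inner ℝ y (σ : Euc d)) (perpVel y σ) :=
      hGm.comp (f := fun σ : UnitSphere d => (inner ℝ y (σ : Euc d), perpVel y (σ : Euc d)))
        (by fun_prop)
    -- The mean over ±w is created by doubling the integral and reflecting one of the two copies.
    have h2 : 2 * ∫⁻ σ : UnitSphere d, G (inner ℝ y (σ : Euc d)) (perpVel y σ) ∂(surfaceMeasure d)
        ≤ 2 * (Z * ∫⁻ σ : UnitSphere d, G₂ (sinHalf e σ) ∂(surfaceMeasure d)) := by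
      rw [hsph, two_mul]
      nth_rewrite 2 [← hint]
      rw [← lintegral_add_left hGσ]
      refine (lintegral_mono hpt).trans_eq ?_
      rw [lintegral_const_mul' _ _ (by simp), lintegral_const_mul' _ _ ENNReal.ofReal_ne_top]
    exact (ENNReal.mul_le_mul_iff_right (by simp) (by simp)).1 h2
  have hG₂int : ∫⁻ σ : UnitSphere d, G₂ (sinHalf e σ) ∂(surfaceMeasure d) ≤
      ∫⁻ σ : UnitSphere d, β (sinHalf y σ) ∂(surfaceMeasure d) +
          ENNReal.ofReal A * (2 * ∫⁻ σ : UnitSphere d, β (sinHalf y σ) *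
            ENNReal.ofReal (sinHalf y σ ^ 2) ∂(surfaceMeasure d)) := by
    have hs := measurable_sinHalf_right y
    simp_rw [hes]
    have hm1 : Measurable fun σ : UnitSphere d =>
        B (sinHalf y σ) * ENNReal.ofReal (1 - sinHalf y σ ^ 2) :=
      (hBm.comp hs).mul (by fun_prop)
    simp only [hG₂]
    rw [lintegral_add_left hm1, lintegral_const_mul' _ _ ENNReal.ofReal_ne_top]
    refine add_le_add (lintegral_symm_cos_sq hd1 y hβ).le ?_
    exact mul_le_mul_right (lintegral_symm_sin_sq_le hd1 y hβ) _
  refine le_trans (le_of_eq (lintegral_congr fun σ => ?_)) (hI.trans (mul_le_mul_right hG₂int Z))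
  simp only [hG, hB, indicator_apply, mem_ofPred_eq]

/-- The gain term is at most the loss term plus a quadratic error, uniformly in the angular
function `β`. -/
lemma exists_gain_le_loss_add (hd : 2 ≤ d) {m γ : ℝ} (hγ : -(d : ℝ) < γ) (hm : d + |γ| + 4 < m) :
    ∃ C : ℝ, 0 ≤ C ∧ ∀ (N : ℝ), 0 < N → ∀ f : Euc d → ℝ, Continuous f → (∀ u, 0 ≤ f u) →
      (∀ u, f u ≤ N * bracket u ^ (-m)) → ∀ v, f v = N * bracket v ^ (-m) →
      ∀ (β : ℝ → ENNReal) (M : ENNReal), Measurable β →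
      (∀ y : Euc d, y ≠ 0 → ∫⁻ σ : UnitSphere d, β (sinHalf y σ) *
        ENNReal.ofReal (sinHalf y σ ^ 2) ∂(surfaceMeasure d) ≤ M) →
      kineticIntegral γ β (fun y w => ENNReal.ofReal (f (v - y) * f (v - w))) ≤
        (∫⁻ y, ENNReal.ofReal (‖y‖ ^ γ * (f (v - y) * f v)) *
          ∫⁻ σ : UnitSphere d, β (sinHalf y σ) ∂(surfaceMeasure d)) +
        ENNReal.ofReal (C * N ^ 2 * bracket v ^ (-m)) * M := by
  classical
  have hd1 : 1 ≤ d := by omega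
  have hγabs := le_abs_self γ
  obtain ⟨κ, K, hκ, hK, hmean⟩ := exists_gainWeight_mean_le d (m := m) hγ (by linarith)
  -- The exponent j = 2 pays for the factor 1 + |y|²/⟨v⟩² ≤ ⟨y⟩² in the error, and 2 + 1/κ is the
  -- constant of `bracket_le_of_le_bracket_sub`.
  obtain ⟨C₁, hC₁, hint⟩ := lintegral_norm_rpow_bracket_le hd1 hγ (j := 2) (m := m) (by norm_num)
    (by linarith) (2 + 1 / κ) (by positivity)
  refine ⟨2 * K * C₁, by positivity, fun N hN f hfc hf0 hf v hv β M hβ hM => ?_⟩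
  set B : ℝ → ENNReal := fun s => β s + β (Real.sqrt (1 - s ^ 2)) with hB
  have hβ' : Measurable fun s : ℝ => β (Real.sqrt (1 - s ^ 2)) := hβ.comp (by fun_prop)
  have hBm : Measurable B := hβ.add hβ'
  set H : Euc d → Euc d → ENNReal := fun y w =>
    ENNReal.ofReal (f (v - y) * (N * gainWeight κ m v y w)) with hH
  have hfm : Measurable f := hfc.measurable
  have hgw := measurable_gainWeight κ m v
  have hHm : Measurable (Function.uncurry H) := by
    refine Measurable.ennreal_ofReal (Measurable.mul (by fun_prop) (hgw.const_mul N))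
  have hswap := kineticIntegral_swap hd1 (γ := γ) hβ hHm
  have hadd := kineticIntegral_add_left (γ := γ) hβ (β' := fun s => β (Real.sqrt (1 - s ^ 2))) hHm
  -- The two terms of the splitting are exchanged by swapping the outgoing velocities, so they
  -- combine into one integral with the symmetrized kernel B.
  have h1 : kineticIntegral γ β (fun y w => ENNReal.ofReal (f (v - y) * f (v - w))) ≤
      kineticIntegral γ B H := by
    rw [hB, hadd, ← hswap, ← kineticIntegral_add_right hβ hHm]
    refine kineticIntegral_mono fun y w => ?_
    have hg1 := gainWeight_nonneg κ m v y w
    have hg2 := gainWeight_nonneg κ m v w y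
    have := hf0 (v - y)
    have := hf0 (v - w)
    rw [hH, ← ENNReal.ofReal_add (by positivity) (by positivity)]
    exact ENNReal.ofReal_le_ofReal (mul_le_gainWeight hf0 hf hN.le v y w)
  refine h1.trans ?_
  rw [kineticIntegral_eq hd hBm hHm]
  set s : Set (Euc d) := {y | κ * bracket v ≤ bracket (v - y)} with hs
  have hbc : Continuous (bracket : Euc d → ℝ) := continuous_bracket
  have hsm : MeasurableSet s := measurableSet_le measurable_const (by fun_prop)
  set E : Euc d → ENNReal := s.indicator fun y => ENNReal.ofReal (2 * K * N ^ 2 * bracket v ^ (-m)) *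
    M * ENNReal.ofReal (‖y‖ ^ γ * bracket y ^ (2 : ℝ) * bracket (v - y) ^ (-m)) with hE
  have hbv : 0 ≤ bracket v ^ (-m) := (Real.rpow_pos_of_pos (bracket_pos v) _).le
  have hEint : ∫⁻ y, E y ≤ ENNReal.ofReal (2 * K * C₁ * N ^ 2 * bracket v ^ (-m)) * M := by
    rw [hE, lintegral_indicator hsm]
    have hmeas : Measurable fun y : Euc d =>
        ENNReal.ofReal (‖y‖ ^ γ * bracket y ^ (2 : ℝ) * bracket (v - y) ^ (-m)) := by
      have h1 : Continuous fun y : Euc d => bracket (v - y) ^ (-m) :=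
        (continuous_bracket_rpow (-m)).comp (by fun_prop)
      have h2 : Continuous fun y : Euc d => bracket y ^ (2 : ℝ) := continuous_bracket_rpow 2
      have h1m := h1.measurable
      have h2m := h2.measurable
      fun_prop
    rw [lintegral_const_mul _ hmeas]
    calc _ ≤ ENNReal.ofReal (2 * K * N ^ 2 * bracket v ^ (-m)) * M * ENNReal.ofReal C₁ := by
          gcongr
          exact hint v s hsm fun y hy => bracket_le_of_le_bracket_sub hκ v y hy
      _ = ENNReal.ofReal (2 * K * N ^ 2 * bracket v ^ (-m) * C₁) * M := by
          rw [ENNReal.ofReal_mul (q := C₁) (by positivity)]; ring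
      _ = _ := by congr 2; ring
  have hEm : Measurable E := by
    refine Measurable.indicator ?_ hsm
    have h1 : Continuous fun y : Euc d => bracket (v - y) ^ (-m) :=
      (continuous_bracket_rpow (-m)).comp (by fun_prop)
    have h2 : Continuous fun y : Euc d => bracket y ^ (2 : ℝ) := continuous_bracket_rpow 2
    have h1m := h1.measurable
    have h2m := h2.measurable
    fun_prop
  refine le_trans (lintegral_mono_ae ?_) ((lintegral_add_right _ hEm).trans_le
    (add_le_add_right hEint _))
  have : Nonempty (Fin d) := ⟨⟨0, hd1⟩⟩
  filter_upwards [compl_mem_ae_iff.2 (measure_singleton (0 : Euc d))] with y hy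
  have hy0 : y ≠ 0 := hy
  set A : ℝ := if κ * bracket v ≤ bracket (v - y) then K * (1 + ‖y‖ ^ 2 / bracket v ^ 2) else 0
    with hA
  have hA0 : 0 ≤ A := by
    rw [hA]; split_ifs <;> positivity
  have := lintegral_gainWeight_le hd (κ := κ) (m := m) (γ := γ) (v := v) hy0 hA0 (hf0 (v - y)) hN.le
    (fun σ hσ hyσ => hmean v y σ hσ hyσ) hβ
  refine this.trans ?_
  rw [mul_add, hv]
  refine add_le_add le_rfl ?_
  by_cases hys : κ * bracket v ≤ bracket (v - y)
  · rw [hE, indicator_of_mem (by exact hys)]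
    calc _ ≤ ENNReal.ofReal (‖y‖ ^ γ * (f (v - y) * (N * bracket v ^ (-m)))) *
          (ENNReal.ofReal A * (2 * M)) := by gcongr; exact hM y hy0
      _ = ENNReal.ofReal (2 * (‖y‖ ^ γ * (f (v - y) * (N * bracket v ^ (-m))) * A)) * M := by
          have hf0y := hf0 (v - y)
          rw [ENNReal.ofReal_mul (p := 2) (by norm_num), ENNReal.ofReal_mul (q := A) (by positivity)]
          simp only [ENNReal.ofReal_ofNat]
          ring
      _ ≤ ENNReal.ofReal (2 * K * N ^ 2 * bracket v ^ (-m) *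
          (‖y‖ ^ γ * bracket y ^ (2 : ℝ) * bracket (v - y) ^ (-m))) * M := by
          refine mul_le_mul_left (ENNReal.ofReal_le_ofReal ?_) M
          rw [hA, if_pos hys]
          have h3 : 1 + ‖y‖ ^ 2 / bracket v ^ 2 ≤ bracket y ^ (2 : ℝ) := by
            rw [Real.rpow_two, bracket_sq y]
            have : ‖y‖ ^ 2 / bracket v ^ 2 ≤ ‖y‖ ^ 2 :=
              div_le_self (by positivity) (one_le_pow₀ (one_le_bracket v))
            linarith
          have h4 := hf (v - y)
          have h5 := hf0 (v - y)
          have hby := bracket_pos (v - y)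
          have hby2 := bracket_pos y
          calc _ ≤ 2 * (‖y‖ ^ γ * ((N * bracket (v - y) ^ (-m)) * (N * bracket v ^ (-m))) *
                (K * bracket y ^ (2 : ℝ))) := by
                have h6 : K * (1 + ‖y‖ ^ 2 / bracket v ^ 2) ≤ K * bracket y ^ (2 : ℝ) :=
                  mul_le_mul_of_nonneg_left h3 hK
                have h7 : f (v - y) * (N * bracket v ^ (-m)) ≤
                    (N * bracket (v - y) ^ (-m)) * (N * bracket v ^ (-m)) :=
                  mul_le_mul_of_nonneg_right h4 (by positivity)
                have h8 : 0 ≤ (N * bracket (v - y) ^ (-m)) * (N * bracket v ^ (-m)) := by positivity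
                refine mul_le_mul_of_nonneg_left ?_ (by norm_num)
                exact mul_le_mul (mul_le_mul_of_nonneg_left h7 (by positivity)) h6 (by positivity)
                  (by positivity)
            _ = _ := by ring
      _ = _ := by
          rw [ENNReal.ofReal_mul (p := 2 * K * N ^ 2 * bracket v ^ (-m)) (by positivity)]
          ring
  · rw [hA, if_neg hys]
    simp

/-! ### The contact estimate for the Boltzmann operator -/

/-- Finiteness of the loss makes the gain finite as well. Both are then integrable, and the iterated
integral of the difference splits. -/
lemma integral_integral_sub_le_of_lintegral_le {α β : Type*} [MeasurableSpace α]
    [MeasurableSpace β] {μ : Measure α} {ν : Measure β} [SFinite μ] [SFinite ν] {g l : α × β → ℝ}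
    (hg : Measurable g) (hl : Measurable l) (hg0 : ∀ p, 0 ≤ g p) (hl0 : ∀ p, 0 ≤ l p)
    {L : ENNReal} {E : ℝ} (hE : 0 ≤ E)
    (hL : ∫⁻ x, ∫⁻ y, ENNReal.ofReal (l (x, y)) ∂ν ∂μ = L) (hLtop : L ≠ ⊤)
    (h : ∫⁻ x, ∫⁻ y, ENNReal.ofReal (g (x, y)) ∂ν ∂μ ≤ L + ENNReal.ofReal E) :
    ∫ x, ∫ y, (g (x, y) - l (x, y)) ∂ν ∂μ ≤ E := by
  rw [← lintegral_prod _ hg.ennreal_ofReal.aemeasurable] at h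
  rw [← lintegral_prod _ hl.ennreal_ofReal.aemeasurable] at hL
  have hGtop : ∫⁻ p, ENNReal.ofReal (g p) ∂(μ.prod ν) ≠ ⊤ :=
    ne_top_of_le_ne_top (ENNReal.add_ne_top.2 ⟨hLtop, ENNReal.ofReal_ne_top⟩) h
  have hgi : Integrable g (μ.prod ν) :=
    (lintegral_ofReal_ne_top_iff_integrable hg.aestronglyMeasurable
      (Eventually.of_forall hg0)).1 hGtop
  have hli : Integrable l (μ.prod ν) :=
    (lintegral_ofReal_ne_top_iff_integrable hl.aestronglyMeasurable
      (Eventually.of_forall hl0)).1 (hL ▸ hLtop)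
  have hprod := integral_prod (fun p => g p - l p) (hgi.sub hli)
  rw [← hprod, integral_sub hgi hli,
    integral_eq_lintegral_of_nonneg_ae (Eventually.of_forall hg0) hg.aestronglyMeasurable,
    integral_eq_lintegral_of_nonneg_ae (Eventually.of_forall hl0) hl.aestronglyMeasurable, hL,
    sub_le_iff_le_add']
  have := ENNReal.toReal_mono (ENNReal.add_ne_top.2 ⟨hLtop, ENNReal.ofReal_ne_top⟩) h
  rwa [ENNReal.toReal_add hLtop ENNReal.ofReal_ne_top, ENNReal.toReal_ofReal hE] at this

lemma postVel_sub (v z : Euc d) (σ : UnitSphere d) :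
    postVel v (v - z) σ = v - halfSum z (-(σ : Euc d)) := by
  rw [postVel, halfSum, sub_sub_cancel]
  module

lemma postVelStar_sub (v z : Euc d) (σ : UnitSphere d) :
    postVelStar v (v - z) σ = v - halfSum z σ := by
  rw [postVelStar, halfSum, sub_sub_cancel]
  module

open Classical in
lemma boltzmannTruncated_eq {γ : ℝ} {b : ℝ → ℝ} {ε : ℝ} {f : Euc d → ℝ} {v : Euc d} :
    boltzmannTruncated γ b ε f f v = ∫ z : Euc d, ∫ σ : UnitSphere d,
      (‖z‖ ^ γ * (if ε < sinHalf z σ then b (sinHalf z σ) else 0) *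
          (f (v - halfSum z σ) * f (v - halfSum z (-(σ : Euc d)))) -
        ‖z‖ ^ γ * (if ε < sinHalf z σ then b (sinHalf z σ) else 0) * (f (v - z) * f v))
        ∂(surfaceMeasure d) := by
  unfold boltzmannTruncated
  rw [← integral_sub_left_eq_self _ _ v]
  refine integral_congr_ae (Eventually.of_forall fun z => ?_)
  simp only [sub_sub_cancel]
  have hs : MeasurableSet {σ : UnitSphere d | ε < sinHalf z σ} :=
    measurableSet_lt measurable_const (measurable_sinHalf_right z)
  rw [← integral_indicator hs]
  refine integral_congr_ae (Eventually.of_forall fun σ => ?_)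
  simp only [indicator_apply, mem_ofPred_eq]
  split_ifs with h
  · rw [collisionKernel, postVel_sub, postVelStar_sub]
    ring
  · ring

/-- At positive truncation the loss is finite and can be subtracted. The error involves only the
angular moment M, so the bound is uniform in the truncation and survives its removal. -/
lemma hasContactEstimate_boltzmann (hd : 2 ≤ d) {γ : ℝ} {b : ℝ → ℝ} (hγ : -(d : ℝ) < γ)
    (hb : IsAngularKernel d b) {m : ℝ} (hm : d + |γ| + 4 < m) :
    ∃ K : ℝ, 0 < K ∧ HasContactEstimate d (.boltzmann γ b) m K := by
  classical
  have hd1 : 1 ≤ d := by omega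
  have hbm : Measurable b := hb.measurable
  obtain ⟨C, hC, hgain⟩ := exists_gain_le_loss_add hd hγ hm
  set e₀ : Euc d := EuclideanSpace.single ⟨0, hd1⟩ 1 with he₀
  have he₀1 : ‖e₀‖ = 1 := by simp [he₀]
  have hsb0 : ∀ e : Euc d, ∀ σ : UnitSphere d, 0 ≤ b (sinHalf e σ) := fun e σ =>
    hb.nonneg _ ⟨sinHalf_nonneg e σ, sinHalf_le_one e σ⟩
  set G : ℝ → ENNReal := fun s => ENNReal.ofReal (s ^ 2 * b s) with hG
  have hGm : Measurable G := by fun_prop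
  set M : ENNReal := ∫⁻ σ : UnitSphere d, G (sinHalf e₀ σ) ∂(surfaceMeasure d) with hM
  have hMtop : M < ⊤ := (hb.integrable e₀ he₀1).lintegral_lt_top
  have hMy : ∀ y : Euc d, y ≠ 0 →
      ∫⁻ σ : UnitSphere d, G (sinHalf y σ) ∂(surfaceMeasure d) = M := by
    intro y hy
    have hyp : 0 < ‖y‖ := norm_pos_iff.2 hy
    have h1 : ‖‖y‖⁻¹ • y‖ = ‖e₀‖ := by
      rw [norm_smul, norm_inv, norm_norm, inv_mul_cancel₀ hyp.ne', he₀1]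
    rw [hM, ← lintegral_sinHalf_const hd1 h1 hGm]
    simp_rw [sinHalf_smul (inv_pos.2 hyp)]
  refine ⟨C * M.toReal + 1, by positivity, fun N hN f hf2 hf0 hf v q hv hq => ?_⟩
  have hbv : 0 ≤ bracket v ^ (-m) := (Real.rpow_pos_of_pos (bracket_pos v) _).le
  have hfc : Continuous f := hf2.continuous
  have hfm : Measurable f := hfc.measurable
  have htrunc : ∀ ε ∈ Ioi (0 : ℝ), boltzmannTruncated γ b ε f f v ≤
      C * N ^ 2 * bracket v ^ (-m) * M.toReal := by
    intro ε hε
    have hε0 : (0 : ℝ) < ε := hε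
    set bε : ℝ → ℝ := fun s => if ε < s then b s else 0 with hbε
    have hbεm : Measurable bε :=
      Measurable.ite (measurableSet_lt measurable_const measurable_id) hbm measurable_const
    have hbε0 : ∀ e : Euc d, ∀ σ : UnitSphere d, 0 ≤ bε (sinHalf e σ) := fun e σ => by
      simp only [hbε]; split_ifs
      · exact hsb0 e σ
      · exact le_rfl
    set β : ℝ → ENNReal := fun s => ENNReal.ofReal (bε s) with hβ
    have hβm : Measurable β := hbεm.ennreal_ofReal
    have hβM : ∀ y : Euc d, y ≠ 0 → ∫⁻ σ : UnitSphere d, β (sinHalf y σ) *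
        ENNReal.ofReal (sinHalf y σ ^ 2) ∂(surfaceMeasure d) ≤ M := by
      intro y hy
      rw [← hMy y hy]
      refine lintegral_mono fun σ => ?_
      simp only [hβ, hG]
      rw [← ENNReal.ofReal_mul (hbε0 y σ), mul_comm]
      refine ENNReal.ofReal_le_ofReal (mul_le_mul_of_nonneg_left ?_ (sq_nonneg _))
      simp only [hbε]; split_ifs
      · exact le_rfl
      · exact hsb0 y σ
    -- On the support of the truncated kernel sin(θ/2) > ε, so its mass is at most M/ε². This is
    -- used only to know that the loss is finite.
    have hβtot : ∀ y : Euc d, y ≠ 0 → ∫⁻ σ : UnitSphere d, β (sinHalf y σ) ∂(surfaceMeasure d) ≤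
        ENNReal.ofReal (1 / ε ^ 2) * M := by
      intro y hy
      rw [← hMy y hy, ← lintegral_const_mul' _ _ ENNReal.ofReal_ne_top]
      refine lintegral_mono fun σ => ?_
      simp only [hβ, hG]
      rw [← ENNReal.ofReal_mul (by positivity)]
      refine ENNReal.ofReal_le_ofReal ?_
      have h0 := hsb0 y σ
      simp only [hbε]; split_ifs with h
      · rw [← mul_assoc]
        refine le_mul_of_one_le_left h0 ?_
        rw [one_div, ← div_eq_inv_mul, one_le_div (by positivity)]
        gcongr
      · positivity
    rw [boltzmannTruncated_eq]
    set g : Euc d × UnitSphere d → ℝ := fun p => ‖p.1‖ ^ γ * bε (sinHalf p.1 p.2) *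
      (f (v - halfSum p.1 p.2) * f (v - halfSum p.1 (-(p.2 : Euc d)))) with hg
    set l : Euc d × UnitSphere d → ℝ := fun p => ‖p.1‖ ^ γ * bε (sinHalf p.1 p.2) *
      (f (v - p.1) * f v) with hl
    have hbm2 : Measurable fun p : Euc d × UnitSphere d => bε (sinHalf p.1 p.2) :=
      hbεm.comp measurable_sinHalf
    have hgm : Measurable g := by
      have h1 : Measurable fun p : Euc d × UnitSphere d => f (v - halfSum p.1 p.2) := by
        unfold halfSum; fun_prop
      have h2 : Measurable fun p : Euc d × UnitSphere d => f (v - halfSum p.1 (-(p.2 : Euc d))) := by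
        unfold halfSum; fun_prop
      have h3 : Measurable fun p : Euc d × UnitSphere d => ‖p.1‖ ^ γ := by fun_prop
      exact (h3.mul hbm2).mul (h1.mul h2)
    have hlm : Measurable l := by
      have h1 : Measurable fun p : Euc d × UnitSphere d => f (v - p.1) * f v := by fun_prop
      have h3 : Measurable fun p : Euc d × UnitSphere d => ‖p.1‖ ^ γ := by fun_prop
      exact (h3.mul hbm2).mul h1
    have hg0 : ∀ p, 0 ≤ g p := fun p => by
      have := hbε0 p.1 p.2
      have := hf0 (v - halfSum p.1 p.2)
      have := hf0 (v - halfSum p.1 (-(p.2 : Euc d)))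
      simp only [hg]; positivity
    have hl0 : ∀ p, 0 ≤ l p := fun p => by
      have := hbε0 p.1 p.2
      have := hf0 (v - p.1)
      have := hf0 v
      simp only [hl]; positivity
    set L : ENNReal := ∫⁻ y, ENNReal.ofReal (‖y‖ ^ γ * (f (v - y) * f v)) *
      ∫⁻ σ : UnitSphere d, β (sinHalf y σ) ∂(surfaceMeasure d) with hL
    have hloss : ∫⁻ z, ∫⁻ σ, ENNReal.ofReal (l (z, σ)) ∂(surfaceMeasure d) = L := by
      refine lintegral_congr fun z => ?_
      rw [← lintegral_const_mul' _ _ ENNReal.ofReal_ne_top]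
      refine lintegral_congr fun σ => ?_
      have h1 := hbε0 z σ
      have h2 := hf0 (v - z)
      have h3 := hf0 v
      simp only [hl, hβ]
      rw [← ENNReal.ofReal_mul (by positivity)]
      congr 1; ring
    have hgaineq : ∫⁻ z, ∫⁻ σ, ENNReal.ofReal (g (z, σ)) ∂(surfaceMeasure d) =
        kineticIntegral γ β (fun y w => ENNReal.ofReal (f (v - y) * f (v - w))) := by
      refine lintegral_congr fun z => lintegral_congr fun σ => ?_
      have h1 := hbε0 z σ
      simp only [hg, hβ]
      rw [ENNReal.ofReal_mul (by positivity), ENNReal.ofReal_mul (by positivity)]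
    have hLtop : L ≠ ⊤ := by
      obtain ⟨C₂, hC₂, hint⟩ := lintegral_norm_rpow_bracket_le hd1 hγ (j := 0) (m := m) le_rfl
        (by linarith) (3 * bracket v) (by have := bracket_pos v; positivity)
      have h1 := hint v univ MeasurableSet.univ (fun y _ => bracket_le_mul_bracket_sub v y)
      rw [setLIntegral_univ] at h1
      have : Nonempty (Fin d) := ⟨⟨0, hd1⟩⟩
      have h2 : L ≤ ∫⁻ y, ENNReal.ofReal (N * f v) * (ENNReal.ofReal (1 / ε ^ 2) * M) *
          ENNReal.ofReal (‖y‖ ^ γ * bracket y ^ (0 : ℝ) * bracket (v - y) ^ (-m)) := by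
        refine lintegral_mono_ae ?_
        filter_upwards [compl_mem_ae_iff.2 (measure_singleton (0 : Euc d))] with y hy
        have h3 := hf0 v
        have h4 := hf0 (v - y)
        calc _ ≤ ENNReal.ofReal (N * f v * (‖y‖ ^ γ * bracket y ^ (0 : ℝ) * bracket (v - y) ^ (-m)))
              * (ENNReal.ofReal (1 / ε ^ 2) * M) := by
              refine mul_le_mul' (ENNReal.ofReal_le_ofReal ?_) (hβtot y hy)
              rw [Real.rpow_zero, mul_one]
              have h5 := mul_le_mul_of_nonneg_right (hf (v - y)) h3
              have h6 : 0 ≤ ‖y‖ ^ γ := by positivity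
              calc _ ≤ ‖y‖ ^ γ * (N * bracket (v - y) ^ (-m) * f v) :=
                    mul_le_mul_of_nonneg_left h5 h6
                _ = _ := by ring
          _ = _ := by
              rw [ENNReal.ofReal_mul (p := N * f v) (by positivity)]; ring
      rw [lintegral_const_mul' _ _ (by finiteness)] at h2
      refine ne_top_of_le_ne_top ?_ (h2.trans (mul_le_mul_right h1 _))
      finiteness
    have hE := hgain N hN f hfc hf0 hf v hv β M hβm hβM
    refine integral_integral_sub_le_of_lintegral_le hgm hlm hg0 hl0 (by positivity) hloss hLtop ?_
    rw [hgaineq]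
    refine hE.trans_eq ?_
    rw [ENNReal.ofReal_mul (p := C * N ^ 2 * bracket v ^ (-m)) (by positivity),
      ENNReal.ofReal_toReal hMtop.ne]
  have hle : q ≤ C * N ^ 2 * bracket v ^ (-m) * M.toReal := by
    refine le_of_tendsto hq ?_
    filter_upwards [self_mem_nhdsWithin] with ε hε using htrunc ε hε
  have : 0 ≤ N ^ 2 * bracket v ^ (-m) := by positivity
  linarith

/-! ### A divergence bound that survives pointwise limits -/

/-- The pairing of a vector field with the gradient of a bump function. -/
noncomputable def bumpPairing (ψ : ContDiffBump (0 : Euc d)) (H : Euc d → Euc d) (y : Euc d) : ℝ :=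
  ∑ i : Fin d, fderiv ℝ ψ y (EuclideanSpace.single i 1) * H y i

lemma integrable_bump_mul (ψ : ContDiffBump (0 : Euc d)) {h : Euc d → ℝ} (hh : Measurable h) {B : ℝ}
    (hB : ∀ y ∈ Metric.ball (0 : Euc d) ψ.rOut, |h y| ≤ B) :
    Integrable fun y => ψ y * h y := by
  refine Integrable.mono' (ψ.integrable.mul_const B)
    (ψ.continuous.measurable.mul hh).aestronglyMeasurable (Eventually.of_forall fun y => ?_)
  rw [norm_mul, Real.norm_of_nonneg ψ.nonneg]
  by_cases hy : y ∈ Metric.ball (0 : Euc d) ψ.rOut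
  · exact mul_le_mul_of_nonneg_left (hB y hy) ψ.nonneg
  · have : ψ y = 0 := ψ.zero_of_le_dist (by simpa using hy)
    simp [this]

lemma fderiv_bump_eq_zero (ψ : ContDiffBump (0 : Euc d)) {y : Euc d}
    (hy : y ∉ Metric.closedBall (0 : Euc d) ψ.rOut) : fderiv ℝ ψ y = 0 := by
  have : y ∉ tsupport ψ := by rwa [ψ.tsupport_eq]
  exact image_eq_zero_of_notMem_tsupport fun h => this (tsupport_fderiv_subset ℝ h)

lemma exists_norm_fderiv_bump_le (ψ : ContDiffBump (0 : Euc d)) :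
    ∃ B : ℝ, 0 ≤ B ∧ ∀ y, ‖fderiv ℝ ψ y‖ ≤ B := by
  have hc : Continuous (fderiv ℝ ψ) := (ψ.contDiff (n := 1)).continuous_fderiv one_ne_zero
  obtain ⟨B, hB⟩ := hc.bounded_above_of_compact_support (ψ.hasCompactSupport.fderiv ℝ)
  exact ⟨B, (norm_nonneg _).trans (hB 0), hB⟩

lemma abs_bumpPairing_le (ψ : ContDiffBump (0 : Euc d)) {B : ℝ} (hB : ∀ y, ‖fderiv ℝ ψ y‖ ≤ B)
    {H : Euc d → Euc d} {C : ℝ}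
    (hH : ∀ y ∈ Metric.closedBall (0 : Euc d) ψ.rOut, ‖H y‖ ≤ C)
    (y : Euc d) : |bumpPairing ψ H y| ≤
      (Metric.closedBall (0 : Euc d) ψ.rOut).indicator (fun _ => d * (B * C)) y := by
  by_cases hy : y ∈ Metric.closedBall (0 : Euc d) ψ.rOut
  · rw [indicator_of_mem hy]
    refine (Finset.abs_sum_le_sum_abs _ _).trans ?_
    refine (Finset.sum_le_card_nsmul _ _ (B * C) fun i _ => ?_).trans_eq (by simp)
    rw [abs_mul]
    refine mul_le_mul ?_ ?_ (abs_nonneg _) ((norm_nonneg _).trans (hB y))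
    · refine ((fderiv ℝ ψ y).le_opNorm _).trans ?_
      simpa using hB y
    · exact (PiLp.norm_apply_le (H y) i).trans (hH y hy)
  · rw [indicator_of_notMem hy, bumpPairing]
    simp [fderiv_bump_eq_zero ψ hy]

lemma integrable_indicator_closedBall_const (r c : ℝ) :
    Integrable ((Metric.closedBall (0 : Euc d) r).indicator fun _ => c) := by
  rw [integrable_indicator_iff Metric.isClosed_closedBall.measurableSet]
  exact integrableOn_const (by finiteness [measure_closedBall_lt_top (μ := (volume : Measure (Euc d))) (x := 0) (r := r)])

lemma integral_bump_mul_divergence (ψ : ContDiffBump (0 : Euc d)) {H : Euc d → Euc d}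
    (hH : Differentiable ℝ H) {B : ℝ}
    (hB : ∀ y ∈ Metric.ball (0 : Euc d) ψ.rOut, ‖fderiv ℝ H y‖ ≤ B) :
    (Integrable fun y => ψ y * ∑ i : Fin d, fderiv ℝ H y (EuclideanSpace.single i 1) i) ∧
    ∫ y, ψ y * ∑ i : Fin d, fderiv ℝ H y (EuclideanSpace.single i 1) i =
      -∫ y, bumpPairing ψ H y := by
  have hbound : ∀ i : Fin d, ∀ y ∈ Metric.ball (0 : Euc d) ψ.rOut,
      |fderiv ℝ H y (EuclideanSpace.single i 1) i| ≤ B := fun i y hy => by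
    refine (PiLp.norm_apply_le (fderiv ℝ H y (EuclideanSpace.single i 1)) i).trans ?_
    refine ((fderiv ℝ H y).le_opNorm _).trans ?_
    simpa using hB y hy
  have hmeas : ∀ i : Fin d, Measurable fun y => fderiv ℝ H y (EuclideanSpace.single i 1) i :=
    fun i => (EuclideanSpace.proj (𝕜 := ℝ) i).continuous.measurable.comp
      (measurable_fderiv_apply_const ℝ H _)
  have hint : ∀ i : Fin d, Integrable fun y => ψ y * fderiv ℝ H y (EuclideanSpace.single i 1) i :=
    fun i => integrable_bump_mul ψ (hmeas i) (hbound i)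
  have hψc : Continuous (fderiv ℝ ψ) := (ψ.contDiff (n := 1)).continuous_fderiv one_ne_zero
  have hpair : ∀ i : Fin d, Integrable fun y =>
      fderiv ℝ ψ y (EuclideanSpace.single i 1) * H y i := fun i => by
    refine Continuous.integrable_of_hasCompactSupport ?_ ?_
    · have := hH.continuous
      fun_prop
    · refine HasCompactSupport.mul_right ?_
      exact (ψ.hasCompactSupport.fderiv ℝ).comp_left (g := fun L : Euc d →L[ℝ] ℝ => L _) (by simp)
  simp_rw [Finset.mul_sum, bumpPairing]
  refine ⟨integrable_finsetSum _ fun i _ => hint i, ?_⟩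
  rw [integral_finsetSum _ fun i _ => hint i, integral_finsetSum _ fun i _ => hpair i,
    ← Finset.sum_neg_distrib]
  refine Finset.sum_congr rfl fun i _ => ?_
  have hcomp : ∀ y, HasFDerivAt (fun y => H y i)
      ((EuclideanSpace.proj (𝕜 := ℝ) i).comp (fderiv ℝ H y)) y := fun y =>
    (EuclideanSpace.proj (𝕜 := ℝ) i).hasFDerivAt.comp y (hH y).hasFDerivAt
  have hfd : ∀ y, fderiv ℝ (fun y => H y i) y (EuclideanSpace.single i 1) =
      fderiv ℝ H y (EuclideanSpace.single i 1) i := fun y => by rw [(hcomp y).fderiv]; rfl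
  have := integral_mul_fderiv_eq_neg_fderiv_mul_of_integrable (μ := (volume : Measure (Euc d)))
    (f := ψ) (g := fun y => H y i) (v := EuclideanSpace.single i 1) (hpair i)
    (by simpa only [hfd] using hint i)
    (by
      refine Continuous.integrable_of_hasCompactSupport ?_ ψ.hasCompactSupport.mul_right
      have := hH.continuous
      have := ψ.continuous
      fun_prop)
    (fun y _ => (ψ.contDiff (n := 1)).differentiable one_ne_zero y)
    (fun y _ => (hcomp y).differentiableAt)
  simpa only [hfd] using this

lemma neg_integral_bumpPairing_le (ψ : ContDiffBump (0 : Euc d)) {H : Euc d → Euc d}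
    (hH : Differentiable ℝ H) {B M : ℝ}
    (hB : ∀ y ∈ Metric.ball (0 : Euc d) ψ.rOut, ‖fderiv ℝ H y‖ ≤ B)
    (hM : ∀ y ∈ Metric.ball (0 : Euc d) ψ.rOut,
      ∑ i : Fin d, fderiv ℝ H y (EuclideanSpace.single i 1) i ≤ M) :
    -∫ y, bumpPairing ψ H y ≤ M * ∫ y, ψ y := by
  obtain ⟨h1, h2⟩ := integral_bump_mul_divergence ψ hH hB
  rw [← h2, ← integral_const_mul]
  refine integral_mono h1 (ψ.integrable.const_mul M) fun y => ?_
  by_cases hy : y ∈ Metric.ball (0 : Euc d) ψ.rOut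
  · simpa [mul_comm M] using mul_le_mul_of_nonneg_left (hM y hy) ψ.nonneg
  · have : ψ y = 0 := ψ.zero_of_le_dist (by simpa using hy)
    simp [this]

/-- The pairing contains no derivative of the field, so locally bounded pointwise convergence is
enough. -/
lemma tendsto_integral_bumpPairing (ψ : ContDiffBump (0 : Euc d)) {G : ℕ → Euc d → Euc d}
    {H : Euc d → Euc d} (hG : ∀ n, AEStronglyMeasurable (bumpPairing ψ (G n)) volume) {C : ℝ}
    (hGC : ∀ n, ∀ y ∈ Metric.closedBall (0 : Euc d) ψ.rOut, ‖G n y‖ ≤ C)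
    (hlim : ∀ y ∈ Metric.closedBall (0 : Euc d) ψ.rOut,
      Tendsto (fun n => G n y) atTop (𝓝 (H y))) :
    AEStronglyMeasurable (bumpPairing ψ H) volume ∧
    Tendsto (fun n => ∫ y, bumpPairing ψ (G n) y) atTop (𝓝 (∫ y, bumpPairing ψ H y)) := by
  obtain ⟨B, hB0, hB⟩ := exists_norm_fderiv_bump_le ψ
  have hl : ∀ y, Tendsto (fun n => bumpPairing ψ (G n) y) atTop (𝓝 (bumpPairing ψ H y)) := by
    intro y
    by_cases hy : y ∈ Metric.closedBall (0 : Euc d) ψ.rOut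
    · refine tendsto_finsetSum _ fun i _ => Tendsto.const_mul _ ?_
      exact ((EuclideanSpace.proj (𝕜 := ℝ) i).continuous.tendsto _).comp (hlim y hy)
    · simp [bumpPairing, fderiv_bump_eq_zero ψ hy]
  refine ⟨aestronglyMeasurable_of_tendsto_ae atTop hG (Eventually.of_forall hl), ?_⟩
  exact tendsto_integral_of_dominated_convergence _ hG
    (integrable_indicator_closedBall_const ψ.rOut (d * (B * C)))
    (fun n => Eventually.of_forall (abs_bumpPairing_le ψ hB (hGC n)))
    (Eventually.of_forall hl)

/-- If differentiable fields `G n` converge boundedly to `F` near `v` and have divergence at most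
`M` there, then the divergence of `F` at `v` is at most `M`. -/
lemma divergence_le_of_tendsto {v : Euc d} {F : Euc d → Euc d} {F' : Euc d →L[ℝ] Euc d}
    (hF : HasFDerivAt F F' v) {G : ℕ → Euc d → Euc d} (hG : ∀ n, Differentiable ℝ (G n))
    {r M C : ℝ} (hr : 0 < r)
    (hlim : ∀ u ∈ Metric.ball v r, Tendsto (fun n => G n u) atTop (𝓝 (F u)))
    (hC : ∀ n, ∀ u ∈ Metric.ball v r, ‖G n u‖ ≤ C)
    (hB : ∀ n, ∃ B, ∀ u ∈ Metric.ball v r, ‖fderiv ℝ (G n) u‖ ≤ B)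
    (hM : ∀ n, ∀ u ∈ Metric.ball v r,
      ∑ i : Fin d, fderiv ℝ (G n) u (EuclideanSpace.single i 1) i ≤ M) :
    ∑ i : Fin d, F' (EuclideanSpace.single i 1) i ≤ M := by
  let ψ : ContDiffBump (0 : Euc d) := ⟨1 / 2, 1, by norm_num, by norm_num⟩
  have hψ : ψ.rOut = 1 := rfl
  have hC0 : 0 ≤ C := (norm_nonneg _).trans (hC 0 v (Metric.mem_ball_self hr))
  have hmem : ∀ s : ℝ, 0 < s → s < r → ∀ y ∈ Metric.closedBall (0 : Euc d) ψ.rOut,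
      v + s • y ∈ Metric.ball v r := by
    intro s hs hsr y hy
    rw [mem_ball_iff_norm, add_sub_cancel_left, norm_smul, Real.norm_of_nonneg hs.le]
    have : ‖y‖ ≤ 1 := by simpa [hψ] using hy
    nlinarith
  -- The blow-up of the field at v, at scale s. Its divergence at y is that of the field at v + s y,
  -- so the bound M is preserved.
  set q : (Euc d → Euc d) → ℝ → Euc d → Euc d := fun F s y => s⁻¹ • (F (v + s • y) - F v) with hq
  have hqd : ∀ n s, 0 < s → ∀ y, HasFDerivAt (q (G n) s) (fderiv ℝ (G n) (v + s • y)) y := by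
    intro n s hs y
    have h1 : HasFDerivAt (fun y : Euc d => v + s • y) (s • ContinuousLinearMap.id ℝ (Euc d)) y :=
      ((hasFDerivAt_id y).const_smul s).const_add v
    have h2 := (((hG n (v + s • y)).hasFDerivAt.comp y h1).sub_const (G n v)).const_smul s⁻¹
    refine h2.congr_fderiv ?_
    ext1 e
    simp [smul_smul, inv_mul_cancel₀ hs.ne']
  have hqcont : ∀ n s, 0 < s → Continuous (bumpPairing ψ (q (G n) s)) := by
    intro n s hs
    have h1 : Continuous (q (G n) s) :=
      continuous_iff_continuousAt.2 fun y => (hqd n s hs y).continuousAt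
    have hψc : Continuous (fderiv ℝ ψ) := (ψ.contDiff (n := 1)).continuous_fderiv one_ne_zero
    unfold bumpPairing
    fun_prop
  -- The limit n → ∞ at a fixed scale: the weak inequality for F itself, before any use of its
  -- differentiability.
  have hstep : ∀ s, 0 < s → s < r → AEStronglyMeasurable (bumpPairing ψ (q F s)) volume ∧
      -∫ y, bumpPairing ψ (q F s) y ≤ M * ∫ y, ψ y := by
    intro s hs hsr
    have hvball : v ∈ Metric.ball v r := Metric.mem_ball_self hr
    obtain ⟨h1, h2⟩ := tendsto_integral_bumpPairing ψ (G := fun n => q (G n) s) (H := q F s)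
      (C := s⁻¹ * (C + C)) (fun n => (hqcont n s hs).aestronglyMeasurable)
      (fun n y hy => by
        simp only [hq]
        rw [norm_smul, norm_inv, Real.norm_of_nonneg hs.le]
        gcongr
        exact (norm_sub_le _ _).trans (add_le_add (hC n _ (hmem s hs hsr y hy)) (hC n v hvball)))
      (fun y hy => ((hlim _ (hmem s hs hsr y hy)).sub (hlim v hvball)).const_smul _)
    refine ⟨h1, le_of_tendsto h2.neg (Eventually.of_forall fun n => ?_)⟩
    obtain ⟨B, hB⟩ := hB n
    refine neg_integral_bumpPairing_le ψ (B := B) (fun y => (hqd n s hs y).differentiableAt) ?_ ?_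
    · intro y hy
      rw [(hqd n s hs y).fderiv]
      exact hB _ (hmem s hs hsr y (Metric.ball_subset_closedBall hy))
    · intro y hy
      rw [(hqd n s hs y).fderiv]
      exact hM n _ (hmem s hs hsr y (Metric.ball_subset_closedBall hy))
  -- Differentiability at v bounds the blow-ups near v uniformly in the scale, which gives
  -- domination as s → 0.
  obtain ⟨δ, hδ, hFδ⟩ : ∃ δ > 0, ∀ u ∈ Metric.ball v δ,
      ‖F u - F v‖ ≤ (‖F'‖ + 1) * ‖u - v‖ := by
    have h1 := hF.isLittleO.def one_pos
    obtain ⟨δ, hδ, h2⟩ := Metric.eventually_nhds_iff_ball.1 h1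
    refine ⟨δ, hδ, fun u hu => ?_⟩
    have h3 := h2 u hu
    have h4 := F'.le_opNorm (u - v)
    calc ‖F u - F v‖ = ‖(F u - F v - F' (u - v)) + F' (u - v)‖ := by simp
      _ ≤ _ := norm_add_le _ _
      _ ≤ _ := by linarith
  set s : ℕ → ℝ := fun n => min r δ / (n + 2) with hs
  have hs0 : ∀ n, 0 < s n := fun n => by
    have : 0 < min r δ := lt_min hr hδ
    simp only [hs]; positivity
  have hslt : ∀ n, s n < min r δ := fun n => by
    have : 0 < min r δ := lt_min hr hδ
    simp only [hs]
    refine div_lt_self this ?_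
    have : (0 : ℝ) ≤ n := Nat.cast_nonneg n
    linarith
  have hslim : Tendsto s atTop (𝓝 0) := by
    have h1 : Tendsto (fun n : ℕ => (n : ℝ) + 2) atTop atTop :=
      tendsto_atTop_add_const_right _ _ tendsto_natCast_atTop_atTop
    exact h1.const_div_atTop _
  obtain ⟨-, h2⟩ := tendsto_integral_bumpPairing ψ (G := fun n => q F (s n)) (H := F')
    (C := ‖F'‖ + 1) (fun n => (hstep _ (hs0 n) ((hslt n).trans_le (min_le_left _ _))).1)
    (fun n y hy => by
      have hy1 : ‖y‖ ≤ 1 := by simpa [hψ] using hy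
      have h3 := hFδ (v + s n • y) (by
        rw [mem_ball_iff_norm, add_sub_cancel_left, norm_smul, Real.norm_of_nonneg (hs0 n).le]
        have := hs0 n
        have := (hslt n).trans_le (min_le_right _ _)
        nlinarith)
      rw [add_sub_cancel_left, norm_smul, Real.norm_of_nonneg (hs0 n).le] at h3
      simp only [hq]
      rw [norm_smul, norm_inv, Real.norm_of_nonneg (hs0 n).le, inv_mul_le_iff₀ (hs0 n)]
      refine h3.trans ?_
      have := hs0 n
      have h5 : (0 : ℝ) ≤ ‖F'‖ + 1 := by positivity
      have := mul_le_mul_of_nonneg_left (mul_le_of_le_one_right (hs0 n).le hy1) h5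
      linarith)
    (fun y _ => by
      have h5 : Tendsto (fun n => (s n)⁻¹) atTop atTop :=
        tendsto_inv_nhdsGT_zero.comp (tendsto_nhdsWithin_iff.2
          ⟨hslim, Eventually.of_forall hs0⟩)
      simpa only [Function.comp_def, inv_inv] using (hF.lim_real y).comp h5)
  have h3 : -∫ y, bumpPairing ψ F' y ≤ M * ∫ y, ψ y :=
    le_of_tendsto h2.neg (Eventually.of_forall fun n =>
      (hstep _ (hs0 n) ((hslt n).trans_le (min_le_left _ _))).2)
  -- The limiting field F' is linear with constant divergence, so the weak inequality becomes the
  -- pointwise one after division by ∫ψ.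
  obtain ⟨-, h4⟩ := integral_bump_mul_divergence ψ (H := F') F'.differentiable (B := ‖F'‖)
    (fun y _ => by rw [F'.fderiv])
  simp only [F'.fderiv] at h4
  rw [← h4, integral_mul_const, mul_comm] at h3
  have hpos : 0 < ∫ y, ψ y := ψ.integral_pos
  exact le_of_mul_le_mul_right h3 hpos

/-! ### Regularized Landau kernels -/

/-- `(|z|² + ε²)^s`. -/
noncomputable def regPow (s ε : ℝ) (z : Euc d) : ℝ := (‖z‖ ^ 2 + ε ^ 2) ^ s

/-- The entries of the regularized Landau matrix `(|z|² + ε²)^{γ/2} (|z|² I - z ⊗ z)`. -/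
noncomputable def landauA (γ ε : ℝ) (i j : Fin d) (z : Euc d) : ℝ :=
  regPow (γ / 2) ε z * (‖z‖ ^ 2 * (if i = j then 1 else 0) - z i * z j)

/-- The divergence of the rows of `landauA`. -/
noncomputable def landauB (γ ε : ℝ) (i : Fin d) (z : Euc d) : ℝ :=
  -((d : ℝ) - 1) * (regPow (γ / 2) ε z * z i)

/-- A locally integrable function of polynomial growth dominating the Landau kernels. -/
noncomputable def landauEnvelope (z : Euc d) : ℝ := ‖z‖ ^ (1 - (d : ℝ)) + bracket z ^ (3 : ℝ)

lemma landauEnvelope_nonneg (z : Euc d) : 0 ≤ landauEnvelope z := by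
  have := bracket_pos z
  unfold landauEnvelope; positivity

@[fun_prop]
lemma measurable_landauEnvelope : Measurable (landauEnvelope : Euc d → ℝ) := by
  have : Continuous fun z : Euc d => bracket z ^ (3 : ℝ) := continuous_bracket_rpow 3
  unfold landauEnvelope
  have := this.measurable
  fun_prop

lemma regPow_nonneg (s ε : ℝ) (z : Euc d) : 0 ≤ regPow s ε z := by
  unfold regPow; positivity

@[fun_prop]
lemma measurable_regPow (s ε : ℝ) : Measurable (regPow s ε : Euc d → ℝ) := by
  unfold regPow; fun_prop

@[fun_prop]
lemma measurable_landauA (γ ε : ℝ) (i j : Fin d) : Measurable (landauA γ ε i j) := by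
  unfold landauA; fun_prop

@[fun_prop]
lemma measurable_landauB (γ ε : ℝ) (i : Fin d) : Measurable (landauB γ ε i) := by
  unfold landauB; fun_prop

lemma abs_apply_le (z : Euc d) (i : Fin d) : |z i| ≤ ‖z‖ := PiLp.norm_apply_le z i

/-- Uniform in the regularization: for γ < 0 the term ε² only decreases the power, and for γ ≥ 0 it
is at most 1. -/
lemma regPow_le {γ ε : ℝ} (hγ : γ ≤ 1) (hε : |ε| ≤ 1) {z : Euc d} (hz : z ≠ 0) :
    regPow (γ / 2) ε z ≤ ‖z‖ ^ γ + bracket z := by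
  have hz0 : 0 < ‖z‖ := norm_pos_iff.2 hz
  have hε2 : ε ^ 2 ≤ 1 := (sq_le_one_iff_abs_le_one ε).2 hε
  have hb := one_le_bracket z
  rcases le_or_gt 0 γ with h | h
  · have h1 : regPow (γ / 2) ε z ≤ bracket z := by
      calc regPow (γ / 2) ε z ≤ (1 + ‖z‖ ^ 2) ^ (γ / 2) := by
            unfold regPow
            exact Real.rpow_le_rpow (by positivity) (by linarith) (by positivity)
        _ = bracket z ^ γ := (bracket_rpow_eq z γ).symm
        _ ≤ bracket z ^ (1 : ℝ) := Real.rpow_le_rpow_of_exponent_le hb hγ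
        _ = bracket z := Real.rpow_one _
    have : 0 ≤ ‖z‖ ^ γ := by positivity
    linarith
  · have h1 : regPow (γ / 2) ε z ≤ ‖z‖ ^ γ := by
      calc regPow (γ / 2) ε z ≤ (‖z‖ ^ 2) ^ (γ / 2) := by
            unfold regPow
            exact Real.rpow_le_rpow_of_nonpos (by positivity) (by nlinarith [sq_nonneg ε])
              (by linarith)
        _ = ‖z‖ ^ γ := by
            rw [← Real.rpow_natCast, ← Real.rpow_mul hz0.le]; congr 1; push_cast; ring
    linarith

lemma norm_rpow_le {γ : ℝ} (hγd : -(d : ℝ) ≤ γ) (hγ : γ ≤ 1) {z : Euc d} (hz : z ≠ 0) :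
    ‖z‖ ^ γ ≤ ‖z‖ ^ (-(d : ℝ)) + bracket z := by
  have hz0 : 0 < ‖z‖ := norm_pos_iff.2 hz
  have hb := one_le_bracket z
  rcases le_or_gt ‖z‖ 1 with h | h
  · have := Real.rpow_le_rpow_of_exponent_ge hz0 h hγd
    linarith
  · have h1 := Real.rpow_le_rpow_of_exponent_le h.le hγ
    rw [Real.rpow_one] at h1
    have h2 := norm_le_bracket z
    have : 0 ≤ ‖z‖ ^ (-(d : ℝ)) := by positivity
    linarith

/-- The exponent 1 - d in `landauEnvelope` is the singularity of |z|^γ |z| in the worst case γ = -d;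
it is still locally integrable. -/
lemma regPow_mul_norm_le {γ ε : ℝ} (hγd : -(d : ℝ) ≤ γ) (hγ : γ ≤ 1) (hε : |ε| ≤ 1) (z : Euc d) :
    regPow (γ / 2) ε z * ‖z‖ ≤ 2 * landauEnvelope z := by
  rcases eq_or_ne z 0 with rfl | hz
  · simpa using landauEnvelope_nonneg (0 : Euc d)
  have hz0 : 0 < ‖z‖ := norm_pos_iff.2 hz
  have hb := one_le_bracket z
  have h1 := (regPow_le hγ hε hz).trans (add_le_add_left (norm_rpow_le hγd hγ hz) _)
  have h2 := norm_le_bracket z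
  have h3 : ‖z‖ ^ (-(d : ℝ)) * ‖z‖ = ‖z‖ ^ (1 - (d : ℝ)) := by
    rw [← Real.rpow_add_one hz0.ne']; congr 1; ring
  have h4 : bracket z ^ (3 : ℝ) = bracket z ^ 3 := by norm_cast
  have h5 := mul_le_mul_of_nonneg_right h1 hz0.le
  have h6 : 0 ≤ ‖z‖ ^ (1 - (d : ℝ)) := by positivity
  have h7 : bracket z * ‖z‖ ≤ bracket z ^ 3 := by
    calc bracket z * ‖z‖ ≤ bracket z * bracket z := by gcongr
      _ = bracket z ^ 2 := by ring
      _ ≤ bracket z ^ 3 := pow_le_pow_right₀ hb (by norm_num)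
  unfold landauEnvelope
  rw [h4]
  nlinarith

lemma regPow_mul_norm_sq_le {γ ε : ℝ} (hγd : -(d : ℝ) ≤ γ) (hγ : γ ≤ 1) (hε : |ε| ≤ 1)
    (z : Euc d) : regPow (γ / 2) ε z * ‖z‖ ^ 2 ≤ 3 * landauEnvelope z := by
  rcases le_or_gt ‖z‖ 1 with h | h
  · have h1 := regPow_mul_norm_le hγd hγ hε z
    have h2 := regPow_nonneg (γ / 2) ε z
    have h3 := landauEnvelope_nonneg z
    calc regPow (γ / 2) ε z * ‖z‖ ^ 2 ≤ regPow (γ / 2) ε z * ‖z‖ := by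
          refine mul_le_mul_of_nonneg_left ?_ h2
          nlinarith [norm_nonneg z]
      _ ≤ _ := by linarith
  · have hz0 : 0 < ‖z‖ := by linarith
    have hz : z ≠ 0 := norm_pos_iff.1 hz0
    have hb := one_le_bracket z
    have h0 := norm_le_bracket z
    have h1 := (regPow_le hγ hε hz).trans (add_le_add_left (norm_rpow_le hγd hγ hz) _)
    have h2 : ‖z‖ ^ (-(d : ℝ)) ≤ 1 :=
      Real.rpow_le_one_of_one_le_of_nonpos h.le (by simp)
    have h4 : bracket z ^ (3 : ℝ) = bracket z ^ 3 := by norm_cast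
    have h6 : 0 ≤ ‖z‖ ^ (1 - (d : ℝ)) := by positivity
    have h7 : regPow (γ / 2) ε z ≤ 3 * bracket z := by linarith
    have h8 : ‖z‖ ^ 2 ≤ bracket z ^ 2 := by gcongr
    unfold landauEnvelope
    rw [h4]
    calc regPow (γ / 2) ε z * ‖z‖ ^ 2 ≤ 3 * bracket z * bracket z ^ 2 := by
          gcongr
      _ ≤ _ := by nlinarith

lemma abs_landauA_le {γ ε : ℝ} (hγd : -(d : ℝ) ≤ γ) (hγ : γ ≤ 1) (hε : |ε| ≤ 1)
    (i j : Fin d) (z : Euc d) : |landauA γ ε i j z| ≤ 6 * landauEnvelope z := by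
  have h1 := regPow_mul_norm_sq_le hγd hγ hε z
  have h2 := regPow_nonneg (γ / 2) ε z
  have h3 : |‖z‖ ^ 2 * (if i = j then 1 else 0) - z i * z j| ≤ 2 * ‖z‖ ^ 2 := by
    have h4 : |z i * z j| ≤ ‖z‖ ^ 2 := by
      rw [abs_mul, sq]
      exact mul_le_mul (abs_apply_le z i) (abs_apply_le z j) (abs_nonneg _) (norm_nonneg _)
    rw [abs_le] at h4 ⊢
    split_ifs <;> constructor <;> nlinarith [sq_nonneg ‖z‖]
  unfold landauA
  rw [abs_mul, abs_of_nonneg h2]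
  calc _ ≤ regPow (γ / 2) ε z * (2 * ‖z‖ ^ 2) := mul_le_mul_of_nonneg_left h3 h2
    _ ≤ _ := by linarith

lemma abs_landauB_le {γ ε : ℝ} (hd : 1 ≤ d) (hγd : -(d : ℝ) ≤ γ) (hγ : γ ≤ 1) (hε : |ε| ≤ 1)
    (i : Fin d) (z : Euc d) : |landauB γ ε i z| ≤ 2 * d * landauEnvelope z := by
  have h1 := regPow_mul_norm_le hγd hγ hε z
  have h2 := regPow_nonneg (γ / 2) ε z
  have hd2 : (1 : ℝ) ≤ d := by exact_mod_cast hd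
  unfold landauB
  rw [abs_mul, abs_mul, abs_of_nonneg h2, abs_neg, abs_of_nonneg (by linarith)]
  have h3 : regPow (γ / 2) ε z * |z i| ≤ 2 * landauEnvelope z :=
    (mul_le_mul_of_nonneg_left (abs_apply_le z i) h2).trans h1
  have h4 : 0 ≤ regPow (γ / 2) ε z * |z i| := by positivity
  calc _ ≤ (d : ℝ) * (regPow (γ / 2) ε z * |z i|) := by nlinarith
    _ ≤ (d : ℝ) * (2 * landauEnvelope z) := by gcongr
    _ = _ := by ring

lemma tendsto_regPow (s : ℝ) {z : Euc d} (hz : z ≠ 0) {e : ℕ → ℝ} (he : Tendsto e atTop (𝓝 0)) :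
    Tendsto (fun n => regPow s (e n) z) atTop (𝓝 (regPow s 0 z)) := by
  unfold regPow
  have hz0 : 0 < ‖z‖ := norm_pos_iff.2 hz
  exact ((he.pow 2).const_add _).rpow_const (Or.inl (by positivity))

lemma tendsto_landauA (γ : ℝ) (i j : Fin d) {z : Euc d} (hz : z ≠ 0) {e : ℕ → ℝ}
    (he : Tendsto e atTop (𝓝 0)) :
    Tendsto (fun n => landauA γ (e n) i j z) atTop (𝓝 (landauA γ 0 i j z)) :=
  (tendsto_regPow _ hz he).mul_const _

lemma tendsto_landauB (γ : ℝ) (i : Fin d) {z : Euc d} (hz : z ≠ 0) {e : ℕ → ℝ}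
    (he : Tendsto e atTop (𝓝 0)) :
    Tendsto (fun n => landauB γ (e n) i z) atTop (𝓝 (landauB γ 0 i z)) :=
  ((tendsto_regPow _ hz he).mul_const _).const_mul _

lemma landauA_symm (γ ε : ℝ) (i j : Fin d) : landauA γ ε i j = landauA γ ε j i := by
  ext z
  unfold landauA
  rw [mul_comm (z i), if_congr (eq_comm (a := i)) rfl rfl]

/-! ### Derivatives of the regularized kernels -/

lemma hasFDerivAt_regPow (s : ℝ) {ε : ℝ} (hε : 0 < ε) (z : Euc d) :
    HasFDerivAt (regPow s ε) ((2 * s * regPow (s - 1) ε z) • innerSL ℝ z) z := by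
  have h1 : HasFDerivAt (fun z : Euc d => ‖z‖ ^ 2 + ε ^ 2) (2 • innerSL ℝ z) z :=
    (hasStrictFDerivAt_norm_sq z).hasFDerivAt.add_const _
  have h2 := h1.rpow_const (p := s) (Or.inl (by positivity))
  refine h2.congr_fderiv ?_
  ext e
  simp [regPow]
  ring

lemma hasFDerivAt_apply (i : Fin d) (z : Euc d) :
    HasFDerivAt (fun z : Euc d => z i) (EuclideanSpace.proj (𝕜 := ℝ) i) z :=
  (EuclideanSpace.proj (𝕜 := ℝ) i).hasFDerivAt

lemma fderiv_landauA (γ : ℝ) {ε : ℝ} (hε : 0 < ε) (i j : Fin d) (z e : Euc d) :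
    fderiv ℝ (landauA γ ε i j) z e =
      γ * regPow (γ / 2 - 1) ε z * inner ℝ z e * (‖z‖ ^ 2 * (if i = j then 1 else 0) - z i * z j) +
      regPow (γ / 2) ε z * (2 * inner ℝ z e * (if i = j then 1 else 0) - (e i * z j + z i * e j)) := by
  have h1 : HasFDerivAt (fun z : Euc d => ‖z‖ ^ 2) (2 • innerSL ℝ z) z :=
    (hasStrictFDerivAt_norm_sq z).hasFDerivAt
  have h2 := (h1.mul_const (if i = j then 1 else 0 : ℝ)).sub
    ((hasFDerivAt_apply i z).mul (hasFDerivAt_apply j z))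
  have h3 := (hasFDerivAt_regPow (γ / 2) hε z).mul h2
  have h4 : HasFDerivAt (landauA γ ε i j) _ z := h3
  rw [h4.fderiv]
  split_ifs <;> simp <;> ring

lemma inner_single_one (z : Euc d) (i : Fin d) :
    inner ℝ z (EuclideanSpace.single i (1 : ℝ)) = z i := by
  simp [EuclideanSpace.inner_single_right]

lemma fderiv_landauB (γ : ℝ) {ε : ℝ} (hε : 0 < ε) (i : Fin d) (z e : Euc d) :
    fderiv ℝ (landauB γ ε i) z e = -((d : ℝ) - 1) *
      (γ * regPow (γ / 2 - 1) ε z * inner ℝ z e * z i + regPow (γ / 2) ε z * e i) := by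
  have h3 := ((hasFDerivAt_regPow (γ / 2) hε z).mul (hasFDerivAt_apply i z)).const_mul
    (-((d : ℝ) - 1))
  have h4 : HasFDerivAt (landauB γ ε i) _ z := h3
  rw [h4.fderiv]
  simp
  ring

/-- The vector z lies in the kernel of |z|²I - z⊗z, so the derivative of the radial factor
contributes nothing; the divergence of the matrix itself is -(d-1)z. -/
lemma sum_fderiv_landauA (γ : ℝ) {ε : ℝ} (hε : 0 < ε) (i : Fin d) (z : Euc d) :
    ∑ j : Fin d, fderiv ℝ (landauA γ ε i j) z (EuclideanSpace.single j 1) = landauB γ ε i z := by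
  have hz : ∑ j : Fin d, z j ^ 2 = ‖z‖ ^ 2 := by simp [EuclideanSpace.norm_sq_eq]
  have h1 : ∀ j : Fin d, fderiv ℝ (landauA γ ε i j) z (EuclideanSpace.single j 1) =
      γ * regPow (γ / 2 - 1) ε z * (‖z‖ ^ 2 * (if i = j then z j else 0) - z i * z j ^ 2) +
      regPow (γ / 2) ε z * ((if i = j then z j else 0) - z i) := by
    intro j
    rw [fderiv_landauA γ hε, inner_single_one]
    by_cases h : i = j
    · subst h; simp; ring
    · have h' : j ≠ i := fun h' => h h'.symm
      simp [h]; ring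
  simp_rw [h1]
  rw [Finset.sum_add_distrib, ← Finset.mul_sum, ← Finset.mul_sum, Finset.sum_sub_distrib,
    Finset.sum_sub_distrib, ← Finset.mul_sum, ← Finset.mul_sum, hz]
  simp [landauB]
  ring

/-- The factor d + γ vanishes in the Coulomb case γ = -d, where only the concentrating term in ε² is
left. -/
lemma sum_fderiv_landauB (γ : ℝ) {ε : ℝ} (hε : 0 < ε) (z : Euc d) :
    ∑ i : Fin d, fderiv ℝ (landauB γ ε i) z (EuclideanSpace.single i 1) =
      -((d : ℝ) - 1) * (regPow (γ / 2 - 1) ε z * ((d + γ) * ‖z‖ ^ 2 + d * ε ^ 2)) := by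
  have hz : ∑ j : Fin d, z j ^ 2 = ‖z‖ ^ 2 := by simp [EuclideanSpace.norm_sq_eq]
  have hρ : 0 < ‖z‖ ^ 2 + ε ^ 2 := by positivity
  have hr : regPow (γ / 2) ε z = regPow (γ / 2 - 1) ε z * (‖z‖ ^ 2 + ε ^ 2) := by
    unfold regPow
    rw [← Real.rpow_add_one hρ.ne']; congr 1; ring
  have h1 : ∀ i : Fin d, fderiv ℝ (landauB γ ε i) z (EuclideanSpace.single i 1) =
      -((d : ℝ) - 1) * (γ * regPow (γ / 2 - 1) ε z * z i ^ 2 + regPow (γ / 2) ε z) := by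
    intro i
    rw [fderiv_landauB γ hε, inner_single_one]
    simp only [PiLp.single_apply, if_true]
    ring
  simp_rw [h1]
  rw [← Finset.mul_sum, Finset.sum_add_distrib, ← Finset.mul_sum, hz]
  simp
  rw [hr]
  left
  ring

/-- Continuously differentiable functions growing, together with their derivative, at most like
`⟨z⟩^n`. -/
def HasC1Growth (n : ℕ) (k : Euc d → ℝ) : Prop :=
  ContDiff ℝ 1 k ∧ ∃ C : ℝ, 0 ≤ C ∧ ∀ z, |k z| ≤ C * bracket z ^ n ∧
    ‖fderiv ℝ k z‖ ≤ C * bracket z ^ n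

lemma HasC1Growth.mul {n l : ℕ} {k h : Euc d → ℝ} (hk : HasC1Growth n k) (hh : HasC1Growth l h) :
    HasC1Growth (n + l) (fun z => k z * h z) := by
  obtain ⟨hk1, C, hC, hk2⟩ := hk
  obtain ⟨hh1, D, hD, hh2⟩ := hh
  refine ⟨hk1.mul hh1, 2 * (C * D), by positivity, fun z => ?_⟩
  have hb := bracket_pos z
  have e1 : 0 ≤ C * D * bracket z ^ (n + l) := by positivity
  have e2 : C * bracket z ^ n * (D * bracket z ^ l) = C * D * bracket z ^ (n + l) := by
    rw [pow_add]; ring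
  have hfd := ((hk1.differentiable one_ne_zero z).hasFDerivAt.mul
    (hh1.differentiable one_ne_zero z).hasFDerivAt).fderiv
  constructor
  · rw [abs_mul]
    have := mul_le_mul (hk2 z).1 (hh2 z).1 (abs_nonneg _) (by positivity)
    linarith
  · have hfd' : fderiv ℝ (fun z => k z * h z) z = k z • fderiv ℝ h z + h z • fderiv ℝ k z := hfd
    rw [hfd']
    refine (norm_add_le _ _).trans ?_
    rw [norm_smul, norm_smul, Real.norm_eq_abs, Real.norm_eq_abs]
    have h1 := mul_le_mul (hk2 z).1 (hh2 z).2 (norm_nonneg _) (by positivity)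
    have h2 := mul_le_mul (hk2 z).2 (hh2 z).1 (abs_nonneg _) (by positivity)
    linarith

lemma HasC1Growth.sub {n : ℕ} {k h : Euc d → ℝ} (hk : HasC1Growth n k) (hh : HasC1Growth n h) :
    HasC1Growth n (fun z => k z - h z) := by
  obtain ⟨hk1, C, hC, hk2⟩ := hk
  obtain ⟨hh1, D, hD, hh2⟩ := hh
  refine ⟨hk1.sub hh1, C + D, by positivity, fun z => ?_⟩
  rw [add_mul]
  constructor
  · exact (abs_sub _ _).trans (add_le_add (hk2 z).1 (hh2 z).1)
  · rw [fderiv_fun_sub (hk1.differentiable one_ne_zero z) (hh1.differentiable one_ne_zero z)]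
    exact (norm_sub_le _ _).trans (add_le_add (hk2 z).2 (hh2 z).2)

lemma hasC1Growth_const (n : ℕ) (c : ℝ) : HasC1Growth n (fun _ : Euc d => c) := by
  refine ⟨contDiff_const, |c|, abs_nonneg c, fun z => ?_⟩
  have h := one_le_pow₀ (one_le_bracket z) (n := n)
  constructor
  · exact le_mul_of_one_le_right (abs_nonneg c) h
  · simp; positivity

lemma hasC1Growth_apply (i : Fin d) : HasC1Growth 1 (fun z : Euc d => z i) := by
  refine ⟨by fun_prop, 1, zero_le_one, fun z => ?_⟩
  rw [pow_one, one_mul]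
  refine ⟨(abs_apply_le z i).trans (norm_le_bracket z), ?_⟩
  rw [(hasFDerivAt_apply i z).fderiv]
  refine (ContinuousLinearMap.opNorm_le_bound _ zero_le_one fun e => ?_).trans (one_le_bracket z)
  simpa using abs_apply_le e i

lemma hasC1Growth_norm_sq : HasC1Growth 2 (fun z : Euc d => ‖z‖ ^ 2) := by
  refine ⟨contDiff_norm_sq ℝ, 2, zero_le_two, fun z => ?_⟩
  have h1 := norm_le_bracket z
  have h2 := one_le_bracket z
  have h3 := norm_nonneg z
  constructor
  · rw [abs_of_nonneg (by positivity)]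
    nlinarith
  · rw [(hasStrictFDerivAt_norm_sq z).hasFDerivAt.fderiv]
    have : ‖(2 : ℕ) • innerSL ℝ z‖ ≤ 2 * ‖z‖ := by
      refine (norm_nsmul_le (n := 2)).trans ?_
      simp
    nlinarith

/-- The constant degenerates as ε → 0. It only justifies differentiation under the integral at fixed
ε and never enters a final bound. -/
lemma hasC1Growth_regPow {γ ε : ℝ} (hγ : γ ≤ 1) (hε : 0 < ε) (hε1 : ε ≤ 1) :
    HasC1Growth 1 (regPow (γ / 2) ε : Euc d → ℝ) := by
  have hcd : ContDiff ℝ 1 (regPow (γ / 2) ε : Euc d → ℝ) := by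
    unfold regPow
    exact ((contDiff_norm_sq ℝ).add contDiff_const).rpow_const_of_ne fun z => by positivity
  have hbd : ∃ C : ℝ, 0 ≤ C ∧ ∀ z : Euc d, regPow (γ / 2) ε z ≤ C * bracket z := by
    refine ⟨max 1 (ε ^ γ), by positivity, fun z => ?_⟩
    have hb := one_le_bracket z
    rcases le_or_gt 0 γ with h | h
    · calc regPow (γ / 2) ε z ≤ (1 + ‖z‖ ^ 2) ^ (γ / 2) := by
            unfold regPow
            exact Real.rpow_le_rpow (by positivity) (by nlinarith) (by positivity)
        _ = bracket z ^ γ := (bracket_rpow_eq z γ).symm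
        _ ≤ bracket z ^ (1 : ℝ) := Real.rpow_le_rpow_of_exponent_le hb hγ
        _ = 1 * bracket z := by rw [Real.rpow_one, one_mul]
        _ ≤ _ := by gcongr; exact le_max_left _ _
    · calc regPow (γ / 2) ε z ≤ (ε ^ 2) ^ (γ / 2) := by
            unfold regPow
            exact Real.rpow_le_rpow_of_nonpos (by positivity) (by nlinarith [sq_nonneg ‖z‖])
              (by linarith)
        _ = ε ^ γ := by
            rw [← Real.rpow_natCast, ← Real.rpow_mul hε.le]; congr 1; push_cast; ring
        _ ≤ max 1 (ε ^ γ) * 1 := by rw [mul_one]; exact le_max_right _ _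
        _ ≤ _ := by gcongr
  obtain ⟨C, hC, hCb⟩ := hbd
  refine ⟨hcd, C * max 1 (|γ| / (2 * ε)), by positivity, fun z => ?_⟩
  have hb := bracket_pos z
  rw [pow_one]
  have hr := regPow_nonneg (γ / 2) ε z
  constructor
  · rw [abs_of_nonneg hr]
    calc _ ≤ C * 1 * bracket z := by simpa using hCb z
      _ ≤ _ := by gcongr; exact le_max_left _ _
  · rw [(hasFDerivAt_regPow _ hε z).fderiv, norm_smul]
    have hr1 := regPow_nonneg (γ / 2 - 1) ε z
    have hr2 : regPow (γ / 2) ε z = regPow (γ / 2 - 1) ε z * (‖z‖ ^ 2 + ε ^ 2) := by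
      unfold regPow
      rw [← Real.rpow_add_one (by positivity)]; congr 1; ring
    have h1 : ‖2 * (γ / 2) * regPow (γ / 2 - 1) ε z‖ = |γ| * regPow (γ / 2 - 1) ε z := by
      rw [norm_mul, Real.norm_of_nonneg hr1, Real.norm_eq_abs]; congr 2; ring
    have h2 : ‖innerSL ℝ z‖ = ‖z‖ := by simp
    rw [h1, h2]
    -- The inequality 2ε|z| ≤ |z|² + ε².
    have h3 : regPow (γ / 2 - 1) ε z * ‖z‖ ≤ regPow (γ / 2) ε z / (2 * ε) := by
      rw [hr2, le_div_iff₀ (by positivity), mul_assoc]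
      refine mul_le_mul_of_nonneg_left ?_ hr1
      nlinarith [sq_nonneg (‖z‖ - ε)]
    calc |γ| * regPow (γ / 2 - 1) ε z * ‖z‖ = |γ| * (regPow (γ / 2 - 1) ε z * ‖z‖) := by ring
      _ ≤ |γ| * (regPow (γ / 2) ε z / (2 * ε)) := by gcongr
      _ = |γ| / (2 * ε) * regPow (γ / 2) ε z := by ring
      _ ≤ max 1 (|γ| / (2 * ε)) * (C * bracket z) := by
          gcongr
          · exact le_max_right _ _
          · exact hCb z
      _ = _ := by ring

lemma hasC1Growth_landauA {γ ε : ℝ} (hγ : γ ≤ 1) (hε : 0 < ε) (hε1 : ε ≤ 1) (i j : Fin d) :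
    HasC1Growth 3 (landauA γ ε i j) :=
  (hasC1Growth_regPow hγ hε hε1).mul ((hasC1Growth_norm_sq.mul (hasC1Growth_const 0 _)).sub
    ((hasC1Growth_apply i).mul (hasC1Growth_apply j)))

lemma hasC1Growth_landauB {γ ε : ℝ} (hγ : γ ≤ 1) (hε : 0 < ε) (hε1 : ε ≤ 1) (i : Fin d) :
    HasC1Growth 3 (landauB γ ε i) :=
  (hasC1Growth_const 1 _).mul ((hasC1Growth_regPow hγ hε hε1).mul (hasC1Growth_apply i))

/-! ### Convolutions with kernels of polynomial growth -/

/-- The convolution `∫ g(w) k(u - w) dw`. -/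
noncomputable def kernelConv (g k : Euc d → ℝ) (u : Euc d) : ℝ := ∫ w, g w * k (u - w)

/-- The singular part requires m > 2d - 1 and the cubic part m > d + 3; both follow from m > 2d + 2
since d ≥ 1. -/
lemma lintegral_landauEnvelope_le (hd : 1 ≤ d) {m : ℝ} (hm : 2 * d + 2 < m) (a : ℝ) (ha : 0 ≤ a) :
    ∃ C : ℝ, 0 ≤ C ∧ ∀ (v : Euc d) (s : Set (Euc d)), MeasurableSet s →
      (∀ y ∈ s, bracket y ≤ a * bracket (v - y)) →
      ∫⁻ y in s, ENNReal.ofReal (landauEnvelope y * bracket (v - y) ^ (-m)) ≤ ENNReal.ofReal C := by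
  have hd1 : (1 : ℝ) ≤ d := by exact_mod_cast hd
  have habs : |1 - (d : ℝ)| = d - 1 := by rw [abs_of_nonpos (by linarith)]; ring
  obtain ⟨C₁, hC₁, h₁⟩ := lintegral_norm_rpow_bracket_le hd (γ := 1 - (d : ℝ)) (by linarith)
    (j := 0) (m := m) le_rfl (by rw [habs]; linarith) a ha
  obtain ⟨C₂, hC₂, h₂⟩ := lintegral_norm_rpow_bracket_le hd (γ := 0) (by linarith)
    (j := 3) (m := m) (by norm_num) (by rw [abs_zero]; linarith) a ha
  refine ⟨C₁ + C₂, by positivity, fun v s hs hsa => ?_⟩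
  rw [ENNReal.ofReal_add hC₁ hC₂]
  refine le_trans ?_ (add_le_add (h₁ v s hs hsa) (h₂ v s hs hsa))
  refine le_trans (lintegral_mono fun y => ?_) (lintegral_add_left' ?_ _).le
  · have hb1 := bracket_pos y
    have hb2 := bracket_pos (v - y)
    rw [← ENNReal.ofReal_add (by positivity) (by positivity)]
    refine ENNReal.ofReal_le_ofReal (le_of_eq ?_)
    simp only [landauEnvelope, Real.rpow_zero]
    ring
  · have h1 : Continuous fun y : Euc d => bracket (v - y) ^ (-m) :=
      (continuous_bracket_rpow (-m)).comp (by fun_prop)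
    have h2 : Continuous fun y : Euc d => bracket y ^ (0 : ℝ) := continuous_bracket_rpow 0
    have := h1.measurable
    have := h2.measurable
    fun_prop

lemma integrable_bracket_mul_landauEnvelope (hd : 1 ≤ d) {m : ℝ} (hm : 2 * d + 2 < m) (u : Euc d) :
    Integrable fun w => bracket w ^ (-m) * landauEnvelope (u - w) := by
  have hb := bracket_pos u
  obtain ⟨C, hC, h⟩ := lintegral_landauEnvelope_le hd hm (3 * bracket u) (by positivity)
  have h1 := h u univ MeasurableSet.univ fun y _ => bracket_le_mul_bracket_sub u y
  rw [setLIntegral_univ] at h1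
  have hm1 : Measurable fun y : Euc d => bracket (u - y) ^ (-m) :=
    ((continuous_bracket_rpow (-m)).comp (by fun_prop)).measurable
  have h2 : Integrable fun y => landauEnvelope y * bracket (u - y) ^ (-m) := by
    refine ⟨(measurable_landauEnvelope.mul hm1).aestronglyMeasurable, ?_⟩
    rw [hasFiniteIntegral_iff_ofReal (Eventually.of_forall fun y =>
      mul_nonneg (landauEnvelope_nonneg y) (Real.rpow_nonneg (bracket_pos _).le _))]
    exact h1.trans_lt ENNReal.ofReal_lt_top
  simpa [mul_comm] using h2.comp_sub_left u

lemma ae_sub_ne (hd : 1 ≤ d) (u : Euc d) : ∀ᵐ w : Euc d, u - w ≠ 0 := by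
  have : Nonempty (Fin d) := ⟨⟨0, hd⟩⟩
  filter_upwards [compl_mem_ae_iff.2 (measure_singleton u)] with w hw h
  exact hw (sub_eq_zero.1 h).symm

lemma abs_mul_kernel_le {m C D : ℝ} {f k : Euc d → ℝ}
    (hf : ∀ w, |f w| ≤ C * bracket w ^ (-m)) (hk : ∀ z, |k z| ≤ D * landauEnvelope z) (u w : Euc d) :
    ‖f w * k (u - w)‖ ≤ C * D * (bracket w ^ (-m) * landauEnvelope (u - w)) := by
  rw [norm_mul, Real.norm_eq_abs, Real.norm_eq_abs]
  calc _ ≤ (C * bracket w ^ (-m)) * (D * landauEnvelope (u - w)) :=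
        mul_le_mul (hf w) (hk _) (abs_nonneg _) ((abs_nonneg _).trans (hf w))
    _ = _ := by ring

lemma integrable_mul_kernel (hd : 1 ≤ d) {m : ℝ} (hm : 2 * d + 2 < m) {C D : ℝ} {f k : Euc d → ℝ}
    (hfm : Measurable f) (hkm : Measurable k)
    (hf : ∀ w, |f w| ≤ C * bracket w ^ (-m)) (hk : ∀ z, |k z| ≤ D * landauEnvelope z) (u : Euc d) :
    Integrable fun w => f w * k (u - w) := by
  refine Integrable.mono' ((integrable_bracket_mul_landauEnvelope hd hm u).const_mul (C * D))
    (by fun_prop) (Eventually.of_forall (abs_mul_kernel_le hf hk u))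

lemma abs_kernelConv_le (hd : 1 ≤ d) {m : ℝ} (hm : 2 * d + 2 < m) (ρ : ℝ) (hρ : 0 ≤ ρ) :
    ∃ B : ℝ, 0 ≤ B ∧ ∀ (C D : ℝ) (f k : Euc d → ℝ), 0 ≤ D →
      (∀ w, |f w| ≤ C * bracket w ^ (-m)) → (∀ z, |k z| ≤ D * landauEnvelope z) →
      ∀ u, bracket u ≤ ρ → |kernelConv f k u| ≤ C * D * B := by
  obtain ⟨B, hB, h⟩ := lintegral_landauEnvelope_le hd hm (3 * ρ) (by positivity)
  refine ⟨B, hB, fun C D f k hD hf hk u hu => ?_⟩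
  have hC : 0 ≤ C := by
    have := (abs_nonneg _).trans (hf 0)
    exact nonneg_of_mul_nonneg_left this (Real.rpow_pos_of_pos (bracket_pos _) _)
  have h1 := h u univ MeasurableSet.univ fun y _ => (bracket_le_mul_bracket_sub u y).trans
    (by have := bracket_pos (u - y); gcongr)
  rw [setLIntegral_univ] at h1
  have hint := integrable_bracket_mul_landauEnvelope hd hm u
  have h2 : ∫ w, bracket w ^ (-m) * landauEnvelope (u - w) ≤ B := by
    rw [← integral_sub_left_eq_self _ volume u, integral_eq_lintegral_of_nonneg_ae]
    · refine ENNReal.toReal_le_of_le_ofReal hB (le_trans (le_of_eq ?_) h1)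
      refine lintegral_congr fun y => ?_
      rw [sub_sub_cancel, mul_comm]
    · exact Eventually.of_forall fun y => mul_nonneg
        (Real.rpow_nonneg (bracket_pos _).le _) (landauEnvelope_nonneg _)
    · exact (hint.comp_sub_left u).aestronglyMeasurable
  calc |kernelConv f k u| ≤ ∫ w, C * D * (bracket w ^ (-m) * landauEnvelope (u - w)) :=
        norm_integral_le_of_norm_le (hint.const_mul _)
          (Eventually.of_forall (abs_mul_kernel_le hf hk u))
    _ = C * D * ∫ w, bracket w ^ (-m) * landauEnvelope (u - w) := integral_const_mul _ _
    _ ≤ _ := by gcongr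

lemma tendsto_kernelConv (hd : 1 ≤ d) {m : ℝ} (hm : 2 * d + 2 < m) {C D : ℝ}
    {f : ℕ → Euc d → ℝ} {f₀ : Euc d → ℝ} {k : ℕ → Euc d → ℝ} {k₀ : Euc d → ℝ}
    (hfm : ∀ n, Measurable (f n)) (hkm : ∀ n, Measurable (k n))
    (hf : ∀ n w, |f n w| ≤ C * bracket w ^ (-m)) (hk : ∀ n z, |k n z| ≤ D * landauEnvelope z)
    (hflim : ∀ w, Tendsto (fun n => f n w) atTop (𝓝 (f₀ w)))
    (hklim : ∀ z ≠ 0, Tendsto (fun n => k n z) atTop (𝓝 (k₀ z))) (u : Euc d) :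
    Tendsto (fun n => kernelConv (f n) (k n) u) atTop (𝓝 (kernelConv f₀ k₀ u)) := by
  refine tendsto_integral_of_dominated_convergence
    (fun w => C * D * (bracket w ^ (-m) * landauEnvelope (u - w))) (fun n => ?_)
    ((integrable_bracket_mul_landauEnvelope hd hm u).const_mul _)
    (fun n => Eventually.of_forall (abs_mul_kernel_le (hf n) (hk n) u)) ?_
  · have := hfm n
    have := hkm n
    fun_prop
  · filter_upwards [ae_sub_ne hd u] with w hw
    exact (hflim w).mul (hklim _ hw)

/-! ### Differentiation of convolutions with regular kernels -/

lemma integrable_bracket_rpow {r : ℝ} (hr : (d : ℝ) < r) :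
    Integrable fun w : Euc d => bracket w ^ (-r) := by
  have h := integrable_rpow_neg_one_add_norm_sq (E := Euc d) (μ := volume) (r := r)
    (by simpa using hr)
  simpa only [bracket_rpow_eq] using h

lemma bracket_sub_le_mul (u w : Euc d) : bracket (u - w) ≤ 3 * bracket u * bracket w := by
  have := bracket_le_mul_bracket_sub u (u - w)
  rwa [sub_sub_cancel] at this

lemma bracket_pow_mul_le {m : ℝ} (n : ℕ) {ρ : ℝ} {u : Euc d} (hu : bracket u ≤ ρ) (w : Euc d) :
    bracket w ^ (-m) * bracket (u - w) ^ n ≤ (3 * ρ) ^ n * bracket w ^ (-(m - n)) := by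
  have hb := bracket_pos w
  have hbu := bracket_pos u
  have hbs := bracket_pos (u - w)
  have h1 : bracket (u - w) ^ n ≤ (3 * ρ * bracket w) ^ n :=
    pow_le_pow_left₀ hbs.le ((bracket_sub_le_mul u w).trans (by gcongr)) _
  have h2 : bracket w ^ (-(m - n)) = bracket w ^ (-m) * bracket w ^ n := by
    rw [← Real.rpow_natCast, ← Real.rpow_add hb]; congr 1; ring
  rw [h2]
  calc _ ≤ bracket w ^ (-m) * (3 * ρ * bracket w) ^ n := by gcongr
    _ = _ := by rw [mul_pow]; ring

lemma bracket_le_of_mem_ball {u u' : Euc d} (h : u' ∈ Metric.ball u 1) :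
    bracket u' ≤ bracket u + 2 := by
  have h1 := bracket_le_one_add_norm u'
  have h2 := norm_le_bracket u
  have h3 : ‖u' - u‖ < 1 := mem_ball_iff_norm.1 h
  have h4 : ‖u'‖ ≤ ‖u‖ + ‖u' - u‖ := by
    calc ‖u'‖ = ‖u + (u' - u)‖ := by simp
      _ ≤ _ := norm_add_le _ _
  linarith

lemma HasC1Growth.integrable {n : ℕ} {k : Euc d → ℝ} (hk : HasC1Growth n k) {g : Euc d → ℝ}
    (hg : Continuous g) {m N : ℝ} (hgN : ∀ w, |g w| ≤ N * bracket w ^ (-m)) (hm : d + n < m)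
    (u : Euc d) : (Integrable fun w => g w * k (u - w)) ∧
      (Integrable fun w => g w • fderiv ℝ k (u - w)) ∧
      ∀ e, Integrable fun w => g w * fderiv ℝ k (u - w) e := by
  obtain ⟨hk1, C, hC, hkC⟩ := hk
  have hN : 0 ≤ N := by
    have := (abs_nonneg _).trans (hgN 0)
    exact nonneg_of_mul_nonneg_left this (Real.rpow_pos_of_pos (bracket_pos _) _)
  have hint : Integrable fun w : Euc d => N * C * (3 * bracket u) ^ n * bracket w ^ (-(m - n)) :=
    (integrable_bracket_rpow (by linarith)).const_mul _
  have hcf := hk1.continuous_fderiv one_ne_zero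
  have hck := hk1.continuous
  have hmain : ∀ w, ∀ t : ℝ, t ≤ C * bracket (u - w) ^ n → 0 ≤ t →
      |g w| * t ≤ N * C * (3 * bracket u) ^ n * bracket w ^ (-(m - n)) := by
    intro w t ht ht0
    have h1 := bracket_pow_mul_le (m := m) n (le_refl (bracket u)) w
    calc |g w| * t ≤ (N * bracket w ^ (-m)) * (C * bracket (u - w) ^ n) :=
          mul_le_mul (hgN w) ht ht0 ((abs_nonneg _).trans (hgN w))
      _ = N * C * (bracket w ^ (-m) * bracket (u - w) ^ n) := by ring
      _ ≤ N * C * ((3 * bracket u) ^ n * bracket w ^ (-(m - n))) := by gcongr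
      _ = _ := by ring
  have h2 : Integrable fun w => g w • fderiv ℝ k (u - w) := by
    refine Integrable.mono' hint (Continuous.aestronglyMeasurable (by fun_prop))
      (Eventually.of_forall fun w => ?_)
    rw [norm_smul]
    exact hmain w _ (hkC _).2 (norm_nonneg _)
  refine ⟨?_, h2, fun e => ?_⟩
  · refine Integrable.mono' hint (Continuous.aestronglyMeasurable (by fun_prop))
      (Eventually.of_forall fun w => ?_)
    rw [norm_mul]
    exact hmain w _ (hkC _).1 (norm_nonneg _)
  · simpa using h2.apply_continuousLinearMap e

/-- All derivatives fall on the kernel, so only the decay of g is used and none of ∇g. -/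
lemma HasC1Growth.hasFDerivAt_kernelConv {n : ℕ} {k : Euc d → ℝ} (hk : HasC1Growth n k)
    {g : Euc d → ℝ} (hg : Continuous g) {m N : ℝ} (hgN : ∀ w, |g w| ≤ N * bracket w ^ (-m))
    (hm : d + n < m) (u : Euc d) :
    HasFDerivAt (kernelConv g k) (∫ w, g w • fderiv ℝ k (u - w)) u := by
  obtain ⟨hi1, hi2, -⟩ := hk.integrable hg hgN hm u
  obtain ⟨hk1, C, hC, hkC⟩ := hk
  have hN : 0 ≤ N := by
    have := (abs_nonneg _).trans (hgN 0)
    exact nonneg_of_mul_nonneg_left this (Real.rpow_pos_of_pos (bracket_pos _) _)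
  have hck := hk1.continuous
  refine hasFDerivAt_integral_of_dominated_of_fderiv_le (s := Metric.ball u 1)
    (F := fun u w => g w * k (u - w)) (F' := fun u w => g w • fderiv ℝ k (u - w))
    (bound := fun w => N * C * (3 * (bracket u + 2)) ^ n * bracket w ^ (-(m - n)))
    (Metric.ball_mem_nhds u one_pos) (Eventually.of_forall fun u' =>
      Continuous.aestronglyMeasurable (by fun_prop)) hi1 hi2.aestronglyMeasurable
    (Eventually.of_forall fun w u' hu' => ?_)
    ((integrable_bracket_rpow (by linarith)).const_mul _)
    (Eventually.of_forall fun w u' _ => ?_)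
  · have h1 := bracket_pow_mul_le (m := m) n (bracket_le_of_mem_ball hu') w
    rw [norm_smul]
    calc ‖g w‖ * ‖fderiv ℝ k (u' - w)‖ ≤ (N * bracket w ^ (-m)) * (C * bracket (u' - w) ^ n) :=
          mul_le_mul (hgN w) (hkC _).2 (norm_nonneg _) ((abs_nonneg _).trans (hgN w))
      _ = N * C * (bracket w ^ (-m) * bracket (u' - w) ^ n) := by ring
      _ ≤ N * C * ((3 * (bracket u + 2)) ^ n * bracket w ^ (-(m - n))) := by gcongr
      _ = _ := by ring
  · have h1 : HasFDerivAt (fun u : Euc d => u - w) (ContinuousLinearMap.id ℝ (Euc d)) u' :=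
      (hasFDerivAt_id u').sub_const w
    exact (((hk1.differentiable one_ne_zero (u' - w)).hasFDerivAt.comp u' h1).const_mul
      (g w)).congr_fderiv (by simp)

lemma HasC1Growth.fderiv_kernelConv_apply {n : ℕ} {k : Euc d → ℝ} (hk : HasC1Growth n k)
    {g : Euc d → ℝ} (hg : Continuous g) {m N : ℝ} (hgN : ∀ w, |g w| ≤ N * bracket w ^ (-m))
    (hm : d + n < m) (u e : Euc d) :
    fderiv ℝ (kernelConv g k) u e = ∫ w, g w * fderiv ℝ k (u - w) e := by
  rw [(hk.hasFDerivAt_kernelConv hg hgN hm u).fderiv,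
    ContinuousLinearMap.integral_apply (hk.integrable hg hgN hm u).2.1]
  rfl

lemma HasC1Growth.contDiff_kernelConv {n : ℕ} {k : Euc d → ℝ} (hk : HasC1Growth n k)
    {g : Euc d → ℝ} (hg : Continuous g) {m N : ℝ} (hgN : ∀ w, |g w| ≤ N * bracket w ^ (-m))
    (hm : d + n < m) : ContDiff ℝ 1 (kernelConv g k) := by
  refine contDiff_one_iff_hasFDerivAt.2 ⟨fun u => ∫ w, g w • fderiv ℝ k (u - w), ?_,
    hk.hasFDerivAt_kernelConv hg hgN hm⟩
  obtain ⟨hk1, C, hC, hkC⟩ := hk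
  have hN : 0 ≤ N := by
    have := (abs_nonneg _).trans (hgN 0)
    exact nonneg_of_mul_nonneg_left this (Real.rpow_pos_of_pos (bracket_pos _) _)
  have hcf := hk1.continuous_fderiv one_ne_zero
  refine continuous_iff_continuousAt.2 fun u => continuousAt_of_dominated
    (bound := fun w => N * C * (3 * (bracket u + 2)) ^ n * bracket w ^ (-(m - n)))
    (Eventually.of_forall fun u' => Continuous.aestronglyMeasurable (by fun_prop)) ?_
    ((integrable_bracket_rpow (by linarith)).const_mul _)
    (Eventually.of_forall fun w => Continuous.continuousAt (by fun_prop))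
  filter_upwards [Metric.ball_mem_nhds u one_pos] with u' hu'
  refine Eventually.of_forall fun w => ?_
  have h1 := bracket_pow_mul_le (m := m) n (bracket_le_of_mem_ball hu') w
  rw [norm_smul]
  calc ‖g w‖ * ‖fderiv ℝ k (u' - w)‖ ≤ (N * bracket w ^ (-m)) * (C * bracket (u' - w) ^ n) :=
        mul_le_mul (hgN w) (hkC _).2 (norm_nonneg _) ((abs_nonneg _).trans (hgN w))
    _ = N * C * (bracket w ^ (-m) * bracket (u' - w) ^ n) := by ring
    _ ≤ N * C * ((3 * (bracket u + 2)) ^ n * bracket w ^ (-(m - n))) := by gcongr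
    _ = _ := by ring

/-! ### Smooth radial cutoffs and Abel means over balls -/

/-- A smooth radial cutoff, equal to `1` for `|w| ≤ R` and to `0` for `|w| ≥ √2 R`. -/
noncomputable def cutoff (R : ℝ) (w : Euc d) : ℝ := Real.smoothTransition (2 - ‖R⁻¹ • w‖ ^ 2)

lemma cutoff_nonneg (R : ℝ) (w : Euc d) : 0 ≤ cutoff R w := Real.smoothTransition.nonneg _

lemma cutoff_le_one (R : ℝ) (w : Euc d) : cutoff R w ≤ 1 := Real.smoothTransition.le_one _

lemma contDiff_cutoff (R : ℝ) {n : ℕ∞} : ContDiff ℝ n (cutoff R : Euc d → ℝ) := by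
  have h : ContDiff ℝ n fun w : Euc d => 2 - ‖R⁻¹ • w‖ ^ 2 :=
    contDiff_const.sub ((contDiff_norm_sq ℝ).comp (contDiff_const_smul _))
  exact Real.smoothTransition.contDiff.comp h

@[fun_prop]
lemma continuous_cutoff (R : ℝ) : Continuous (cutoff R : Euc d → ℝ) :=
  (contDiff_cutoff R (n := 0)).continuous

lemma cutoff_eq_zero {R : ℝ} (hR : 0 < R) {w : Euc d} (hw : w ∉ Metric.ball 0 (2 * R)) :
    cutoff R w = 0 := by
  refine Real.smoothTransition.zero_of_nonpos ?_
  have h1 : 2 * R ≤ ‖w‖ := by simpa using hw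
  have h2 : 2 ≤ ‖R⁻¹ • w‖ := by
    rw [norm_smul, norm_inv, Real.norm_of_nonneg hR.le, ← div_eq_inv_mul, le_div_iff₀ hR]
    exact h1
  nlinarith

lemma hasCompactSupport_cutoff {R : ℝ} (hR : 0 < R) :
    HasCompactSupport (cutoff R : Euc d → ℝ) :=
  HasCompactSupport.intro (isCompact_closedBall 0 (2 * R)) fun _ hw =>
    cutoff_eq_zero hR fun h => hw (Metric.ball_subset_closedBall h)

lemma tendsto_cutoff (w : Euc d) :
    Tendsto (fun n : ℕ => cutoff ((n : ℝ) + 1) w) atTop (𝓝 1) := by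
  refine tendsto_const_nhds.congr' ?_
  filter_upwards [tendsto_natCast_atTop_atTop.eventually_ge_atTop ‖w‖] with n hn
  symm
  refine Real.smoothTransition.one_of_one_le ?_
  have h1 : ‖((n : ℝ) + 1)⁻¹ • w‖ ≤ 1 := by
    rw [norm_smul, norm_inv, Real.norm_of_nonneg (by positivity), inv_mul_le_iff₀ (by positivity)]
    linarith
  nlinarith [norm_nonneg (((n : ℝ) + 1)⁻¹ • w)]

lemma exists_norm_fderiv_cutoff_le : ∃ B : ℝ, 0 ≤ B ∧ ∀ R : ℝ, 0 < R → ∀ w : Euc d,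
    ‖fderiv ℝ (cutoff R) w‖ ≤ B / R := by
  have hc : Continuous (fderiv ℝ (cutoff 1 : Euc d → ℝ)) :=
    (contDiff_cutoff 1 (n := 1)).continuous_fderiv one_ne_zero
  obtain ⟨B, hB⟩ := hc.bounded_above_of_compact_support
    ((hasCompactSupport_cutoff one_pos).fderiv ℝ)
  refine ⟨B, (norm_nonneg _).trans (hB 0), fun R hR w => ?_⟩
  have h1 : (cutoff R : Euc d → ℝ) = fun w => cutoff 1 (R⁻¹ • w) := by
    ext w; simp [cutoff]
  rw [h1, fderiv_comp_smul, norm_smul, norm_inv, Real.norm_of_nonneg hR.le, div_eq_inv_mul]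
  gcongr
  exact hB _

lemma continuous_deriv_smoothTransition : Continuous (deriv Real.smoothTransition) :=
  (Real.smoothTransition.contDiff (n := 1)).continuous_deriv le_rfl

/-- A layer-cake formula: it writes the smooth cutoff as a superposition of indicators of balls. -/
lemma integral_deriv_smoothTransition_indicator {x : ℝ} (hx : 0 ≤ x) :
    ∫ s in Ioc (0 : ℝ) 2, (Ioi x).indicator (fun s => deriv Real.smoothTransition (2 - s)) s =
      Real.smoothTransition (2 - x) := by
  have hc : Continuous fun s : ℝ => deriv Real.smoothTransition (2 - s) :=
    continuous_deriv_smoothTransition.comp (by fun_prop)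
  rw [setIntegral_indicator measurableSet_Ioi]
  have h1 : Ioc (0 : ℝ) 2 ∩ Ioi x = Ioc x 2 := by
    ext s; simp only [mem_inter_iff, mem_Ioc, mem_Ioi]
    constructor
    · rintro ⟨⟨-, h⟩, h'⟩; exact ⟨h', h⟩
    · rintro ⟨h, h'⟩; exact ⟨⟨by linarith, h'⟩, h⟩
  rw [h1]
  rcases le_or_gt x 2 with h | h
  · rw [← intervalIntegral.integral_of_le h]
    have h2 : ∀ s ∈ uIcc x 2, HasDerivAt (fun s => -Real.smoothTransition (2 - s))
        (deriv Real.smoothTransition (2 - s)) s := by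
      intro s _
      have h3 : HasDerivAt (fun s : ℝ => 2 - s) (-1) s := by
        simpa using (hasDerivAt_id s).const_sub 2
      have h4 : DifferentiableAt ℝ Real.smoothTransition (2 - s) :=
        (Real.smoothTransition.contDiff (n := 1)).differentiable one_ne_zero _
      exact ((h4.hasDerivAt.comp s h3).neg).congr_deriv (by simp)
    rw [intervalIntegral.integral_eq_sub_of_hasDerivAt h2 (hc.intervalIntegrable _ _)]
    simp
  · rw [Ioc_eq_empty (by linarith)]
    simp [Real.smoothTransition.zero_of_nonpos (show 2 - x ≤ 0 by linarith)]

/-- By the layer-cake formula and Fubini, the smoothly cut off integral is a weighted average of the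
integrals over the balls of radius R√s. -/
lemma integral_cutoff_smul {R : ℝ} (hR : 0 < R) {I : Euc d → Euc d}
    (hI : IntegrableOn I (Metric.ball 0 (2 * R))) :
    AEStronglyMeasurable (fun s : ℝ => ∫ w in Metric.ball (0 : Euc d) (R * √s), I w)
      (volume.restrict (Ioc 0 2)) ∧
    ∫ w, cutoff R w • I w = ∫ s in Ioc (0 : ℝ) 2,
      deriv Real.smoothTransition (2 - s) • ∫ w in Metric.ball (0 : Euc d) (R * √s), I w := by
  set J := (Metric.ball (0 : Euc d) (2 * R)).indicator I with hJ
  have hJi : Integrable J := by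
    rwa [hJ, integrable_indicator_iff Metric.isOpen_ball.measurableSet]
  have hdc : Continuous fun s : ℝ => deriv Real.smoothTransition (2 - s) :=
    continuous_deriv_smoothTransition.comp (by fun_prop)
  obtain ⟨M, hM⟩ := (isCompact_Icc (a := (0 : ℝ)) (b := 2)).exists_bound_of_continuousOn
    hdc.continuousOn
  have hmem : ∀ (s : ℝ) (w : Euc d), s ∈ Ioc (0 : ℝ) 2 →
      (w ∈ Metric.ball (0 : Euc d) (R * √s) ↔ ‖R⁻¹ • w‖ ^ 2 < s) := by
    intro s w hs
    rw [mem_ball_zero_iff, norm_smul, norm_inv, Real.norm_of_nonneg hR.le,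
      ← Real.lt_sqrt (by positivity), inv_mul_lt_iff₀ hR]
  have hsub : ∀ s ∈ Ioc (0 : ℝ) 2,
      Metric.ball (0 : Euc d) (R * √s) ⊆ Metric.ball 0 (2 * R) := by
    intro s hs
    refine Metric.ball_subset_ball ?_
    have : √s ≤ 2 := by
      rw [Real.sqrt_le_left (by norm_num)]; nlinarith [hs.2]
    nlinarith
  set S : Set (Euc d × ℝ) := {p | ‖R⁻¹ • p.1‖ ^ 2 < p.2} with hS
  have hSm : MeasurableSet S := measurableSet_lt
    (f := fun p : Euc d × ℝ => ‖R⁻¹ • p.1‖ ^ 2) (g := fun p => p.2) (by fun_prop) (by fun_prop)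
  have hprod : ∀ c : ℝ → ℝ, Continuous c → (∀ s ∈ Ioc (0 : ℝ) 2, |c s| ≤ M + 1) →
      Integrable (fun p : Euc d × ℝ => S.indicator (fun p => c p.2) p • J p.1)
        (volume.prod (volume.restrict (Ioc 0 2))) := by
    intro c hc hcM
    have h1 : Integrable (fun p : Euc d × ℝ => ‖J p.1‖ * (M + 1))
        (volume.prod (volume.restrict (Ioc 0 2))) :=
      hJi.norm.mul_prod (integrable_const _)
    refine Integrable.mono' h1 ?_ ?_
    · have h3 : AEStronglyMeasurable (fun p : Euc d × ℝ => J p.1)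
          (volume.prod (volume.restrict (Ioc 0 2))) := hJi.aestronglyMeasurable.comp_fst
      have h2 : Measurable fun p : Euc d × ℝ => c p.2 := hc.measurable.comp measurable_snd
      exact (h2.indicator hSm).aestronglyMeasurable.smul h3
    · have h2 : ∀ᵐ p : Euc d × ℝ ∂(volume.prod (volume.restrict (Ioc 0 2))), p.2 ∈ Ioc (0 : ℝ) 2 :=
        Measure.quasiMeasurePreserving_snd.ae (ae_restrict_mem measurableSet_Ioc)
      filter_upwards [h2] with p hp
      rw [norm_smul, mul_comm]
      refine mul_le_mul_of_nonneg_left ?_ (norm_nonneg _)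
      have h3 := hcM p.2 hp
      by_cases h : p ∈ S
      · rwa [indicator_of_mem h]
      · rw [indicator_of_notMem h, norm_zero]; exact (abs_nonneg _).trans h3
  have hinner : ∀ (c : ℝ → ℝ), ∀ s ∈ Ioc (0 : ℝ) 2,
      ∫ w, S.indicator (fun p => c p.2) (w, s) • J w =
        c s • ∫ w in Metric.ball (0 : Euc d) (R * √s), I w := by
    intro c s hs
    rw [← integral_smul, ← integral_indicator Metric.isOpen_ball.measurableSet]
    refine integral_congr_ae (Eventually.of_forall fun w => ?_)
    by_cases h : w ∈ Metric.ball (0 : Euc d) (R * √s)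
    · have h1 : (w, s) ∈ S := (hmem s w hs).1 h
      simp only [indicator_of_mem h, indicator_of_mem h1, hJ, indicator_of_mem (hsub s hs h)]
    · have h1 : (w, s) ∉ S := fun h' => h ((hmem s w hs).2 h')
      simp only [indicator_of_notMem h, indicator_of_notMem h1, zero_smul]
  have hM0 : ∀ s ∈ Ioc (0 : ℝ) 2, |deriv Real.smoothTransition (2 - s)| ≤ M + 1 := fun s hs => by
    have := hM s ⟨hs.1.le, hs.2⟩
    rw [Real.norm_eq_abs] at this
    linarith
  have hMnn : 0 ≤ M := (norm_nonneg _).trans (hM 0 ⟨le_rfl, by norm_num⟩)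
  constructor
  · have h1 := (hprod (fun _ => 1) continuous_const fun s _ => by
      rw [abs_one]; linarith).integral_prod_right.aestronglyMeasurable
    refine h1.congr ?_
    filter_upwards [ae_restrict_mem measurableSet_Ioc] with s hs
    rw [hinner (fun _ => 1) s hs, one_smul]
  · have h1 := hprod _ hdc hM0
    have h2 : ∀ w, cutoff R w • I w = ∫ s in Ioc (0 : ℝ) 2,
        S.indicator (fun p => deriv Real.smoothTransition (2 - p.2)) (w, s) • J w := by
      intro w
      rw [integral_smul_const]
      have h3 : ∫ s in Ioc (0 : ℝ) 2,
          S.indicator (fun p : Euc d × ℝ => deriv Real.smoothTransition (2 - p.2)) (w, s) =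
          cutoff R w := by
        rw [cutoff, ← integral_deriv_smoothTransition_indicator (sq_nonneg _)]
        rfl
      rw [h3]
      by_cases hw : w ∈ Metric.ball (0 : Euc d) (2 * R)
      · rw [hJ, indicator_of_mem hw]
      · rw [cutoff_eq_zero hR hw, zero_smul, zero_smul]
    simp_rw [h2]
    rw [integral_integral_swap (f := fun (w : Euc d) (s : ℝ) =>
      S.indicator (fun p : Euc d × ℝ => deriv Real.smoothTransition (2 - p.2)) (w, s) • J w) h1]
    refine setIntegral_congr_fun measurableSet_Ioc fun s hs =>
      hinner (fun s => deriv Real.smoothTransition (2 - s)) s hs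

/-- If the integrals of `I` over large balls converge, so do its smoothly cut off integrals. -/
lemma tendsto_integral_cutoff_smul {I : Euc d → Euc d} {L : Euc d}
    (hI : ∀ R, IntegrableOn I (Metric.ball 0 R))
    (hL : Tendsto (fun R : ℝ => ∫ w in Metric.ball (0 : Euc d) R, I w) atTop (𝓝 L)) :
    Tendsto (fun n : ℕ => ∫ w, cutoff ((n : ℝ) + 1) w • I w) atTop (𝓝 L) := by
  have hdc : Continuous fun s : ℝ => deriv Real.smoothTransition (2 - s) :=
    continuous_deriv_smoothTransition.comp (by fun_prop)
  obtain ⟨M, hM⟩ := (isCompact_Icc (a := (0 : ℝ)) (b := 2)).exists_bound_of_continuousOn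
    hdc.continuousOn
  -- A bound for all radii, needed as a dominating constant: large radii by convergence, the others
  -- by the integral of ‖I‖ over one fixed ball.
  obtain ⟨B, hB⟩ : ∃ B : ℝ, ∀ R, ‖∫ w in Metric.ball (0 : Euc d) R, I w‖ ≤ B := by
    have h1 : ∀ᶠ R in atTop, ‖∫ w in Metric.ball (0 : Euc d) R, I w‖ ≤ ‖L‖ + 1 :=
      (hL.norm.eventually (gt_mem_nhds (lt_add_one _))).mono fun _ h => h.le
    obtain ⟨R₀, hR₀⟩ := eventually_atTop.1 h1
    refine ⟨max (‖L‖ + 1) (∫ w in Metric.ball (0 : Euc d) R₀, ‖I w‖), fun R => ?_⟩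
    rcases le_total R₀ R with h | h
    · exact (hR₀ R h).trans (le_max_left _ _)
    · refine le_trans ((norm_integral_le_integral_norm _).trans ?_) (le_max_right _ _)
      exact setIntegral_mono_set (hI R₀).norm (Eventually.of_forall fun _ => norm_nonneg _)
        (Metric.ball_subset_ball h).eventuallyLE
  have hn : ∀ n : ℕ, (0 : ℝ) < (n : ℝ) + 1 := fun n => by positivity
  simp_rw [fun n : ℕ => (integral_cutoff_smul (hn n) (hI _)).2]
  have hlim : ∫ s in Ioc (0 : ℝ) 2, deriv Real.smoothTransition (2 - s) • L = L := by
    rw [integral_smul_const]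
    have h1 := integral_deriv_smoothTransition_indicator le_rfl
    rw [setIntegral_congr_fun measurableSet_Ioc
      (g := fun s => deriv Real.smoothTransition (2 - s))
      (fun s hs => indicator_of_mem (mem_Ioi.2 hs.1) _)] at h1
    rw [h1, Real.smoothTransition.one_of_one_le (by norm_num), one_smul]
  rw [← hlim]
  have hMnn : 0 ≤ M := (norm_nonneg _).trans (hM 0 ⟨le_rfl, by norm_num⟩)
  refine tendsto_integral_of_dominated_convergence (fun _ => M * B) (fun n => ?_)
    (integrable_const _) (fun n => ?_) ?_
  · exact hdc.aestronglyMeasurable.smul (integral_cutoff_smul (hn n) (hI _)).1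
  · filter_upwards [ae_restrict_mem measurableSet_Ioc] with s hs
    rw [norm_smul]
    exact mul_le_mul (hM s ⟨hs.1.le, hs.2⟩) (hB _) (norm_nonneg _) hMnn
  · filter_upwards [ae_restrict_mem measurableSet_Ioc] with s hs
    refine Tendsto.const_smul (hL.comp ?_) _
    exact (tendsto_atTop_add_const_right _ _ tendsto_natCast_atTop_atTop).atTop_mul_const
      (Real.sqrt_pos.2 hs.1)

/-! ### The Landau flux as an absolutely convergent integral -/

/-- The regularized Landau flux, after moving the derivatives of `g` under the integral onto the
kernel. -/
noncomputable def landauFlux (γ ε : ℝ) (g : Euc d → ℝ) (u : Euc d) : Euc d :=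
  WithLp.toLp 2 fun i => ∑ j : Fin d,
    kernelConv g (landauA γ ε i j) u * fderiv ℝ g u (EuclideanSpace.single j 1) -
    g u * kernelConv g (landauB γ ε i) u

lemma gradient_apply_eq (g : Euc d → ℝ) (u : Euc d) (i : Fin d) :
    gradient g u i = fderiv ℝ g u (EuclideanSpace.single i 1) := by
  have h := InnerProductSpace.toDual_symm_apply (𝕜 := ℝ) (x := EuclideanSpace.single i (1 : ℝ))
    (y := fderiv ℝ g u)
  rw [← h, gradient, EuclideanSpace.inner_single_right]
  simp

lemma landauIntegrand_apply (γ : ℝ) (g f : Euc d → ℝ) {u w : Euc d} (h : u - w ≠ 0) (i : Fin d) :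
    landauIntegrand γ g f u w i = ∑ j : Fin d, landauA γ 0 i j (u - w) *
      (g w * fderiv ℝ f u (EuclideanSpace.single j 1) -
        f u * fderiv ℝ g w (EuclideanSpace.single j 1)) := by
  set z := u - w with hz
  set y : Euc d := g w • gradient f u - f u • gradient g w with hy
  have hz0 : 0 < ‖z‖ := norm_pos_iff.2 h
  have hyj : ∀ j, g w * fderiv ℝ f u (EuclideanSpace.single j 1) -
      f u * fderiv ℝ g w (EuclideanSpace.single j 1) = y j := fun j => by
    simp [hy, gradient_apply_eq]
  simp_rw [hyj]
  have hr : regPow (γ / 2) 0 z = ‖z‖ ^ γ := by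
    unfold regPow
    rw [zero_pow two_ne_zero, add_zero, ← Real.rpow_natCast, ← Real.rpow_mul hz0.le]
    congr 1; push_cast; ring
  have hin : inner ℝ z y = ∑ j, z j * y j := by
    rw [PiLp.inner_apply]
    refine Finset.sum_congr rfl fun j _ => ?_
    simp [mul_comm]
  have h1 : ∀ j, landauA γ 0 i j z * y j =
      ‖z‖ ^ γ * (‖z‖ ^ 2 * (if i = j then y j else 0)) - ‖z‖ ^ γ * (z i * (z j * y j)) := fun j => by
    unfold landauA
    rw [hr]
    split_ifs <;> ring
  simp_rw [h1]
  rw [Finset.sum_sub_distrib, ← Finset.mul_sum, ← Finset.mul_sum, ← Finset.mul_sum,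
    ← Finset.mul_sum, ← hin]
  simp only [Finset.sum_ite_eq, Finset.mem_univ, if_true]
  have h2 : ‖z‖ ^ (2 + γ) = ‖z‖ ^ 2 * ‖z‖ ^ γ := by
    rw [Real.rpow_add hz0]; norm_cast
  simp only [landauIntegrand, perpProj, ← hz, ← hy, PiLp.smul_apply, PiLp.sub_apply, smul_eq_mul,
    h2]
  field_simp

lemma exists_abs_le_bracket_rpow {h : Euc d → ℝ} (hh : Continuous h) (m R : ℝ) :
    ∃ C : ℝ, 0 ≤ C ∧ ∀ w ∈ Metric.closedBall (0 : Euc d) R, |h w| ≤ C * bracket w ^ (-m) := by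
  have hc : Continuous fun w => h w * bracket w ^ m := hh.mul (continuous_bracket_rpow m)
  obtain ⟨C, hC⟩ := (isCompact_closedBall (0 : Euc d) R).exists_bound_of_continuousOn
    hc.continuousOn
  refine ⟨max C 0, le_max_right _ _, fun w hw => ?_⟩
  have hb := bracket_pos w
  have h1 := (hC w hw).trans (le_max_left C 0)
  rw [norm_mul, Real.norm_eq_abs, Real.norm_of_nonneg (by positivity)] at h1
  rw [Real.rpow_neg hb.le, ← div_eq_mul_inv, le_div_iff₀ (by positivity)]
  exact h1

lemma kernelConv_sub {f h k : Euc d → ℝ} {u : Euc d} (hf : Integrable fun w => f w * k (u - w))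
    (hh : Integrable fun w => h w * k (u - w)) (a b : ℝ) :
    kernelConv (fun w => a * f w - b * h w) k u = a * kernelConv f k u - b * kernelConv h k u := by
  unfold kernelConv
  rw [← integral_const_mul, ← integral_const_mul,
    ← integral_sub (hf.const_mul a) (hh.const_mul b)]
  refine integral_congr_ae (Eventually.of_forall fun w => ?_)
  ring

/-- Integration by parts against the regularized kernel. -/
lemma sum_kernelConv_cutoff_fderiv_of_pos {γ ε : ℝ} (hγ : γ ≤ 1) (hε : 0 < ε) (hε1 : ε ≤ 1)
    {g : Euc d → ℝ} (hg : ContDiff ℝ 1 g) {R : ℝ} (hR : 0 < R) (i : Fin d) (u : Euc d) :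
    ∑ j : Fin d, kernelConv (fun w => cutoff R w * fderiv ℝ g w (EuclideanSpace.single j 1))
        (landauA γ ε i j) u =
      kernelConv (fun w => cutoff R w * g w) (landauB γ ε i) u -
      ∑ j : Fin d, kernelConv (fun w => g w * fderiv ℝ (cutoff R) w (EuclideanSpace.single j 1))
        (landauA γ ε i j) u := by
  have hgc := hg.continuous
  have hgf := hg.continuous_fderiv one_ne_zero
  have hχ : ContDiff ℝ 1 (cutoff R : Euc d → ℝ) := contDiff_cutoff R (n := 1)
  have hχc := hχ.continuous
  have hχf := hχ.continuous_fderiv one_ne_zero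
  have hχs : HasCompactSupport (cutoff R : Euc d → ℝ) := hasCompactSupport_cutoff hR
  have hA : ∀ j, ContDiff ℝ 1 (landauA γ ε i j) := fun j =>
    (hasC1Growth_landauA hγ hε hε1 i j).1
  have hAc : ∀ j, Continuous (landauA γ ε i j) := fun j => (hA j).continuous
  have hAf : ∀ j, Continuous (fderiv ℝ (landauA γ ε i j)) := fun j =>
    (hA j).continuous_fderiv one_ne_zero
  have hD : ∀ (j : Fin d) w, HasFDerivAt (fun w => cutoff R w * landauA γ ε i j (u - w))
      (cutoff R w • -fderiv ℝ (landauA γ ε i j) (u - w) +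
        landauA γ ε i j (u - w) • fderiv ℝ (cutoff R) w) w := by
    intro j w
    have h1 : HasFDerivAt (fun w : Euc d => u - w) (-ContinuousLinearMap.id ℝ (Euc d)) w :=
      (hasFDerivAt_id w).const_sub u
    have h2 := ((hA j).differentiable one_ne_zero (u - w)).hasFDerivAt.comp w h1
    refine ((hχ.differentiable one_ne_zero w).hasFDerivAt.mul h2).congr_fderiv ?_
    ext e; simp
  have hint : ∀ h : Euc d → ℝ, Continuous h → Integrable fun w => cutoff R w * h w := fun h hh =>
    Continuous.integrable_of_hasCompactSupport (by fun_prop) hχs.mul_right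
  have hint' : ∀ (e : Euc d) (h : Euc d → ℝ), Continuous h →
      Integrable fun w => fderiv ℝ (cutoff R) w e * h w := fun e h hh => by
    refine Continuous.integrable_of_hasCompactSupport (by fun_prop) (HasCompactSupport.mul_right ?_)
    exact (hχs.fderiv ℝ).comp_left (g := fun L : Euc d →L[ℝ] ℝ => L e) (by simp)
  have key : ∀ j : Fin d,
      kernelConv (fun w => cutoff R w * fderiv ℝ g w (EuclideanSpace.single j 1))
        (landauA γ ε i j) u =
      (∫ w, cutoff R w * (g w * fderiv ℝ (landauA γ ε i j) (u - w) (EuclideanSpace.single j 1))) -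
      kernelConv (fun w => g w * fderiv ℝ (cutoff R) w (EuclideanSpace.single j 1))
        (landauA γ ε i j) u := by
    intro j
    set e : Euc d := EuclideanSpace.single j 1
    have i1 : Integrable fun w =>
        cutoff R w * (g w * fderiv ℝ (landauA γ ε i j) (u - w) e) := hint _ (by
      have := hAf j
      fun_prop)
    have i2 : Integrable fun w =>
        fderiv ℝ (cutoff R) w e * (g w * landauA γ ε i j (u - w)) := hint' e _ (by
      have := hAc j
      fun_prop)
    have ibp := integral_mul_fderiv_eq_neg_fderiv_mul_of_integrable
      (μ := (volume : Measure (Euc d))) (f := fun w => cutoff R w * landauA γ ε i j (u - w))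
      (g := g) (v := e) ?_ ?_ ?_ (fun w _ => (hD j w).differentiableAt)
      (fun w _ => hg.differentiable one_ne_zero w)
    · unfold kernelConv
      calc _ = ∫ w, cutoff R w * landauA γ ε i j (u - w) * fderiv ℝ g w e := by
            refine integral_congr_ae (Eventually.of_forall fun w => ?_)
            simp only; ring
        _ = _ := ibp
        _ = ∫ w, (cutoff R w * (g w * fderiv ℝ (landauA γ ε i j) (u - w) e) -
              fderiv ℝ (cutoff R) w e * (g w * landauA γ ε i j (u - w))) := by
            rw [← integral_neg]
            refine integral_congr_ae (Eventually.of_forall fun w => ?_)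
            simp only [(hD j w).fderiv]
            simp
            ring
        _ = _ := by
            rw [integral_sub i1 i2]
            congr 1
            refine integral_congr_ae (Eventually.of_forall fun w => ?_)
            simp only; ring
    · refine (i2.sub i1).congr (Eventually.of_forall fun w => ?_)
      simp only [(hD j w).fderiv]
      simp
      ring
    · have := hAc j
      refine (hint (fun w => landauA γ ε i j (u - w) * fderiv ℝ g w e) (by fun_prop)).congr
        (Eventually.of_forall fun w => ?_)
      simp only; ring
    · have := hAc j
      refine (hint (fun w => landauA γ ε i j (u - w) * g w) (by fun_prop)).congr
        (Eventually.of_forall fun w => ?_)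
      simp only; ring
  simp_rw [key]
  rw [Finset.sum_sub_distrib, ← integral_finsetSum _ fun j _ => hint _ (by
    have := hAf j
    fun_prop)]
  congr 1
  refine integral_congr_ae (Eventually.of_forall fun w => ?_)
  simp only
  -- The derivatives that fell on row i of the regularized matrix add up to its divergence.
  rw [← sum_fderiv_landauA γ hε i (u - w), Finset.mul_sum]
  refine Finset.sum_congr rfl fun j _ => ?_
  ring

lemma tendsto_one_div_succ : Tendsto (fun n : ℕ => 1 / ((n : ℝ) + 1)) atTop (𝓝 0) :=
  tendsto_one_div_add_atTop_nhds_zero_nat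

lemma one_div_succ_pos (n : ℕ) : 0 < 1 / ((n : ℝ) + 1) := by positivity

lemma one_div_succ_le_one (n : ℕ) : 1 / ((n : ℝ) + 1) ≤ 1 := by
  rw [div_le_one (by positivity)]
  have : (0 : ℝ) ≤ n := Nat.cast_nonneg n
  linarith

lemma abs_one_div_succ_le_one (n : ℕ) : |1 / ((n : ℝ) + 1)| ≤ 1 := by
  rw [abs_of_pos (one_div_succ_pos n)]
  exact one_div_succ_le_one n

lemma exists_abs_cutoff_mul_le {h : Euc d → ℝ} (hh : Continuous h) (m : ℝ) {R : ℝ} (hR : 0 < R) :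
    ∃ C : ℝ, ∀ w, |cutoff R w * h w| ≤ C * bracket w ^ (-m) := by
  obtain ⟨C, hC, hb⟩ := exists_abs_le_bracket_rpow (d := d) (h := fun w => cutoff R w * h w)
    (by fun_prop) m (2 * R)
  refine ⟨C, fun w => ?_⟩
  by_cases hw : w ∈ Metric.closedBall (0 : Euc d) (2 * R)
  · exact hb w hw
  · rw [cutoff_eq_zero hR fun h => hw (Metric.ball_subset_closedBall h), zero_mul, abs_zero]
    have := bracket_pos w
    positivity

lemma exists_abs_mul_fderiv_cutoff_le {h : Euc d → ℝ} (hh : Continuous h) (m : ℝ) {R : ℝ}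
    (hR : 0 < R) (e : Euc d) :
    ∃ C : ℝ, ∀ w, |h w * fderiv ℝ (cutoff R) w e| ≤ C * bracket w ^ (-m) := by
  have hχf : Continuous (fderiv ℝ (cutoff R : Euc d → ℝ)) :=
    (contDiff_cutoff R (n := 1)).continuous_fderiv one_ne_zero
  have hcs : HasCompactSupport fun w => h w * fderiv ℝ (cutoff R) w e := HasCompactSupport.mul_left
    (((hasCompactSupport_cutoff hR).fderiv ℝ).comp_left (g := fun L : Euc d →L[ℝ] ℝ => L e)
      (by simp))
  obtain ⟨ρ, hρ⟩ := hcs.isCompact.isBounded.subset_closedBall 0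
  obtain ⟨C, hC, hb⟩ := exists_abs_le_bracket_rpow (d := d)
    (h := fun w => h w * fderiv ℝ (cutoff R) w e) (by fun_prop) m ρ
  refine ⟨C, fun w => ?_⟩
  by_cases hw : w ∈ Metric.closedBall (0 : Euc d) ρ
  · exact hb w hw
  · have h1 : h w * fderiv ℝ (cutoff R) w e = 0 :=
      image_eq_zero_of_notMem_tsupport (f := fun w => h w * fderiv ℝ (cutoff R) w e)
        fun h => hw (hρ h)
    rw [h1, abs_zero]
    have := bracket_pos w
    positivity

/-- The limit ε → 0 of the regularized identity. All densities have compact support and the kernels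
are dominated by the envelope. -/
lemma sum_kernelConv_cutoff_fderiv (hd : 1 ≤ d) {γ : ℝ} (hγd : -(d : ℝ) ≤ γ) (hγ : γ ≤ 1)
    {g : Euc d → ℝ} (hg : ContDiff ℝ 1 g) {R : ℝ} (hR : 0 < R) (i : Fin d) (u : Euc d) :
    ∑ j : Fin d, kernelConv (fun w => cutoff R w * fderiv ℝ g w (EuclideanSpace.single j 1))
        (landauA γ 0 i j) u =
      kernelConv (fun w => cutoff R w * g w) (landauB γ 0 i) u -
      ∑ j : Fin d, kernelConv (fun w => g w * fderiv ℝ (cutoff R) w (EuclideanSpace.single j 1))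
        (landauA γ 0 i j) u := by
  have hgc := hg.continuous
  have hgf := hg.continuous_fderiv one_ne_zero
  have hχf : Continuous (fderiv ℝ (cutoff R : Euc d → ℝ)) :=
    (contDiff_cutoff R (n := 1)).continuous_fderiv one_ne_zero
  -- Any exponent above 2d + 2 would do, as the densities are compactly supported.
  set m : ℝ := 2 * d + 3 with hm
  have hm' : 2 * (d : ℝ) + 2 < m := by linarith
  have hlim : ∀ (f : Euc d → ℝ), Measurable f → (∃ C : ℝ, ∀ w, |f w| ≤ C * bracket w ^ (-m)) →
      ∀ (k : ℝ → Euc d → ℝ) (D : ℝ), (∀ ε, Measurable (k ε)) →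
      (∀ ε, |ε| ≤ 1 → ∀ z, |k ε z| ≤ D * landauEnvelope z) →
      (∀ z ≠ 0, Tendsto (fun n : ℕ => k (1 / ((n : ℝ) + 1)) z) atTop (𝓝 (k 0 z))) →
      Tendsto (fun n : ℕ => kernelConv f (k (1 / ((n : ℝ) + 1))) u) atTop
        (𝓝 (kernelConv f (k 0) u)) := by
    rintro f hf ⟨C, hC⟩ k D hk hkD hkl
    exact tendsto_kernelConv hd hm' (fun _ => hf) (fun n => hk _) (fun _ => hC)
      (fun n => hkD _ (abs_one_div_succ_le_one n)) (fun _ => tendsto_const_nhds) hkl u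
  have hA : ∀ (f : Euc d → ℝ), Measurable f → (∃ C : ℝ, ∀ w, |f w| ≤ C * bracket w ^ (-m)) →
      ∀ j, Tendsto (fun n : ℕ => kernelConv f (landauA γ (1 / ((n : ℝ) + 1)) i j) u) atTop
        (𝓝 (kernelConv f (landauA γ 0 i j) u)) := fun f hf hC j =>
    hlim f hf hC (fun ε => landauA γ ε i j) 6 (fun ε => by fun_prop)
      (fun ε hε => abs_landauA_le hγd hγ hε i j)
      (fun z hz => tendsto_landauA γ i j hz tendsto_one_div_succ)
  have hB : ∀ (f : Euc d → ℝ), Measurable f → (∃ C : ℝ, ∀ w, |f w| ≤ C * bracket w ^ (-m)) →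
      Tendsto (fun n : ℕ => kernelConv f (landauB γ (1 / ((n : ℝ) + 1)) i) u) atTop
        (𝓝 (kernelConv f (landauB γ 0 i) u)) := fun f hf hC =>
    hlim f hf hC (fun ε => landauB γ ε i) (2 * d) (fun ε => by fun_prop)
      (fun ε hε => abs_landauB_le hd hγd hγ hε i)
      (fun z hz => tendsto_landauB γ i hz tendsto_one_div_succ)
  have l1 := tendsto_finsetSum Finset.univ fun j _ =>
    hA (fun w => cutoff R w * fderiv ℝ g w (EuclideanSpace.single j 1))
      (Continuous.measurable (by fun_prop)) (exists_abs_cutoff_mul_le (by fun_prop) m hR) j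
  have l2 := (hB (fun w => cutoff R w * g w) (Continuous.measurable (by fun_prop))
    (exists_abs_cutoff_mul_le (by fun_prop) m hR)).sub
    (tendsto_finsetSum Finset.univ fun j _ =>
      hA (fun w => g w * fderiv ℝ (cutoff R) w (EuclideanSpace.single j 1))
      (Continuous.measurable (by fun_prop)) (exists_abs_mul_fderiv_cutoff_le hgc m hR _) j)
  refine tendsto_nhds_unique l1 (l2.congr fun n => ?_)
  exact (sum_kernelConv_cutoff_fderiv_of_pos hγ (one_div_succ_pos n) (one_div_succ_le_one n)
    hg hR i u).symm

lemma integrable_cutoff_mul_landauA (hd : 1 ≤ d) {γ : ℝ} (hγd : -(d : ℝ) ≤ γ) (hγ : γ ≤ 1)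
    {h : Euc d → ℝ} (hh : Continuous h) {R : ℝ} (hR : 0 < R) (i j : Fin d) (u : Euc d) :
    Integrable fun w => cutoff R w * h w * landauA γ 0 i j (u - w) := by
  obtain ⟨C, hC⟩ := exists_abs_cutoff_mul_le hh (2 * d + 3) hR
  exact integrable_mul_kernel hd (by linarith) (Continuous.measurable (by fun_prop)) (by fun_prop)
    hC (abs_landauA_le hγd hγ (by simp) i j) u

lemma integrableOn_landauIntegrand (hd : 1 ≤ d) {γ : ℝ} (hγd : -(d : ℝ) ≤ γ) (hγ : γ ≤ 1)
    {g : Euc d → ℝ} (hg : ContDiff ℝ 1 g) (u : Euc d) (R : ℝ) :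
    IntegrableOn (landauIntegrand γ g g u) (Metric.ball 0 R) := by
  have hgc := hg.continuous
  have hgf := hg.continuous_fderiv one_ne_zero
  rw [IntegrableOn, integrable_piLp_iff]
  intro i
  obtain ⟨n, hn⟩ := exists_nat_ge R
  set ρ : ℝ := n + 1 with hρ
  have hρ0 : 0 < ρ := by positivity
  have h1 : Integrable fun w => ∑ j : Fin d, cutoff ρ w *
      (g w * fderiv ℝ g u (EuclideanSpace.single j 1) -
        g u * fderiv ℝ g w (EuclideanSpace.single j 1)) * landauA γ 0 i j (u - w) :=
    integrable_finsetSum _ fun j _ =>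
      integrable_cutoff_mul_landauA hd hγd hγ (by fun_prop) hρ0 i j u
  refine (h1.integrableOn (s := Metric.ball 0 R)).congr ?_
  filter_upwards [ae_restrict_mem Metric.isOpen_ball.measurableSet,
    ae_restrict_of_ae (ae_sub_ne hd u)] with w hw hwu
  rw [landauIntegrand_apply γ g g hwu]
  refine Finset.sum_congr rfl fun j _ => ?_
  have h2 : cutoff ρ w = 1 := by
    refine Real.smoothTransition.one_of_one_le ?_
    have h3 : ‖w‖ < R := by simpa using hw
    have h4 : ‖ρ⁻¹ • w‖ ≤ 1 := by
      rw [norm_smul, norm_inv, Real.norm_of_nonneg hρ0.le, inv_mul_le_iff₀ hρ0]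
      linarith
    nlinarith [norm_nonneg (ρ⁻¹ • w)]
  rw [h2]; ring

lemma integral_cutoff_smul_landauIntegrand (hd : 1 ≤ d) {γ : ℝ} (hγd : -(d : ℝ) ≤ γ) (hγ : γ ≤ 1)
    {g : Euc d → ℝ} (hg : ContDiff ℝ 1 g) {R : ℝ} (hR : 0 < R) (u : Euc d) (i : Fin d) :
    (∫ w, cutoff R w • landauIntegrand γ g g u w) i =
      ∑ j : Fin d, kernelConv (fun w => cutoff R w * g w) (landauA γ 0 i j) u *
        fderiv ℝ g u (EuclideanSpace.single j 1) -
      g u * (kernelConv (fun w => cutoff R w * g w) (landauB γ 0 i) u -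
        ∑ j : Fin d, kernelConv (fun w => g w * fderiv ℝ (cutoff R) w (EuclideanSpace.single j 1))
          (landauA γ 0 i j) u) := by
  have hgc := hg.continuous
  have hgf := hg.continuous_fderiv one_ne_zero
  have i1 := fun i j => integrable_cutoff_mul_landauA hd hγd hγ hgc hR i j u
  have i2 := fun i j => integrable_cutoff_mul_landauA hd hγd hγ
    (h := fun w => fderiv ℝ g w (EuclideanSpace.single j 1)) (by fun_prop) hR i j u
  have hae : ∀ i, (fun w => (cutoff R w • landauIntegrand γ g g u w) i) =ᵐ[volume] fun w =>
      ∑ j : Fin d, (fderiv ℝ g u (EuclideanSpace.single j 1) * (cutoff R w * g w) - g u *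
        (cutoff R w * fderiv ℝ g w (EuclideanSpace.single j 1))) * landauA γ 0 i j (u - w) := by
    intro i
    filter_upwards [ae_sub_ne hd u] with w hwu
    rw [PiLp.smul_apply, landauIntegrand_apply γ g g hwu, smul_eq_mul, Finset.mul_sum]
    refine Finset.sum_congr rfl fun j _ => ?_
    ring
  have hint : ∀ i j, Integrable fun w => (fderiv ℝ g u (EuclideanSpace.single j 1) *
      (cutoff R w * g w) - g u * (cutoff R w * fderiv ℝ g w (EuclideanSpace.single j 1))) *
      landauA γ 0 i j (u - w) := by
    intro i j
    refine (((i1 i j).const_mul (fderiv ℝ g u (EuclideanSpace.single j 1))).sub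
      ((i2 i j).const_mul (g u))).congr (Eventually.of_forall fun w => ?_)
    simp only [Pi.sub_apply]; ring
  rw [eval_integral_piLp fun i => (integrable_finsetSum _ fun j _ => hint i j).congr (hae i).symm,
    integral_congr_ae (hae i), integral_finsetSum _ fun j _ => hint i j,
    ← sum_kernelConv_cutoff_fderiv hd hγd hγ hg hR i u, Finset.mul_sum, ← Finset.sum_sub_distrib]
  refine Finset.sum_congr rfl fun j _ => ?_
  have := kernelConv_sub (i1 i j) (i2 i j) (fderiv ℝ g u (EuclideanSpace.single j 1)) (g u)
  rw [mul_comm _ (fderiv ℝ g u (EuclideanSpace.single j 1)), ← this]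
  rfl

/-- The limit of the integrals over balls defining the Landau flux. -/
lemma landauFlux_eq_of_tendsto (hd : 1 ≤ d) {γ : ℝ} (hγd : -(d : ℝ) ≤ γ) (hγ : γ ≤ 1)
    {g : Euc d → ℝ} (hg : ContDiff ℝ 1 g) {m N : ℝ} (hm : 2 * d + 2 < m)
    (hgN : ∀ w, |g w| ≤ N * bracket w ^ (-m)) {u F : Euc d}
    (hF : Tendsto (fun R : ℝ => ∫ w in Metric.ball (0 : Euc d) R, landauIntegrand γ g g u w)
      atTop (𝓝 F)) :
    landauFlux γ 0 g u = F := by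
  have hgc := hg.continuous
  have hχf : ∀ R, Continuous (fderiv ℝ (cutoff R : Euc d → ℝ)) := fun R =>
    (contDiff_cutoff R (n := 1)).continuous_fderiv one_ne_zero
  -- Replacing sharp balls by smooth cutoffs permits integration by parts without boundary terms
  -- involving ∇g.
  have hlim := tendsto_integral_cutoff_smul
    (integrableOn_landauIntegrand hd hγd hγ hg u) hF
  ext i
  have hlim' := ((EuclideanSpace.proj (𝕜 := ℝ) i).continuous.tendsto _).comp hlim
  refine tendsto_nhds_unique ?_ hlim'
  have hn : ∀ n : ℕ, (0 : ℝ) < (n : ℝ) + 1 := fun n => by positivity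
  have hcongr : ∀ n : ℕ, _ = (EuclideanSpace.proj (𝕜 := ℝ) i ∘ fun n : ℕ =>
      ∫ w, cutoff ((n : ℝ) + 1) w • landauIntegrand γ g g u w) n := fun n =>
    (integral_cutoff_smul_landauIntegrand hd hγd hγ hg (hn n) u i).symm
  refine Tendsto.congr hcongr ?_
  have hN : ∀ w : Euc d, 0 ≤ N * bracket w ^ (-m) := fun w => (abs_nonneg _).trans (hgN w)
  have b1 : ∀ n : ℕ, ∀ w, |cutoff ((n : ℝ) + 1) w * g w| ≤ N * bracket w ^ (-m) := fun n w => by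
    rw [abs_mul, abs_of_nonneg (cutoff_nonneg _ _)]
    exact (mul_le_of_le_one_left (abs_nonneg _) (cutoff_le_one _ _)).trans (hgN w)
  have l1 : ∀ w, Tendsto (fun n : ℕ => cutoff ((n : ℝ) + 1) w * g w) atTop (𝓝 (g w)) := fun w => by
    simpa using (tendsto_cutoff w).mul_const (g w)
  obtain ⟨B, hB0, hB⟩ := exists_norm_fderiv_cutoff_le (d := d)
  have hBe : ∀ (n : ℕ) (w : Euc d) (j : Fin d),
      |fderiv ℝ (cutoff ((n : ℝ) + 1)) w (EuclideanSpace.single j 1)| ≤ B / ((n : ℝ) + 1) := by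
    intro n w j
    refine le_trans ((fderiv ℝ (cutoff ((n : ℝ) + 1)) w).le_opNorm _) ?_
    simpa using hB _ (hn n) w
  have b2 : ∀ (j : Fin d) (n : ℕ) (w : Euc d),
      |g w * fderiv ℝ (cutoff ((n : ℝ) + 1)) w (EuclideanSpace.single j 1)| ≤
        N * B * bracket w ^ (-m) := by
    intro j n w
    rw [abs_mul]
    have h1 : B / ((n : ℝ) + 1) ≤ B := div_le_self hB0 (by
      have : (0 : ℝ) ≤ n := Nat.cast_nonneg n
      linarith)
    calc _ ≤ (N * bracket w ^ (-m)) * B :=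
          mul_le_mul (hgN w) ((hBe n w j).trans h1) (abs_nonneg _) (hN w)
      _ = _ := by ring
  -- The gradient of the cutoff is O(1/R), so the commutator term disappears in the limit thanks to
  -- the decay of g alone.
  have l2 : ∀ (j : Fin d) (w : Euc d), Tendsto (fun n : ℕ =>
      g w * fderiv ℝ (cutoff ((n : ℝ) + 1)) w (EuclideanSpace.single j 1)) atTop (𝓝 0) := by
    intro j w
    have h1 : Tendsto (fun n : ℕ => B / ((n : ℝ) + 1)) atTop (𝓝 0) := by
      have := tendsto_one_div_succ.const_mul B
      simpa [div_eq_mul_inv] using this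
    have h2 := squeeze_zero_norm (f := fun n : ℕ =>
      fderiv ℝ (cutoff ((n : ℝ) + 1)) w (EuclideanSpace.single j 1)) (fun n => hBe n w j) h1
    simpa using h2.const_mul (g w)
  have c1 : ∀ j, Tendsto (fun n : ℕ => kernelConv (fun w => cutoff ((n : ℝ) + 1) w * g w)
      (landauA γ 0 i j) u) atTop (𝓝 (kernelConv g (landauA γ 0 i j) u)) := fun j =>
    tendsto_kernelConv hd hm (fun n => Continuous.measurable (by fun_prop))
      (fun _ => by fun_prop) b1 (fun _ => abs_landauA_le hγd hγ (by simp) i j) l1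
      (fun _ _ => tendsto_const_nhds) u
  have c2 : Tendsto (fun n : ℕ => kernelConv (fun w => cutoff ((n : ℝ) + 1) w * g w)
      (landauB γ 0 i) u) atTop (𝓝 (kernelConv g (landauB γ 0 i) u)) :=
    tendsto_kernelConv hd hm (fun n => Continuous.measurable (by fun_prop))
      (fun _ => by fun_prop) b1 (fun _ => abs_landauB_le hd hγd hγ (by simp) i) l1
      (fun _ _ => tendsto_const_nhds) u
  have c3 : ∀ j, Tendsto (fun n : ℕ => kernelConv
      (fun w => g w * fderiv ℝ (cutoff ((n : ℝ) + 1)) w (EuclideanSpace.single j 1))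
      (landauA γ 0 i j) u) atTop (𝓝 (kernelConv (fun _ => 0) (landauA γ 0 i j) u)) := fun j =>
    tendsto_kernelConv hd hm (fun n => Continuous.measurable (by
        have := hχf ((n : ℝ) + 1)
        fun_prop))
      (fun _ => by fun_prop) (b2 j) (fun _ => abs_landauA_le hγd hγ (by simp) i j) (l2 j)
      (fun _ _ => tendsto_const_nhds) u
  have h0 : ∀ k : Euc d → ℝ, kernelConv (fun _ => 0) k u = 0 := fun k => by simp [kernelConv]
  simp only [h0] at c3
  have := (tendsto_finsetSum Finset.univ fun j _ =>
    (c1 j).mul_const (fderiv ℝ g u (EuclideanSpace.single j 1))).sub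
    ((c2.sub (tendsto_finsetSum Finset.univ fun j _ => c3 j)).const_mul (g u))
  simpa [landauFlux] using this

/-- Pointwise convergence of the regularized fluxes. -/
lemma tendsto_landauFlux (hd : 1 ≤ d) {γ : ℝ} (hγd : -(d : ℝ) ≤ γ) (hγ : γ ≤ 1)
    {g : Euc d → ℝ} (hg : Continuous g) {m N : ℝ} (hm : 2 * d + 2 < m)
    (hgN : ∀ w, |g w| ≤ N * bracket w ^ (-m)) (u : Euc d) :
    Tendsto (fun n : ℕ => landauFlux γ (1 / ((n : ℝ) + 1)) g u) atTop
      (𝓝 (landauFlux γ 0 g u)) := by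
  have hgm := hg.measurable
  refine ((PiLp.continuous_toLp 2 _).tendsto _).comp (tendsto_pi_nhds.2 fun i => ?_)
  refine (tendsto_finsetSum Finset.univ fun j _ => Tendsto.mul_const _ ?_).sub
    (Tendsto.const_mul _ ?_)
  · exact tendsto_kernelConv hd hm (fun _ => hgm) (fun _ => by fun_prop) (fun _ => hgN)
      (fun n => abs_landauA_le hγd hγ (abs_one_div_succ_le_one n) i j)
      (fun _ => tendsto_const_nhds)
      (fun z hz => tendsto_landauA γ i j hz tendsto_one_div_succ) u
  · exact tendsto_kernelConv hd hm (fun _ => hgm) (fun _ => by fun_prop) (fun _ => hgN)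
      (fun n => abs_landauB_le hd hγd hγ (abs_one_div_succ_le_one n) i)
      (fun _ => tendsto_const_nhds)
      (fun z hz => tendsto_landauB γ i hz tendsto_one_div_succ) u

/-- The regularized fluxes are locally bounded, uniformly in the regularization. -/
lemma exists_norm_landauFlux_le (hd : 1 ≤ d) {γ : ℝ} (hγd : -(d : ℝ) ≤ γ) (hγ : γ ≤ 1)
    {g : Euc d → ℝ} (hg : ContDiff ℝ 1 g) {m N : ℝ} (hm : 2 * d + 2 < m)
    (hgN : ∀ w, |g w| ≤ N * bracket w ^ (-m)) (v : Euc d) :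
    ∃ B : ℝ, ∀ ε, |ε| ≤ 1 → ∀ u ∈ Metric.ball v 1, ‖landauFlux γ ε g u‖ ≤ B := by
  have hN : 0 ≤ N := by
    have := (abs_nonneg _).trans (hgN 0)
    exact nonneg_of_mul_nonneg_left this (Real.rpow_pos_of_pos (bracket_pos _) _)
  obtain ⟨B, hB, h⟩ := abs_kernelConv_le hd hm (bracket v + 2)
    (by have := bracket_pos v; positivity)
  obtain ⟨D, hD⟩ := (isCompact_closedBall v 1).exists_bound_of_continuousOn
    (hg.continuous_fderiv one_ne_zero).continuousOn
  obtain ⟨G, hG⟩ := (isCompact_closedBall v 1).exists_bound_of_continuousOn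
    hg.continuous.continuousOn
  refine ⟨∑ _i : Fin d, (∑ _j : Fin d, N * 6 * B * D + G * (N * (2 * d) * B)),
    fun ε hε u hu => ?_⟩
  have hu' := Metric.ball_subset_closedBall hu
  have hbu := bracket_le_of_mem_ball hu
  have hcomp : ∀ i : Fin d, ‖landauFlux γ ε g u i‖ ≤
      ∑ _j : Fin d, N * 6 * B * D + G * (N * (2 * d) * B) := by
    intro i
    refine (norm_sub_le _ _).trans (add_le_add ((norm_sum_le _ _).trans
      (Finset.sum_le_sum fun j _ => ?_)) ?_)
    · rw [norm_mul]
      refine mul_le_mul (h N 6 g _ (by norm_num) hgN (abs_landauA_le hγd hγ hε i j) u hbu) ?_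
        (norm_nonneg _) (by positivity)
      refine ((fderiv ℝ g u).le_opNorm _).trans ?_
      simpa using hD u hu'
    · rw [norm_mul]
      exact mul_le_mul (hG u hu') (h N (2 * d) g _ (by positivity) hgN
        (abs_landauB_le hd hγd hγ hε i) u hbu) (norm_nonneg _) ((norm_nonneg _).trans (hG u hu'))
  calc ‖landauFlux γ ε g u‖ ≤ ∑ i, ‖landauFlux γ ε g u i‖ := by
        rw [EuclideanSpace.norm_eq]
        refine Real.sqrt_le_left (Finset.sum_nonneg fun i _ => norm_nonneg _) |>.2 ?_
        exact Finset.sum_sq_le_sq_sum_of_nonneg fun i _ => norm_nonneg _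
    _ ≤ _ := Finset.sum_le_sum fun i _ => hcomp i

/-! ### The divergence of the regularized flux -/

lemma contDiff_fderiv_apply {g : Euc d → ℝ} (hg : ContDiff ℝ 2 g) (e : Euc d) :
    ContDiff ℝ 1 fun u => fderiv ℝ g u e :=
  (hg.fderiv_right (m := 1) (by norm_num)).clm_apply contDiff_const

lemma fderiv_fderiv_apply {g : Euc d → ℝ} (hg : ContDiff ℝ 2 g) (u e e' : Euc d) :
    fderiv ℝ (fun u => fderiv ℝ g u e) u e' = fderiv ℝ (fderiv ℝ g) u e' e := by
  have h1 : DifferentiableAt ℝ (fderiv ℝ g) u :=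
    (hg.fderiv_right (m := 1) (by norm_num)).differentiable one_ne_zero u
  have h2 := h1.hasFDerivAt.clm_apply (hasFDerivAt_const e u)
  rw [h2.fderiv]
  simp

lemma contDiff_landauFlux {γ ε : ℝ} (hγ : γ ≤ 1) (hε : 0 < ε) (hε1 : ε ≤ 1)
    {g : Euc d → ℝ} (hg : ContDiff ℝ 2 g) {m N : ℝ} (hm : d + 3 < m)
    (hgN : ∀ w, |g w| ≤ N * bracket w ^ (-m)) : ContDiff ℝ 1 (landauFlux γ ε g) := by
  have hgc := hg.continuous
  have hm' : (d : ℝ) + (3 : ℕ) < m := by exact_mod_cast hm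
  refine contDiff_euclidean.2 fun i => ?_
  refine (ContDiff.sum fun j _ => ContDiff.mul ?_ (contDiff_fderiv_apply hg _)).sub
    ((hg.of_le (by norm_num)).mul ?_)
  · exact (hasC1Growth_landauA hγ hε hε1 i j).contDiff_kernelConv hgc hgN hm'
  · exact (hasC1Growth_landauB hγ hε hε1 i).contDiff_kernelConv hgc hgN hm'

/-- The first-order terms cancel: differentiating g * A_{ij} gives, by symmetry of the matrix, ∇g ·
(g * B), which is what the second part of the flux subtracts. What remains is A : D²g - g div B
under the integral. -/
lemma divergence_landauFlux {γ ε : ℝ} (hγ : γ ≤ 1) (hε : 0 < ε) (hε1 : ε ≤ 1)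
    {g : Euc d → ℝ} (hg : ContDiff ℝ 2 g) {m N : ℝ} (hm : d + 3 < m)
    (hgN : ∀ w, |g w| ≤ N * bracket w ^ (-m)) (u : Euc d) :
    ∑ i : Fin d, fderiv ℝ (landauFlux γ ε g) u (EuclideanSpace.single i 1) i =
      ∫ w, g w * (∑ i : Fin d, ∑ j : Fin d, landauA γ ε i j (u - w) *
        fderiv ℝ (fderiv ℝ g) u (EuclideanSpace.single i 1) (EuclideanSpace.single j 1) +
        g u * (((d : ℝ) - 1) * (regPow (γ / 2 - 1) ε (u - w) *
          ((d + γ) * ‖u - w‖ ^ 2 + d * ε ^ 2)))) := by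
  have hgc := hg.continuous
  have hm' : (d : ℝ) + (3 : ℕ) < m := by exact_mod_cast hm
  have hA := fun i j => hasC1Growth_landauA (d := d) hγ hε hε1 i j
  have hB := fun i => hasC1Growth_landauB (d := d) hγ hε hε1 i
  have hF := contDiff_landauFlux hγ hε hε1 hg hm hgN
  set e : Fin d → Euc d := fun i => EuclideanSpace.single i 1 with he
  have hdiv : ∀ i : Fin d, fderiv ℝ (landauFlux γ ε g) u (e i) i =
      ∑ j, (kernelConv g (landauA γ ε i j) u * fderiv ℝ (fderiv ℝ g) u (e i) (e j) +
        fderiv ℝ g u (e j) * fderiv ℝ (kernelConv g (landauA γ ε i j)) u (e i)) -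
      (g u * fderiv ℝ (kernelConv g (landauB γ ε i)) u (e i) +
        kernelConv g (landauB γ ε i) u * fderiv ℝ g u (e i)) := by
    intro i
    have h1 : HasFDerivAt (fun u => landauFlux γ ε g u i)
        ((EuclideanSpace.proj (𝕜 := ℝ) i).comp (fderiv ℝ (landauFlux γ ε g) u)) u :=
      (EuclideanSpace.proj (𝕜 := ℝ) i).hasFDerivAt.comp u
        (hF.differentiable one_ne_zero u).hasFDerivAt
    have hκ := fun j => (((hA i j).contDiff_kernelConv hgc hgN hm').differentiable
      one_ne_zero u).hasFDerivAt
    have hβ := (((hB i).contDiff_kernelConv hgc hgN hm').differentiable one_ne_zero u).hasFDerivAt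
    have hp := fun j => ((contDiff_fderiv_apply hg (e j)).differentiable one_ne_zero u).hasFDerivAt
    have hgd := (hg.differentiable two_ne_zero u).hasFDerivAt
    have h2 := (HasFDerivAt.fun_sum (u := Finset.univ) fun j _ => (hκ j).mul (hp j)).sub
      (hgd.mul hβ)
    have h3 := congrArg (fun L : Euc d →L[ℝ] ℝ => L (e i)) (h1.unique h2)
    refine Eq.trans h3 ?_
    simp [fderiv_fderiv_apply hg]
  change ∑ i : Fin d, fderiv ℝ (landauFlux γ ε g) u (e i) i = _
  rw [Finset.sum_congr rfl fun i _ => hdiv i]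
  have hcancel : ∀ j : Fin d, ∑ i : Fin d, fderiv ℝ (kernelConv g (landauA γ ε i j)) u (e i) =
      kernelConv g (landauB γ ε j) u := by
    intro j
    simp_rw [landauA_symm γ ε _ j, (hA j _).fderiv_kernelConv_apply hgc hgN hm']
    rw [← integral_finsetSum _ fun i _ => ((hA j i).integrable hgc hgN hm' u).2.2 _]
    refine integral_congr_ae (Eventually.of_forall fun w => ?_)
    simp only
    rw [← Finset.mul_sum, he, sum_fderiv_landauA γ hε]
  have hi1 := fun i j => ((hA i j).integrable hgc hgN hm' u).1
  have hi2 := fun i => ((hB i).integrable hgc hgN hm' u).2.2 (e i)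
  have hrhs : ∀ w, g w * (∑ i : Fin d, ∑ j : Fin d, landauA γ ε i j (u - w) *
        fderiv ℝ (fderiv ℝ g) u (e i) (e j) +
        g u * (((d : ℝ) - 1) * (regPow (γ / 2 - 1) ε (u - w) *
          ((d + γ) * ‖u - w‖ ^ 2 + d * ε ^ 2)))) =
      ∑ i : Fin d, ∑ j : Fin d, g w * landauA γ ε i j (u - w) *
        fderiv ℝ (fderiv ℝ g) u (e i) (e j) -
      g u * ∑ i : Fin d, g w * fderiv ℝ (landauB γ ε i) (u - w) (e i) := by
    intro w
    rw [← Finset.mul_sum, he, sum_fderiv_landauB γ hε]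
    simp only [mul_assoc (g w), ← Finset.mul_sum]
    ring
  rw [integral_congr_ae (Eventually.of_forall hrhs)]
  rw [integral_sub (integrable_finsetSum _ fun i _ => integrable_finsetSum _ fun j _ =>
      (hi1 i j).mul_const _) ((integrable_finsetSum _ fun i _ => hi2 i).const_mul _),
    integral_const_mul, integral_finsetSum _ fun i _ => hi2 i,
    integral_finsetSum _ fun i _ => integrable_finsetSum _ fun j _ => (hi1 i j).mul_const _]
  simp_rw [integral_finsetSum Finset.univ fun j _ => (hi1 _ j).mul_const _, integral_mul_const,
    (hB _).fderiv_kernelConv_apply hgc hgN hm']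
  simp only [Finset.sum_sub_distrib, Finset.sum_add_distrib, ← Finset.mul_sum]
  rw [Finset.sum_comm (f := fun i j => fderiv ℝ g u (e j) *
    fderiv ℝ (kernelConv g (landauA γ ε i j)) u (e i))]
  simp only [← Finset.mul_sum, hcancel]
  simp only [mul_comm (kernelConv g (landauB γ ε _) u)]
  simp only [kernelConv]
  ring

/-! ### Second-order comparison at a contact point -/

/-- On the line through v in direction ξ, a negative second derivative would make v a local maximum
too. The restriction would then be locally constant, with second derivative zero. -/
lemma fderiv_fderiv_nonneg_of_isLocalMin {h : Euc d → ℝ} (hh : ContDiff ℝ 2 h) {v : Euc d}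
    (hmin : IsLocalMin h v) (ξ : Euc d) : 0 ≤ fderiv ℝ (fderiv ℝ h) v ξ ξ := by
  by_contra! hneg
  set ℓ : ℝ → Euc d := fun t => v + t • ξ with hℓ
  have hℓd : ∀ t, HasDerivAt ℓ ξ t := fun t => by
    exact (((hasDerivAt_id t).smul_const ξ).const_add v).congr_deriv (by simp)
  have hk : ∀ t, HasDerivAt (fun t => h (ℓ t)) (fderiv ℝ h (ℓ t) ξ) t := fun t =>
    (hh.differentiable two_ne_zero (ℓ t)).hasFDerivAt.comp_hasDerivAt t (hℓd t)
  have hk1 : deriv (fun t => h (ℓ t)) = fun t => fderiv ℝ h (ℓ t) ξ := funext fun t => (hk t).deriv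
  have hk2 : HasDerivAt (fun t => fderiv ℝ h (ℓ t) ξ) (fderiv ℝ (fderiv ℝ h) v ξ ξ) 0 := by
    have h1 := ((contDiff_fderiv_apply hh ξ).differentiable one_ne_zero (ℓ 0)).hasFDerivAt
    have h2 : HasDerivAt (fun t => fderiv ℝ h (ℓ t) ξ) _ 0 := h1.comp_hasDerivAt 0 (hℓd 0)
    have h3 : ℓ 0 = v := by simp [hℓ]
    rwa [fderiv_fderiv_apply hh, h3] at h2
  have hmin' : IsLocalMin (fun t => h (ℓ t)) 0 := by
    have h1 : Tendsto ℓ (𝓝 0) (𝓝 v) := by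
      have := (hℓd 0).continuousAt.tendsto
      simpa [hℓ] using this
    have h2 := h1.eventually hmin
    filter_upwards [h2] with t ht
    simpa [hℓ] using ht
  have hmax : IsLocalMax (fun t => h (ℓ t)) 0 := by
    refine isLocalMax_of_deriv_deriv_neg ?_ hmin'.deriv_eq_zero (hk 0).continuousAt
    rw [hk1, hk2.deriv]; exact hneg
  have hconst : (fun t => h (ℓ t)) =ᶠ[𝓝 0] fun _ => h (ℓ 0) := by
    filter_upwards [hmin', hmax] with t h1 h2 using le_antisymm h2 h1
  have h1 := hconst.deriv.deriv_eq
  rw [hk1, hk2.deriv] at h1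
  simp at h1
  linarith

lemma tendsto_norm_fderiv_fderiv_sub {h : Euc d → ℝ} (hh : ContDiff ℝ 2 h) (v : Euc d) :
    Tendsto (fun u => ‖fderiv ℝ (fderiv ℝ h) u - fderiv ℝ (fderiv ℝ h) v‖) (𝓝 v) (𝓝 0) := by
  have hc := (hh.fderiv_right (m := 1) (by norm_num)).continuous_fderiv one_ne_zero
  exact tendsto_iff_norm_sub_tendsto_zero.1 (hc.tendsto v)

lemma exists_ball_fderiv_fderiv_ge {h : Euc d → ℝ} (hh : ContDiff ℝ 2 h) {v : Euc d}
    (hmin : IsLocalMin h v) {τ : ℝ} (hτ : 0 < τ) :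
    ∃ r > 0, ∀ u ∈ Metric.ball v r, ∀ ξ, -(τ * ‖ξ‖ ^ 2) ≤ fderiv ℝ (fderiv ℝ h) u ξ ξ := by
  obtain ⟨r, hr, hb⟩ := Metric.eventually_nhds_iff_ball.1
    ((tendsto_norm_fderiv_fderiv_sub hh v).eventually (gt_mem_nhds hτ))
  refine ⟨r, hr, fun u hu ξ => ?_⟩
  have h0 := fderiv_fderiv_nonneg_of_isLocalMin hh hmin ξ
  have h2 := (fderiv ℝ (fderiv ℝ h) u - fderiv ℝ (fderiv ℝ h) v).le_opNorm₂ ξ ξ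
  have h3 : (fderiv ℝ (fderiv ℝ h) u - fderiv ℝ (fderiv ℝ h) v) ξ ξ =
      fderiv ℝ (fderiv ℝ h) u ξ ξ - fderiv ℝ (fderiv ℝ h) v ξ ξ := rfl
  rw [h3, mul_assoc, ← sq, Real.norm_eq_abs] at h2
  have h4 := mul_le_mul_of_nonneg_right (hb u hu).le (sq_nonneg ‖ξ‖)
  have h5 := (abs_le.1 h2).1
  linarith

/-- The Hessian inequality at the contact point persists nearby up to τ, by continuity. A whole ball
is needed because the divergence bound is passed to the limit in weak form. -/
lemma exists_ball_fderiv_fderiv_le {g φ : Euc d → ℝ} (hg : ContDiff ℝ 2 g) (hφ : ContDiff ℝ 2 φ)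
    (hle : ∀ u, g u ≤ φ u) {v : Euc d} (hv : g v = φ v) {τ : ℝ} (hτ : 0 < τ) :
    ∃ r > 0, ∀ u ∈ Metric.ball v r, ∀ ξ, fderiv ℝ (fderiv ℝ g) u ξ ξ ≤
      fderiv ℝ (fderiv ℝ φ) u ξ ξ + τ * ‖ξ‖ ^ 2 := by
  have hmin : IsLocalMin (fun u => φ u - g u) v := Eventually.of_forall fun u => by
    simp only [hv, sub_self]; linarith [hle u]
  obtain ⟨r, hr, h⟩ := exists_ball_fderiv_fderiv_ge (hφ.sub hg) hmin hτ
  refine ⟨r, hr, fun u hu ξ => ?_⟩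
  have h3 : ∀ e u, fderiv ℝ (fun u => φ u - g u) u e = fderiv ℝ φ u e - fderiv ℝ g u e :=
    fun e u => by
      rw [fderiv_fun_sub (hφ.differentiable two_ne_zero u) (hg.differentiable two_ne_zero u)]
      rfl
  have h4 : fderiv ℝ (fderiv ℝ fun u => φ u - g u) u ξ ξ =
      fderiv ℝ (fderiv ℝ φ) u ξ ξ - fderiv ℝ (fderiv ℝ g) u ξ ξ := by
    rw [← fderiv_fderiv_apply (hφ.sub hg), funext (h3 ξ),
      fderiv_fun_sub ((contDiff_fderiv_apply hφ ξ).differentiable one_ne_zero u)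
        ((contDiff_fderiv_apply hg ξ).differentiable one_ne_zero u),
      ← fderiv_fderiv_apply hφ, ← fderiv_fderiv_apply hg]
    rfl
  have h5 := h u hu ξ
  rw [h4] at h5
  linarith

/-! ### The Landau matrix paired with a Hessian -/

/-- Lagrange's identity: |z|²I - z⊗z is half the sum of ξ_{ij}⊗ξ_{ij} with ξ_{ij} = z_i e_j - z_j
e_i. This sum of squares makes the pairing monotone in X. -/
lemma sum_landauA_mul (γ ε : ℝ) (z : Euc d) (X : Euc d →L[ℝ] Euc d →L[ℝ] ℝ) :
    ∑ i : Fin d, ∑ j : Fin d, landauA γ ε i j z *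
        X (EuclideanSpace.single i 1) (EuclideanSpace.single j 1) =
      regPow (γ / 2) ε z / 2 * ∑ i : Fin d, ∑ j : Fin d,
        X (z i • EuclideanSpace.single j 1 - z j • EuclideanSpace.single i 1)
          (z i • EuclideanSpace.single j 1 - z j • EuclideanSpace.single i 1) := by
  have hz : ∑ j : Fin d, z j ^ 2 = ‖z‖ ^ 2 := by simp [EuclideanSpace.norm_sq_eq]
  set e : Fin d → Euc d := fun i => EuclideanSpace.single i 1 with he
  change ∑ i : Fin d, ∑ j : Fin d, landauA γ ε i j z * X (e i) (e j) =
      regPow (γ / 2) ε z / 2 * ∑ i : Fin d, ∑ j : Fin d,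
        X (z i • e j - z j • e i) (z i • e j - z j • e i)
  have h1 : ∀ i j, X (z i • e j - z j • e i) (z i • e j - z j • e i) =
      z i ^ 2 * X (e j) (e j) + z j ^ 2 * X (e i) (e i) - z i * z j * X (e j) (e i) -
        z i * z j * X (e i) (e j) := by
    intro i j
    simp only [map_sub, map_smul, _root_.sub_apply, _root_.smul_apply, smul_eq_mul]
    ring
  have h2 : ∀ i j, landauA γ ε i j z * X (e i) (e j) = regPow (γ / 2) ε z *
      (‖z‖ ^ 2 * (if i = j then X (e i) (e j) else 0)) -
      regPow (γ / 2) ε z * (z i * z j * X (e i) (e j)) := by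
    intro i j
    unfold landauA
    split_ifs <;> ring
  have h3 : ∑ i : Fin d, ∑ j : Fin d, z i * z j * X (e j) (e i) =
      ∑ i : Fin d, ∑ j : Fin d, z i * z j * X (e i) (e j) := by
    rw [Finset.sum_comm]
    refine Finset.sum_congr rfl fun i _ => Finset.sum_congr rfl fun j _ => by ring
  simp_rw [h1, h2]
  simp only [Finset.sum_sub_distrib, Finset.sum_add_distrib, ← Finset.mul_sum, ← Finset.sum_mul,
    Finset.sum_ite_eq, Finset.mem_univ, if_true, h3, hz]
  ring

lemma sum_landauA_mul_le (γ ε : ℝ) (z : Euc d) {X Y : Euc d →L[ℝ] Euc d →L[ℝ] ℝ} {τ : ℝ}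
    (hτ : 0 ≤ τ) (h : ∀ ξ, X ξ ξ ≤ Y ξ ξ + τ * ‖ξ‖ ^ 2) :
    ∑ i : Fin d, ∑ j : Fin d, landauA γ ε i j z *
        X (EuclideanSpace.single i 1) (EuclideanSpace.single j 1) ≤
      ∑ i : Fin d, ∑ j : Fin d, landauA γ ε i j z *
        Y (EuclideanSpace.single i 1) (EuclideanSpace.single j 1) +
      2 * d ^ 2 * τ * (regPow (γ / 2) ε z * ‖z‖ ^ 2) := by
  rw [sum_landauA_mul, sum_landauA_mul]
  have hr := regPow_nonneg (γ / 2) ε z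
  have hξ : ∀ i j : Fin d, ‖z i • EuclideanSpace.single j (1 : ℝ) -
      z j • EuclideanSpace.single i (1 : ℝ)‖ ^ 2 ≤ 4 * ‖z‖ ^ 2 := by
    intro i j
    have h1 : ‖z i • EuclideanSpace.single j (1 : ℝ) - z j • EuclideanSpace.single i (1 : ℝ)‖ ≤
        2 * ‖z‖ := by
      refine (norm_sub_le _ _).trans ?_
      rw [norm_smul, norm_smul]
      have h2 := abs_apply_le z i
      have h3 := abs_apply_le z j
      simp only [PiLp.norm_single, norm_one, mul_one, Real.norm_eq_abs]
      linarith
    calc _ ≤ (2 * ‖z‖) ^ 2 := by gcongr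
      _ = _ := by ring
  have h1 : ∑ i : Fin d, ∑ j : Fin d,
        X (z i • EuclideanSpace.single j 1 - z j • EuclideanSpace.single i 1)
          (z i • EuclideanSpace.single j 1 - z j • EuclideanSpace.single i 1) ≤
      ∑ i : Fin d, ∑ j : Fin d,
        (Y (z i • EuclideanSpace.single j 1 - z j • EuclideanSpace.single i 1)
          (z i • EuclideanSpace.single j 1 - z j • EuclideanSpace.single i 1) +
          τ * (4 * ‖z‖ ^ 2)) := by
    refine Finset.sum_le_sum fun i _ => Finset.sum_le_sum fun j _ => (h _).trans ?_
    have := mul_le_mul_of_nonneg_left (hξ i j) hτ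
    linarith
  have h2 := mul_le_mul_of_nonneg_left h1 (div_nonneg hr zero_le_two)
  refine h2.trans (le_of_eq ?_)
  simp only [Finset.sum_add_distrib, Finset.sum_const, Finset.card_univ, Fintype.card_fin,
    nsmul_eq_mul]
  ring

/-! ### The Hessian of a power of the bracket -/

lemma bracket_rpow_eq_regPow (v : Euc d) (m : ℝ) : bracket v ^ (-m) = regPow (-m / 2) 1 v := by
  rw [bracket_rpow_eq, regPow, one_pow, add_comm]

lemma contDiff_regPow (s : ℝ) {ε : ℝ} (hε : 0 < ε) {n : ℕ∞} :
    ContDiff ℝ n (regPow s ε : Euc d → ℝ) :=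
  ((contDiff_norm_sq ℝ).add contDiff_const).rpow_const_of_ne fun z => by positivity

lemma contDiff_bracket_rpow (N m : ℝ) {n : ℕ∞} :
    ContDiff ℝ n fun v : Euc d => N * bracket v ^ (-m) := by
  simp_rw [bracket_rpow_eq_regPow]
  exact contDiff_const.mul (contDiff_regPow _ one_pos)

lemma fderiv_fderiv_bracket_rpow (N m : ℝ) (u x y : Euc d) :
    fderiv ℝ (fderiv ℝ fun v : Euc d => N * bracket v ^ (-m)) u x y =
      N * bracket u ^ (-m) * (m * (m + 2) / bracket u ^ 4 * (inner ℝ u x * inner ℝ u y) -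
        m / bracket u ^ 2 * inner ℝ x y) := by
  have hb := bracket_pos u
  have h1 : ∀ v : Euc d, fderiv ℝ (fun v : Euc d => N * bracket v ^ (-m)) v y =
      -(N * m) * (regPow (-m / 2 - 1) 1 v * inner ℝ v y) := by
    intro v
    simp_rw [bracket_rpow_eq_regPow]
    rw [((hasFDerivAt_regPow (-m / 2) one_pos v).const_mul N).fderiv]
    simp
    ring
  have h2 : HasFDerivAt (fun v : Euc d => inner ℝ v y) (innerSL ℝ y) u := by
    simp_rw [real_inner_comm y]
    exact (innerSL ℝ y).hasFDerivAt
  have h3 := ((hasFDerivAt_regPow (-m / 2 - 1) one_pos u).mul h2).const_mul (-(N * m))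
  have hp : ‖u‖ ^ 2 + 1 ^ 2 = bracket u ^ 2 := by rw [bracket_sq]; ring
  have e1 : regPow (-m / 2 - 1) 1 u = bracket u ^ (-m) / bracket u ^ 2 := by
    rw [bracket_rpow_eq_regPow]
    unfold regPow
    rw [hp, Real.rpow_sub_one (by positivity)]
  have e2 : regPow (-m / 2 - 1 - 1) 1 u = bracket u ^ (-m) / bracket u ^ 4 := by
    rw [bracket_rpow_eq_regPow]
    unfold regPow
    rw [hp, Real.rpow_sub_one (by positivity), Real.rpow_sub_one (by positivity)]
    field_simp
  rw [← fderiv_fderiv_apply (contDiff_bracket_rpow N m (n := 2)), funext h1]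
  refine (congrArg (fun L : Euc d →L[ℝ] ℝ => L x) h3.fderiv).trans ?_
  simp [e1, e2, real_inner_comm x y]
  ring

lemma sum_landauA_mul_inner (γ ε : ℝ) (z u : Euc d) :
    ∑ i : Fin d, ∑ j : Fin d, landauA γ ε i j z *
      (inner ℝ u (EuclideanSpace.single i (1 : ℝ)) * inner ℝ u (EuclideanSpace.single j (1 : ℝ))) =
    regPow (γ / 2) ε z * (‖z‖ ^ 2 * ‖u‖ ^ 2 - inner ℝ z u ^ 2) := by
  have hu : ∑ j : Fin d, u j ^ 2 = ‖u‖ ^ 2 := by simp [EuclideanSpace.norm_sq_eq]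
  have hin : inner ℝ z u = ∑ j, z j * u j := by
    rw [PiLp.inner_apply]
    refine Finset.sum_congr rfl fun j _ => ?_
    simp [mul_comm]
  have h2 : ∀ i j, landauA γ ε i j z * (u i * u j) = regPow (γ / 2) ε z *
      (‖z‖ ^ 2 * (if i = j then u i ^ 2 else 0)) -
      regPow (γ / 2) ε z * ((z i * u i) * (z j * u j)) := by
    intro i j
    unfold landauA
    split_ifs with h
    · subst h; ring
    · ring
  simp_rw [inner_single_one, h2]
  simp only [Finset.sum_sub_distrib, ← Finset.mul_sum, ← Finset.sum_mul,
    Finset.sum_ite_eq, Finset.mem_univ, if_true, hu, ← hin]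
  ring

lemma sum_landauA_diag (γ ε : ℝ) (z : Euc d) :
    ∑ i : Fin d, ∑ j : Fin d, landauA γ ε i j z *
      inner ℝ (EuclideanSpace.single i (1 : ℝ) : Euc d) (EuclideanSpace.single j (1 : ℝ)) =
    ((d : ℝ) - 1) * (regPow (γ / 2) ε z * ‖z‖ ^ 2) := by
  have hz : ∑ j : Fin d, z j ^ 2 = ‖z‖ ^ 2 := by simp [EuclideanSpace.norm_sq_eq]
  have h1 : ∀ i j : Fin d, landauA γ ε i j z *
      inner ℝ (EuclideanSpace.single i (1 : ℝ) : Euc d) (EuclideanSpace.single j (1 : ℝ)) =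
      if i = j then regPow (γ / 2) ε z * (‖z‖ ^ 2 - z i ^ 2) else 0 := by
    intro i j
    rw [inner_single_one, PiLp.single_apply]
    unfold landauA
    by_cases h : i = j
    · subst h; simp; ring_nf; simp
    · simp [h, Ne.symm h]
  simp_rw [h1]
  simp only [Finset.sum_ite_eq, Finset.mem_univ, if_true, ← Finset.mul_sum,
    Finset.sum_sub_distrib, Finset.sum_const, Finset.card_univ, Fintype.card_fin, nsmul_eq_mul, hz]
  ring

lemma sum_landauA_mul_hessian_bracket (γ ε N m : ℝ) (z u : Euc d) :
    ∑ i : Fin d, ∑ j : Fin d, landauA γ ε i j z *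
        fderiv ℝ (fderiv ℝ fun v : Euc d => N * bracket v ^ (-m)) u
          (EuclideanSpace.single i 1) (EuclideanSpace.single j 1) =
      N * bracket u ^ (-m) * (regPow (γ / 2) ε z * (m * (m + 2) / bracket u ^ 4 *
        (‖z‖ ^ 2 * ‖u‖ ^ 2 - inner ℝ z u ^ 2) - m * ((d : ℝ) - 1) / bracket u ^ 2 * ‖z‖ ^ 2)) := by
  simp_rw [fderiv_fderiv_bracket_rpow]
  have h1 : ∀ i j : Fin d, landauA γ ε i j z * (N * bracket u ^ (-m) *
      (m * (m + 2) / bracket u ^ 4 * (inner ℝ u (EuclideanSpace.single i (1 : ℝ)) *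
        inner ℝ u (EuclideanSpace.single j (1 : ℝ))) -
        m / bracket u ^ 2 * inner ℝ (EuclideanSpace.single i (1 : ℝ) : Euc d)
          (EuclideanSpace.single j (1 : ℝ)))) =
      N * bracket u ^ (-m) * (m * (m + 2) / bracket u ^ 4) * (landauA γ ε i j z *
        (inner ℝ u (EuclideanSpace.single i (1 : ℝ)) *
          inner ℝ u (EuclideanSpace.single j (1 : ℝ)))) -
      N * bracket u ^ (-m) * (m / bracket u ^ 2) * (landauA γ ε i j z *
        inner ℝ (EuclideanSpace.single i (1 : ℝ) : Euc d) (EuclideanSpace.single j (1 : ℝ))) := by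
    intro i j; ring
  simp_rw [h1]
  simp only [Finset.sum_sub_distrib, ← Finset.mul_sum]
  rw [sum_landauA_mul_inner, sum_landauA_diag]
  ring

/-! ### The Landau operator applied to a power of the bracket -/

/-- `(A_ε(z) : D²φ(u) - φ(u) div div A_ε(z)) / φ(u)` for `φ = ⟨·⟩^{-m}`. -/
noncomputable def landauSymbol (γ ε m : ℝ) (u z : Euc d) : ℝ :=
  regPow (γ / 2) ε z * (m * (m + 2) / bracket u ^ 4 * (‖z‖ ^ 2 * ‖u‖ ^ 2 - inner ℝ z u ^ 2) -
      m * ((d : ℝ) - 1) / bracket u ^ 2 * ‖z‖ ^ 2) +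
    ((d : ℝ) - 1) * (regPow (γ / 2 - 1) ε z * ((d + γ) * ‖z‖ ^ 2 + d * ε ^ 2))

lemma regPow_half_eq (γ : ℝ) {ε : ℝ} (hε : 0 < ε) (z : Euc d) :
    regPow (γ / 2) ε z = regPow (γ / 2 - 1) ε z * (‖z‖ ^ 2 + ε ^ 2) := by
  unfold regPow
  rw [← Real.rpow_add_one (by positivity)]; congr 1; ring

/-- When u - z is small, z is nearly parallel and equal to u, so the positive term with |z|²|u|² -
⟨z,u⟩² is negligible. The negative term is close to -m(d-1) and beats the contribution of div div A,
at most (d-1)(d+1), once m ≥ 2(d+1). -/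
lemma landauSymbol_nonpos (hd : 2 ≤ d) {γ ε m : ℝ} (hγ : γ ≤ 1) (hε : 0 < ε)
    (hm : 2 * ((d : ℝ) + 1) ≤ m) {u z : Euc d}
    (hlow : bracket (u - z) < 1 / (16 * (m + 2)) * bracket u) : landauSymbol γ ε m u z ≤ 0 := by
  have hd2 : (2 : ℝ) ≤ d := by exact_mod_cast hd
  set κ : ℝ := 1 / (16 * (m + 2)) with hκ
  have hm2 : 0 < m + 2 := by linarith
  have hκ0 : 0 < κ := by positivity
  have hκm : κ * (m + 2) = 1 / 16 := by rw [hκ]; field_simp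
  have hκ1 : κ ≤ 1 / 128 := by nlinarith
  have hz := norm_sq_ge_of_bracket_sub_lt hκ0 (by linarith) u z hlow
  have hb := one_le_bracket u
  set P : ℝ := bracket u ^ 2 with hP
  have hP0 : 0 < P := by positivity
  have hP4 : bracket u ^ 4 = P ^ 2 := by rw [hP]; ring
  have huP : ‖u‖ ^ 2 ≤ P := by rw [hP, bracket_sq]; linarith
  have hw : ‖u - z‖ ^ 2 ≤ κ ^ 2 * P := by
    have h1 : ‖u - z‖ ≤ κ * bracket u := (norm_le_bracket _).trans hlow.le
    calc ‖u - z‖ ^ 2 ≤ (κ * bracket u) ^ 2 := by gcongr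
      _ = _ := by rw [hP]; ring
  have hG : ‖z‖ ^ 2 * ‖u‖ ^ 2 - inner ℝ z u ^ 2 ≤ κ ^ 2 * P ^ 2 := by
    have h1 : ‖u - z‖ ^ 2 = ‖u‖ ^ 2 - 2 * inner ℝ u z + ‖z‖ ^ 2 := norm_sub_sq_real u z
    have h2 : ‖z‖ ^ 2 * ‖u‖ ^ 2 - inner ℝ z u ^ 2 =
        ‖u - z‖ ^ 2 * ‖u‖ ^ 2 - (‖u‖ ^ 2 - inner ℝ z u) ^ 2 := by
      rw [h1, real_inner_comm u z]; ring
    rw [h2]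
    have h3 : ‖u - z‖ ^ 2 * ‖u‖ ^ 2 ≤ κ ^ 2 * P * P := by gcongr
    nlinarith [sq_nonneg (‖u‖ ^ 2 - inner ℝ z u)]
  have hr := regPow_nonneg (γ / 2 - 1) ε z
  have hρ : 0 < ‖z‖ ^ 2 + ε ^ 2 := by positivity
  have ha : m * (m + 2) / P ^ 2 * (‖z‖ ^ 2 * ‖u‖ ^ 2 - inner ℝ z u ^ 2) ≤ m / 8 := by
    have h1 : 0 ≤ m * (m + 2) / P ^ 2 := by
      have : 0 ≤ m := by linarith
      positivity
    calc _ ≤ m * (m + 2) / P ^ 2 * (κ ^ 2 * P ^ 2) := mul_le_mul_of_nonneg_left hG h1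
      _ = m * (κ * (m + 2)) * κ := by field_simp
      _ ≤ m / 8 := by rw [hκm]; nlinarith
  have hbnd : m * ((d : ℝ) - 1) * (7 / 8) ≤ m * ((d : ℝ) - 1) / P * ‖z‖ ^ 2 := by
    have h1 : 0 ≤ m * ((d : ℝ) - 1) / P := by
      have : 0 ≤ m := by linarith
      have : 0 ≤ (d : ℝ) - 1 := by linarith
      positivity
    calc m * ((d : ℝ) - 1) * (7 / 8) ≤ m * ((d : ℝ) - 1) * (1 - 4 * κ) := by
          refine mul_le_mul_of_nonneg_left (by linarith) (mul_nonneg (by linarith) (by linarith))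
      _ = m * ((d : ℝ) - 1) / P * ((1 - 4 * κ) * P) := by field_simp
      _ ≤ _ := mul_le_mul_of_nonneg_left hz h1
  have hc : (d + γ) * ‖z‖ ^ 2 + d * ε ^ 2 ≤ (d + 1) * (‖z‖ ^ 2 + ε ^ 2) := by
    nlinarith [sq_nonneg ‖z‖, sq_nonneg ε]
  unfold landauSymbol
  rw [regPow_half_eq γ hε, hP4]
  -- The numbers are m/8 - (7/8)m(d-1) + (d-1)(d+1), which is nonpositive since d - 1 ≥ 1 and m ≥
  -- 2(d+1).
  have h1 : (m * (m + 2) / P ^ 2 * (‖z‖ ^ 2 * ‖u‖ ^ 2 - inner ℝ z u ^ 2) -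
      m * ((d : ℝ) - 1) / P * ‖z‖ ^ 2) + ((d : ℝ) - 1) * (d + 1) ≤ 0 := by
    nlinarith
  have h2 := mul_nonneg hr hρ.le
  have h3 := mul_le_mul_of_nonneg_left hc (mul_nonneg (by linarith : (0 : ℝ) ≤ (d : ℝ) - 1) hr)
  have h4 := mul_nonpos_of_nonneg_of_nonpos h2 h1
  linarith

/-- A bound for `landauSymbol` that is uniform in `u` and `ε`. -/
noncomputable def landauSymbolBound (γ ε m : ℝ) (z : Euc d) : ℝ :=
  (3 * m * (m + 2) + d * (d + 1)) * landauEnvelope z + d * ((d + γ) * ‖z‖ ^ γ) +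
    d ^ 2 * (ε ^ 2 * regPow (-(d : ℝ) / 2 - 1) ε z * bracket z ^ ((d : ℝ) + 1))

lemma bracket_le_landauEnvelope (z : Euc d) : bracket z ≤ landauEnvelope z := by
  have h1 := Real.rpow_le_rpow_of_exponent_le (one_le_bracket z) (show (1 : ℝ) ≤ 3 by norm_num)
  rw [Real.rpow_one] at h1
  have : 0 ≤ ‖z‖ ^ (1 - (d : ℝ)) := by positivity
  unfold landauEnvelope
  linarith

lemma landauSymbolBound_nonneg {γ m : ℝ} (hγd : -(d : ℝ) ≤ γ) (hm : 0 ≤ m) (ε : ℝ) (z : Euc d) :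
    0 ≤ landauSymbolBound γ ε m z := by
  have h1 := landauEnvelope_nonneg z
  have h2 := regPow_nonneg (-(d : ℝ) / 2 - 1) ε z
  have h3 := bracket_pos z
  have h4 : 0 ≤ (d : ℝ) + γ := by linarith
  unfold landauSymbolBound
  positivity

/-- The second-order part is bounded by the envelope. The factor d + γ is kept in front of |z|^γ
because |z|^{-d} is not integrable, and the ε² term is compared with an approximate delta of fixed
mass. -/
lemma landauSymbol_le (hd : 2 ≤ d) {γ ε m : ℝ} (hγd : -(d : ℝ) ≤ γ) (hγ : γ ≤ 1) (hε : 0 < ε)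
    (hε1 : ε ≤ 1) (hm : 0 ≤ m) (u : Euc d) {z : Euc d} (hz : z ≠ 0) :
    landauSymbol γ ε m u z ≤ landauSymbolBound γ ε m z := by
  have hd2 : (2 : ℝ) ≤ d := by exact_mod_cast hd
  have hεa : |ε| ≤ 1 := by rwa [abs_of_pos hε]
  have hb := one_le_bracket u
  have hbz := one_le_bracket z
  have hr := regPow_nonneg (γ / 2) ε z
  have hr1 := regPow_nonneg (γ / 2 - 1) ε z
  have h1 : regPow (γ / 2) ε z * (m * (m + 2) / bracket u ^ 4 * (‖z‖ ^ 2 * ‖u‖ ^ 2 -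
      inner ℝ z u ^ 2) - m * ((d : ℝ) - 1) / bracket u ^ 2 * ‖z‖ ^ 2) ≤
      3 * m * (m + 2) * landauEnvelope z := by
    have e1 : m * (m + 2) / bracket u ^ 4 * (‖z‖ ^ 2 * ‖u‖ ^ 2 - inner ℝ z u ^ 2) ≤
        m * (m + 2) * ‖z‖ ^ 2 := by
      have e2 : ‖u‖ ^ 2 ≤ bracket u ^ 4 := by
        have : ‖u‖ ^ 2 ≤ bracket u ^ 2 := by rw [bracket_sq]; linarith
        exact this.trans (pow_le_pow_right₀ hb (by norm_num))
      rw [div_mul_eq_mul_div, div_le_iff₀ (by positivity), mul_assoc (m * (m + 2))]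
      refine mul_le_mul_of_nonneg_left ?_ (by positivity)
      have := mul_le_mul_of_nonneg_left e2 (sq_nonneg ‖z‖)
      nlinarith [sq_nonneg (inner ℝ z u)]
    have e3 : 0 ≤ m * ((d : ℝ) - 1) / bracket u ^ 2 * ‖z‖ ^ 2 := by
      have : 0 ≤ (d : ℝ) - 1 := by linarith
      positivity
    calc _ ≤ regPow (γ / 2) ε z * (m * (m + 2) * ‖z‖ ^ 2) :=
          mul_le_mul_of_nonneg_left (by linarith) hr
      _ = m * (m + 2) * (regPow (γ / 2) ε z * ‖z‖ ^ 2) := by ring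
      _ ≤ m * (m + 2) * (3 * landauEnvelope z) :=
          mul_le_mul_of_nonneg_left (regPow_mul_norm_sq_le hγd hγ hεa z) (by positivity)
      _ = _ := by ring
  have h2 : regPow (γ / 2 - 1) ε z * ((d + γ) * ‖z‖ ^ 2) ≤
      (d + γ) * ‖z‖ ^ γ + (d + 1) * landauEnvelope z := by
    have e1 : regPow (γ / 2 - 1) ε z * ‖z‖ ^ 2 ≤ regPow (γ / 2) ε z := by
      rw [regPow_half_eq γ hε]
      exact mul_le_mul_of_nonneg_left (by nlinarith) hr1
    have e2 := (e1.trans (regPow_le hγ hεa hz)).trans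
      (add_le_add_right (bracket_le_landauEnvelope z) _)
    have e3 := mul_le_mul_of_nonneg_left e2 (show 0 ≤ (d : ℝ) + γ by linarith)
    have e4 := mul_le_mul_of_nonneg_right (show (d : ℝ) + γ ≤ d + 1 by linarith)
      (landauEnvelope_nonneg z)
    linarith
  have h3 : regPow (γ / 2 - 1) ε z ≤
      regPow (-(d : ℝ) / 2 - 1) ε z * bracket z ^ ((d : ℝ) + 1) := by
    have hρ : 0 < ‖z‖ ^ 2 + ε ^ 2 := by positivity
    have e1 : regPow (γ / 2 - 1) ε z = regPow (-(d : ℝ) / 2 - 1) ε z *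
        (‖z‖ ^ 2 + ε ^ 2) ^ ((d + γ) / 2) := by
      unfold regPow
      rw [← Real.rpow_add hρ]; congr 1; ring
    rw [e1]
    refine mul_le_mul_of_nonneg_left ?_ (regPow_nonneg _ _ _)
    calc (‖z‖ ^ 2 + ε ^ 2) ^ ((d + γ) / 2) ≤ (1 + ‖z‖ ^ 2) ^ ((d + γ) / 2) :=
          Real.rpow_le_rpow hρ.le (by nlinarith) (by linarith)
      _ = bracket z ^ (d + γ) := (bracket_rpow_eq z _).symm
      _ ≤ _ := Real.rpow_le_rpow_of_exponent_le hbz (by linarith)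
  have h4 := mul_le_mul_of_nonneg_left h3 (sq_nonneg ε)
  have e5 := landauEnvelope_nonneg z
  have e6 : 0 ≤ (d + γ) * ‖z‖ ^ γ := mul_nonneg (by linarith) (by positivity)
  have e7 : 0 ≤ ε ^ 2 * regPow (γ / 2 - 1) ε z := by positivity
  have h5 : ((d : ℝ) - 1) * (regPow (γ / 2 - 1) ε z * ((d + γ) * ‖z‖ ^ 2 + d * ε ^ 2)) ≤
      d * ((d + γ) * ‖z‖ ^ γ + (d + 1) * landauEnvelope z) +
      d ^ 2 * (ε ^ 2 * regPow (γ / 2 - 1) ε z) := by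
    calc _ = ((d : ℝ) - 1) * (regPow (γ / 2 - 1) ε z * ((d + γ) * ‖z‖ ^ 2)) +
          ((d : ℝ) - 1) * d * (ε ^ 2 * regPow (γ / 2 - 1) ε z) := by ring
      _ ≤ ((d : ℝ) - 1) * ((d + γ) * ‖z‖ ^ γ + (d + 1) * landauEnvelope z) +
          ((d : ℝ) - 1) * d * (ε ^ 2 * regPow (γ / 2 - 1) ε z) := by
          have := mul_le_mul_of_nonneg_left h2 (show 0 ≤ (d : ℝ) - 1 by linarith)
          linarith
      _ ≤ _ := by
          have e8 : 0 ≤ (d + γ) * ‖z‖ ^ γ + (d + 1) * landauEnvelope z := by positivity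
          have e9 : 0 ≤ d * (ε ^ 2 * regPow (γ / 2 - 1) ε z) := by positivity
          nlinarith
  have h6 := mul_le_mul_of_nonneg_left h4 (show 0 ≤ (d : ℝ) ^ 2 by positivity)
  unfold landauSymbol landauSymbolBound
  linarith

/-- The total mass of `ε² (|z|² + ε²)^{-d/2-1}` does not depend on `ε`. -/
lemma exists_lintegral_regPow_le (d : ℕ) : ∃ C : ℝ, 0 ≤ C ∧ ∀ ε : ℝ, 0 < ε →
    ∫⁻ z : Euc d, ENNReal.ofReal (ε ^ 2 * regPow (-(d : ℝ) / 2 - 1) ε z) ≤ ENNReal.ofReal C := by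
  have hint : Integrable fun y : Euc d => bracket y ^ (-((d : ℝ) + 2)) :=
    integrable_bracket_rpow (by linarith)
  refine ⟨∫ y : Euc d, bracket y ^ (-((d : ℝ) + 2)), integral_nonneg fun y =>
    Real.rpow_nonneg (bracket_pos y).le _, fun ε hε => ?_⟩
  -- The scaling z = εy removes ε from the profile.
  have h1 : ∀ z : Euc d, ε ^ 2 * regPow (-(d : ℝ) / 2 - 1) ε z =
      (ε ^ d)⁻¹ * bracket (ε⁻¹ • z) ^ (-((d : ℝ) + 2)) := by
    intro z
    have e1 : ‖z‖ ^ 2 + ε ^ 2 = ε ^ 2 * (1 + ‖ε⁻¹ • z‖ ^ 2) := by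
      rw [norm_smul, norm_inv, Real.norm_of_nonneg hε.le]
      field_simp
      ring
    have e2 : (ε ^ 2) ^ (-(d : ℝ) / 2 - 1) = (ε ^ d)⁻¹ * (ε ^ 2)⁻¹ := by
      rw [← Real.rpow_natCast ε 2, ← Real.rpow_mul hε.le, ← Real.rpow_natCast ε d,
        ← Real.rpow_neg hε.le, ← Real.rpow_neg hε.le, ← Real.rpow_add hε]
      congr 1; push_cast; ring
    unfold regPow
    rw [bracket_rpow_eq, e1, Real.mul_rpow (by positivity) (by positivity), e2]
    have e3 : -(d : ℝ) / 2 - 1 = -((d : ℝ) + 2) / 2 := by ring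
    rw [e3]
    field_simp
  have hint2 : Integrable fun z : Euc d => (ε ^ d)⁻¹ * bracket (ε⁻¹ • z) ^ (-((d : ℝ) + 2)) :=
    (hint.comp_smul (inv_ne_zero hε.ne')).const_mul _
  simp_rw [h1]
  rw [← ofReal_integral_eq_lintegral_ofReal hint2 (Eventually.of_forall fun z =>
    mul_nonneg (by positivity) (Real.rpow_nonneg (bracket_pos _).le _)), integral_const_mul,
    Measure.integral_comp_inv_smul_of_nonneg volume (fun y : Euc d => bracket y ^ (-((d : ℝ) + 2)))
      hε.le]
  refine ENNReal.ofReal_le_ofReal (le_of_eq ?_)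
  rw [finrank_euclideanSpace_fin, smul_eq_mul, inv_mul_cancel_left₀ (by positivity)]

/-- At γ = -d the power is not locally integrable but its coefficient is zero; for γ > -d it is
integrable. -/
lemma exists_lintegral_norm_rpow_le (hd : 1 ≤ d) {γ : ℝ} (hγd : -(d : ℝ) ≤ γ) (hγ : γ ≤ 1) {m : ℝ}
    (hm : 2 * d + 2 < m) (a : ℝ) (ha : 0 ≤ a) :
    ∃ C : ℝ, 0 ≤ C ∧ ∀ (v : Euc d) (s : Set (Euc d)), MeasurableSet s →
      (∀ y ∈ s, bracket y ≤ a * bracket (v - y)) →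
      ∫⁻ y in s, ENNReal.ofReal ((d + γ) * ‖y‖ ^ γ * bracket (v - y) ^ (-m)) ≤
        ENNReal.ofReal C := by
  have hd1 : (1 : ℝ) ≤ d := by exact_mod_cast hd
  rcases hγd.eq_or_lt with h | h
  · refine ⟨0, le_rfl, fun v s _ _ => ?_⟩
    simp [← h]
  · obtain ⟨C, hC, hb⟩ := lintegral_norm_rpow_bracket_le hd h (j := 0) (m := m) le_rfl (by
      have : |γ| ≤ d := abs_le.2 ⟨hγd, by linarith⟩
      linarith) a ha
    refine ⟨(d + γ) * C, mul_nonneg (by linarith) hC, fun v s hs hsa => ?_⟩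
    rw [ENNReal.ofReal_mul (by linarith)]
    refine le_trans (le_of_eq ?_) (mul_le_mul_right (hb v s hs hsa) _)
    rw [← lintegral_const_mul' _ _ ENNReal.ofReal_ne_top]
    refine lintegral_congr fun y => ?_
    rw [← ENNReal.ofReal_mul (by linarith), Real.rpow_zero, mul_one, mul_assoc]

lemma exists_lintegral_landauSymbolBound_le (hd : 1 ≤ d) {γ : ℝ} (hγd : -(d : ℝ) ≤ γ)
    (hγ : γ ≤ 1) {m : ℝ} (hm : 2 * d + 2 < m) {κ : ℝ} (hκ : 0 < κ) :
    ∃ C : ℝ, 0 ≤ C ∧ ∀ (ε : ℝ), 0 < ε → ∀ u : Euc d,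
      ∫⁻ z in {z : Euc d | κ * bracket u ≤ bracket (u - z)},
        ENNReal.ofReal (bracket (u - z) ^ (-m) * landauSymbolBound γ ε m z) ≤
      ENNReal.ofReal C := by
  set a : ℝ := 2 + 1 / κ with ha
  have ha0 : 0 ≤ a := by positivity
  have hm0 : 0 ≤ m := by
    have : (0 : ℝ) ≤ d := Nat.cast_nonneg d
    linarith
  obtain ⟨C₁, hC₁, h₁⟩ := lintegral_landauEnvelope_le hd hm a ha0
  obtain ⟨C₂, hC₂, h₂⟩ := exists_lintegral_norm_rpow_le hd hγd hγ hm a ha0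
  obtain ⟨C₃, hC₃, h₃⟩ := exists_lintegral_regPow_le d
  set c₁ : ℝ := 3 * m * (m + 2) + d * (d + 1) with hc₁
  set c₃ : ℝ := d ^ 2 * a ^ ((d : ℝ) + 1) with hc₃
  have hc₁0 : 0 ≤ c₁ := by positivity
  have hc₃0 : 0 ≤ c₃ := by positivity
  have hd0 : (0 : ℝ) ≤ d := Nat.cast_nonneg d
  refine ⟨c₁ * C₁ + d * C₂ + c₃ * C₃, by positivity, fun ε hε u => ?_⟩
  set s : Set (Euc d) := {z | κ * bracket u ≤ bracket (u - z)} with hs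
  have hsm : MeasurableSet s := by
    have := continuous_bracket (d := d)
    exact (isClosed_le continuous_const (by fun_prop)).measurableSet
  have hsa : ∀ z ∈ s, bracket z ≤ a * bracket (u - z) := fun z hz =>
    bracket_le_of_le_bracket_sub hκ u z hz
  have hbm : Measurable fun z : Euc d => bracket (u - z) ^ (-m) :=
    ((continuous_bracket_rpow (-m)).comp (by fun_prop)).measurable
  have hpt : ∀ z ∈ s, ENNReal.ofReal (bracket (u - z) ^ (-m) * landauSymbolBound γ ε m z) ≤
      (ENNReal.ofReal c₁ * ENNReal.ofReal (landauEnvelope z * bracket (u - z) ^ (-m)) +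
        ENNReal.ofReal d * ENNReal.ofReal ((d + γ) * ‖z‖ ^ γ * bracket (u - z) ^ (-m))) +
        ENNReal.ofReal c₃ * ENNReal.ofReal (ε ^ 2 * regPow (-(d : ℝ) / 2 - 1) ε z) := by
    intro z hz
    have hb := one_le_bracket (u - z)
    have hbz := bracket_pos z
    have hb0 : 0 ≤ bracket (u - z) ^ (-m) := by positivity
    have hr := regPow_nonneg (-(d : ℝ) / 2 - 1) ε z
    have he := landauEnvelope_nonneg z
    have hg : 0 ≤ (d + γ) * ‖z‖ ^ γ := mul_nonneg (by linarith) (by positivity)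
    rw [← ENNReal.ofReal_mul hc₁0, ← ENNReal.ofReal_mul hd0, ← ENNReal.ofReal_mul hc₃0,
      ← ENNReal.ofReal_add (by positivity) (by positivity),
      ← ENNReal.ofReal_add (by positivity) (by positivity)]
    refine ENNReal.ofReal_le_ofReal ?_
    -- On this region the growth ⟨z⟩^{d+1} is absorbed by ⟨u-z⟩^{-m}, so that only the mass of the
    -- approximate delta remains.
    have h4 : bracket (u - z) ^ (-m) * bracket z ^ ((d : ℝ) + 1) ≤ a ^ ((d : ℝ) + 1) := by
      calc _ ≤ bracket (u - z) ^ (-m) * (a * bracket (u - z)) ^ ((d : ℝ) + 1) := by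
            gcongr; exact hsa z hz
        _ = a ^ ((d : ℝ) + 1) * bracket (u - z) ^ (-m + ((d : ℝ) + 1)) := by
            rw [Real.mul_rpow ha0 (bracket_pos _).le, Real.rpow_add (bracket_pos _) (-m)]; ring
        _ ≤ a ^ ((d : ℝ) + 1) * 1 := by
            gcongr
            exact Real.rpow_le_one_of_one_le_of_nonpos hb (by linarith)
        _ = _ := mul_one _
    have h5 := mul_le_mul_of_nonneg_left h4
      (show 0 ≤ d ^ 2 * (ε ^ 2 * regPow (-(d : ℝ) / 2 - 1) ε z) by positivity)
    unfold landauSymbolBound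
    rw [← hc₁]
    calc _ = c₁ * (landauEnvelope z * bracket (u - z) ^ (-m)) +
          d * ((d + γ) * ‖z‖ ^ γ * bracket (u - z) ^ (-m)) +
          d ^ 2 * (ε ^ 2 * regPow (-(d : ℝ) / 2 - 1) ε z) *
            (bracket (u - z) ^ (-m) * bracket z ^ ((d : ℝ) + 1)) := by ring
      _ ≤ c₁ * (landauEnvelope z * bracket (u - z) ^ (-m)) +
          d * ((d + γ) * ‖z‖ ^ γ * bracket (u - z) ^ (-m)) +
          d ^ 2 * (ε ^ 2 * regPow (-(d : ℝ) / 2 - 1) ε z) * a ^ ((d : ℝ) + 1) := by linarith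
      _ = _ := by rw [hc₃]; ring
  refine (setLIntegral_mono' hsm hpt).trans ?_
  rw [lintegral_add_left (by fun_prop), lintegral_add_left (by fun_prop),
    lintegral_const_mul' _ _ ENNReal.ofReal_ne_top, lintegral_const_mul' _ _ ENNReal.ofReal_ne_top,
    lintegral_const_mul' _ _ ENNReal.ofReal_ne_top,
    ENNReal.ofReal_add (p := c₁ * C₁ + d * C₂) (by positivity) (by positivity),
    ENNReal.ofReal_add (p := c₁ * C₁) (by positivity) (by positivity), ENNReal.ofReal_mul hc₁0,
    ENNReal.ofReal_mul hd0, ENNReal.ofReal_mul hc₃0]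
  gcongr
  · exact h₁ u s hsm hsa
  · exact h₂ u s hsm hsa
  · exact (setLIntegral_le_lintegral _ _).trans (h₃ ε hε)

/-! ### The contact estimate for the Landau operator -/

/-- Only the positive part has to be estimated; for a non-integrable q the integral is 0 by
convention, which is at most C. -/
lemma integral_le_of_lintegral_ofReal_le {q : Euc d → ℝ} {C : ℝ} (hC : 0 ≤ C)
    (h : ∫⁻ z, ENNReal.ofReal (q z) ≤ ENNReal.ofReal C) : ∫ z, q z ≤ C := by
  by_cases hq : Integrable q
  · rw [integral_eq_lintegral_pos_part_sub_lintegral_neg_part hq]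
    have h1 := ENNReal.toReal_le_of_le_ofReal hC h
    have h2 : 0 ≤ (∫⁻ z, ENNReal.ofReal (-q z)).toReal := ENNReal.toReal_nonneg
    linarith
  · rwa [integral_undef hq]

/-- The order of quantifiers matters: K does not depend on the size ρ of the velocity, whereas C
does, but C multiplies τ, which is sent to zero. -/
lemma exists_divergence_landauFlux_le (hd : 2 ≤ d) {γ : ℝ} (hγd : -(d : ℝ) ≤ γ) (hγ : γ ≤ 1)
    {m : ℝ} (hm : 2 * d + 2 < m) :
    ∃ K : ℝ, 0 ≤ K ∧ ∀ ρ : ℝ, 0 ≤ ρ → ∃ C : ℝ, 0 ≤ C ∧ ∀ N : ℝ, 0 ≤ N → ∀ g : Euc d → ℝ,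
      ContDiff ℝ 2 g → (∀ v, 0 ≤ g v) → (∀ v, g v ≤ N * bracket v ^ (-m)) →
      ∀ ε : ℝ, 0 < ε → ε ≤ 1 → ∀ τ : ℝ, 0 ≤ τ → ∀ u : Euc d, bracket u ≤ ρ →
      (∀ ξ, fderiv ℝ (fderiv ℝ g) u ξ ξ ≤
        fderiv ℝ (fderiv ℝ fun v : Euc d => N * bracket v ^ (-m)) u ξ ξ + τ * ‖ξ‖ ^ 2) →
      ∑ i : Fin d, fderiv ℝ (landauFlux γ ε g) u (EuclideanSpace.single i 1) i ≤
        K * N ^ 2 * bracket u ^ (-m) + C * N * τ := by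
  have hd1 : 1 ≤ d := by omega
  have hd2 : (2 : ℝ) ≤ d := by exact_mod_cast hd
  have hm0 : 0 ≤ m := by linarith
  set κ : ℝ := 1 / (16 * (m + 2)) with hκ
  have hκ0 : 0 < κ := by positivity
  obtain ⟨K, hK, hKb⟩ := exists_lintegral_landauSymbolBound_le hd1 hγd hγ hm hκ0
  refine ⟨K, hK, fun ρ hρ => ?_⟩
  obtain ⟨B, hB, hBb⟩ := lintegral_landauEnvelope_le hd1 hm (3 * ρ) (by positivity)
  refine ⟨6 * d ^ 2 * B, by positivity, fun N hN g hg hg0 hgN ε hε hε1 τ hτ u hu hξ => ?_⟩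
  have hεa : |ε| ≤ 1 := by rwa [abs_of_pos hε]
  have habs : ∀ w, |g w| ≤ N * bracket w ^ (-m) := fun w => by
    rw [abs_of_nonneg (hg0 w)]; exact hgN w
  rw [divergence_landauFlux hγ hε hε1 hg (by linarith) habs u,
    ← integral_sub_left_eq_self _ volume u]
  simp only [sub_sub_cancel]
  have hbu : 0 ≤ bracket u ^ (-m) := Real.rpow_nonneg (bracket_pos u).le _
  refine integral_le_of_lintegral_ofReal_le (by positivity) ?_
  set s : Set (Euc d) := {z | κ * bracket u ≤ bracket (u - z)} with hs
  have hsm : MeasurableSet s := by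
    have := continuous_bracket (d := d)
    exact (isClosed_le continuous_const (by fun_prop)).measurableSet
  have hpt : ∀ z : Euc d, z ≠ 0 → ENNReal.ofReal (g (u - z) *
      (∑ i : Fin d, ∑ j : Fin d, landauA γ ε i j z *
        fderiv ℝ (fderiv ℝ g) u (EuclideanSpace.single i 1) (EuclideanSpace.single j 1) +
        g u * (((d : ℝ) - 1) * (regPow (γ / 2 - 1) ε z *
          ((d + γ) * ‖z‖ ^ 2 + d * ε ^ 2))))) ≤
      ENNReal.ofReal (6 * d ^ 2 * N * τ) *
        ENNReal.ofReal (landauEnvelope z * bracket (u - z) ^ (-m)) +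
      ENNReal.ofReal (N ^ 2 * bracket u ^ (-m)) * s.indicator (fun z =>
        ENNReal.ofReal (bracket (u - z) ^ (-m) * landauSymbolBound γ ε m z)) z := by
    intro z hz
    have hbz : 0 ≤ bracket (u - z) ^ (-m) := Real.rpow_nonneg (bracket_pos _).le _
    have he := landauEnvelope_nonneg z
    have h1 := sum_landauA_mul_le γ ε z hτ hξ
    rw [sum_landauA_mul_hessian_bracket] at h1
    have h2 : g u * (((d : ℝ) - 1) * (regPow (γ / 2 - 1) ε z *
        ((d + γ) * ‖z‖ ^ 2 + d * ε ^ 2))) ≤ N * bracket u ^ (-m) * (((d : ℝ) - 1) *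
        (regPow (γ / 2 - 1) ε z * ((d + γ) * ‖z‖ ^ 2 + d * ε ^ 2))) := by
      refine mul_le_mul_of_nonneg_right (hgN u) (mul_nonneg (by linarith)
        (mul_nonneg (regPow_nonneg _ _ _) (add_nonneg (mul_nonneg (by linarith) (sq_nonneg _))
          (by positivity))))
    have h3 : 2 * d ^ 2 * τ * (regPow (γ / 2) ε z * ‖z‖ ^ 2) ≤
        6 * d ^ 2 * τ * landauEnvelope z := by
      have := mul_le_mul_of_nonneg_left (regPow_mul_norm_sq_le hγd hγ hεa z)
        (show 0 ≤ 2 * (d : ℝ) ^ 2 * τ by positivity)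
      linarith
    -- Nonnegativity of g(u-z) and of the matrix allows both D²g(u) and g(u) to be replaced by the
    -- barrier, leaving its symbol and an error in τ.
    have h4 : g (u - z) *
      (∑ i : Fin d, ∑ j : Fin d, landauA γ ε i j z *
        fderiv ℝ (fderiv ℝ g) u (EuclideanSpace.single i 1) (EuclideanSpace.single j 1) +
        g u * (((d : ℝ) - 1) * (regPow (γ / 2 - 1) ε z *
          ((d + γ) * ‖z‖ ^ 2 + d * ε ^ 2)))) ≤
        g (u - z) * (6 * d ^ 2 * τ * landauEnvelope z) +
        N * bracket u ^ (-m) * (g (u - z) * landauSymbol γ ε m u z) := by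
      have h5 : ∑ i : Fin d, ∑ j : Fin d, landauA γ ε i j z *
        fderiv ℝ (fderiv ℝ g) u (EuclideanSpace.single i 1) (EuclideanSpace.single j 1) +
        g u * (((d : ℝ) - 1) * (regPow (γ / 2 - 1) ε z *
          ((d + γ) * ‖z‖ ^ 2 + d * ε ^ 2))) ≤ 6 * d ^ 2 * τ * landauEnvelope z +
          N * bracket u ^ (-m) * landauSymbol γ ε m u z := by
        unfold landauSymbol
        linarith
      exact (mul_le_mul_of_nonneg_left h5 (hg0 (u - z))).trans_eq (by ring)
    have h6 : g (u - z) * (6 * d ^ 2 * τ * landauEnvelope z) ≤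
        6 * d ^ 2 * N * τ * (landauEnvelope z * bracket (u - z) ^ (-m)) :=
      (mul_le_mul_of_nonneg_right (hgN (u - z)) (by positivity)).trans_eq (by ring)
    rw [← ENNReal.ofReal_mul (by positivity)]
    by_cases hzs : z ∈ s
    · rw [indicator_of_mem hzs, ← ENNReal.ofReal_mul (by positivity)]
      have h7 := landauSymbolBound_nonneg hγd hm0 ε z
      rw [← ENNReal.ofReal_add (by positivity) (by positivity)]
      refine ENNReal.ofReal_le_ofReal (h4.trans (add_le_add h6 ?_))
      have h8 : g (u - z) * landauSymbol γ ε m u z ≤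
          N * bracket (u - z) ^ (-m) * landauSymbolBound γ ε m z :=
        (mul_le_mul_of_nonneg_left (landauSymbol_le hd hγd hγ hε hε1 hm0 u hz)
          (hg0 _)).trans (mul_le_mul_of_nonneg_right (hgN _) h7)
      exact (mul_le_mul_of_nonneg_left h8 (by positivity)).trans_eq (by ring)
    · rw [indicator_of_notMem hzs, mul_zero, add_zero]
      refine ENNReal.ofReal_le_ofReal (h4.trans ?_)
      have h8 : landauSymbol γ ε m u z ≤ 0 :=
        landauSymbol_nonpos hd hγ hε (by linarith) (not_le.1 hzs)
      have h9 : N * bracket u ^ (-m) * (g (u - z) * landauSymbol γ ε m u z) ≤ 0 :=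
        mul_nonpos_of_nonneg_of_nonpos (by positivity)
          (mul_nonpos_of_nonneg_of_nonpos (hg0 _) h8)
      linarith
  have hne : ∀ᵐ z : Euc d, z ≠ 0 := by
    filter_upwards [ae_sub_ne hd1 (0 : Euc d)] with z hz h
    exact hz (by simp [h])
  have hbm : Measurable fun z : Euc d => bracket (u - z) ^ (-m) :=
    ((continuous_bracket_rpow (-m)).comp (by fun_prop)).measurable
  refine (lintegral_mono_ae (hne.mono hpt)).trans ?_
  rw [lintegral_add_left (by fun_prop), lintegral_const_mul' _ _ ENNReal.ofReal_ne_top,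
    lintegral_const_mul' _ _ ENNReal.ofReal_ne_top, lintegral_indicator hsm, add_comm,
    ENNReal.ofReal_add (by positivity) (by positivity)]
  have hBu := hBb u univ MeasurableSet.univ fun y _ => (bracket_le_mul_bracket_sub u y).trans
    (by have := bracket_pos (u - y); gcongr)
  rw [setLIntegral_univ] at hBu
  refine add_le_add ((mul_le_mul_right (hKb ε hε u) _).trans_eq ?_)
    ((mul_le_mul_right hBu _).trans_eq ?_)
  · rw [← ENNReal.ofReal_mul (by positivity)]; congr 1; ring
  · rw [← ENNReal.ofReal_mul (by positivity)]; congr 1; ring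

/-- The uniform divergence bound for the regularized fluxes on a small ball around the contact point
passes to the flux itself, and τ → 0 removes the Hessian error. -/
lemma hasContactEstimate_landau (hd : 2 ≤ d) {γ : ℝ} (hγd : -(d : ℝ) ≤ γ) (hγ : γ ≤ 1) {m : ℝ}
    (hm : 2 * d + 2 < m) : ∃ K : ℝ, 0 < K ∧ HasContactEstimate d (.landau γ) m K := by
  have hd1 : 1 ≤ d := by omega
  have hd2 : (2 : ℝ) ≤ d := by exact_mod_cast hd
  obtain ⟨K, hK, hKb⟩ := exists_divergence_landauFlux_le hd hγd hγ hm
  refine ⟨K + 1, by positivity, fun N hN g hg hg0 hgN v q hv hq => ?_⟩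
  obtain ⟨F, hF, F', hF', rfl⟩ := hq
  have hg1 : ContDiff ℝ 1 g := hg.of_le (by norm_num)
  have habs : ∀ w, |g w| ≤ N * bracket w ^ (-m) := fun w => by
    rw [abs_of_nonneg (hg0 w)]; exact hgN w
  have hbv := bracket_pos v
  obtain ⟨C, hC, hCb⟩ := hKb (bracket v + 2) (by positivity)
  obtain ⟨B, hB⟩ := exists_norm_landauFlux_le hd1 hγd hγ hg1 hm habs v
  -- The same τ measures the Hessian error and the oscillation of ⟨u⟩^{-m} on the ball where the
  -- comparison takes place.
  have hmain : ∀ τ : ℝ, 0 < τ → ∑ i : Fin d, F' (EuclideanSpace.single i 1) i ≤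
      K * N ^ 2 * (bracket v ^ (-m) + τ) + C * N * τ := by
    intro τ hτ
    obtain ⟨r₁, hr₁, h₁⟩ := exists_ball_fderiv_fderiv_le hg (contDiff_bracket_rpow N m (n := 2))
      hgN hv hτ
    obtain ⟨r₂, hr₂, h₂⟩ := Metric.eventually_nhds_iff_ball.1
      (((continuous_bracket_rpow (-m)).tendsto v).eventually
        (gt_mem_nhds (show bracket v ^ (-m) < bracket v ^ (-m) + τ by linarith)))
    have hr : 0 < min 1 (min r₁ r₂) := lt_min one_pos (lt_min hr₁ hr₂)
    have hsub : ∀ u ∈ Metric.ball v (min 1 (min r₁ r₂)),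
        u ∈ Metric.ball v 1 ∧ u ∈ Metric.ball v r₁ ∧ u ∈ Metric.ball v r₂ := by
      intro u hu
      simpa [Metric.mem_ball, lt_min_iff] using hu
    have hcd : ∀ n : ℕ, ContDiff ℝ 1 (landauFlux γ (1 / ((n : ℝ) + 1)) g) := fun n =>
      contDiff_landauFlux hγ (one_div_succ_pos n) (one_div_succ_le_one n) hg (by linarith) habs
    refine divergence_le_of_tendsto hF' (G := fun n : ℕ => landauFlux γ (1 / ((n : ℝ) + 1)) g)
      (C := B) (fun n => (hcd n).differentiable one_ne_zero) hr (fun u _ => ?_)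
      (fun n u hu => hB _ (abs_one_div_succ_le_one n) u (hsub u hu).1) (fun n => ?_)
      (fun n u hu => ?_)
    · rw [← landauFlux_eq_of_tendsto hd1 hγd hγ hg1 hm habs (hF u)]
      exact tendsto_landauFlux hd1 hγd hγ hg.continuous hm habs u
    · obtain ⟨B', hB'⟩ := (isCompact_closedBall v 1).exists_bound_of_continuousOn
        ((hcd n).continuous_fderiv one_ne_zero).continuousOn
      exact ⟨B', fun u hu => hB' u (Metric.ball_subset_closedBall (hsub u hu).1)⟩
    · obtain ⟨hu1, hu2, hu3⟩ := hsub u hu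
      refine (hCb N hN.le g hg hg0 hgN _ (one_div_succ_pos n) (one_div_succ_le_one n) τ hτ.le u
        (bracket_le_of_mem_ball hu1) (h₁ u hu2)).trans ?_
      have := mul_le_mul_of_nonneg_left (h₂ u hu3).le (show 0 ≤ K * N ^ 2 by positivity)
      linarith
  have hle : ∑ i : Fin d, F' (EuclideanSpace.single i 1) i ≤ K * N ^ 2 * bracket v ^ (-m) := by
    refine le_of_forall_pos_le_add fun δ hδ => ?_
    have hpos : 0 < K * N ^ 2 + C * N + 1 := by positivity
    refine (hmain (δ / (K * N ^ 2 + C * N + 1)) (by positivity)).trans ?_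
    have h1 : (K * N ^ 2 + C * N) * (δ / (K * N ^ 2 + C * N + 1)) ≤ δ := by
      rw [mul_div_assoc', div_le_iff₀ hpos]
      nlinarith
    linarith
  have : 0 ≤ N ^ 2 * bracket v ^ (-m) := by positivity
  linarith

end Kinetic

/-! ### The lower bound on the blow-up rate -/

theorem corollary1p2 (d : ℕ) (hd : 2 ≤ d) (Q : Kinetic.CollisionOperator) (hQ : Q.Admissible d) :
    ∃ m₀ : ℝ, ∀ m : ℝ, m₀ < m → ∃ C : ℝ, 0 < C ∧
      ∀ (Ω : Kinetic.SpatialDomain) (T : ℝ), 0 < T →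
      ∀ f : ℝ → Kinetic.Euc d → Kinetic.Euc d → ℝ,
        Kinetic.IsSolution Q Ω m T f →
        Kinetic.weightedNorm m (f 0) < ⊤ →
        limsup (fun t : ℝ => Kinetic.weightedNorm 0 (f t)) (𝓝[<] T) = ⊤ →
        ∀ t ∈ Ico 0 T,
          ENNReal.ofReal (1 / (C * (T - t))) ≤ Kinetic.weightedNorm m (f t) := by
  -- Nonnegativity of m₀ gives ⟨v⟩^m ≥ 1, so that control of the weighted norm excludes blow-up of
  -- the unweighted one.
  obtain ⟨m₀, hm₀, h⟩ : ∃ m₀ : ℝ, 0 ≤ m₀ ∧ ∀ m : ℝ, m₀ < m →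
      ∃ K : ℝ, 0 < K ∧ Kinetic.HasContactEstimate d Q m K := by
    match Q, hQ with
    | .landau γ, ⟨h1, h2, _⟩ =>
      exact ⟨2 * d + 2, by positivity, fun m hm =>
        Kinetic.hasContactEstimate_landau hd h1 h2 hm⟩
    | .boltzmann γ b, ⟨h1, hb⟩ =>
      exact ⟨d + |γ| + 4, by positivity, fun m hm =>
        Kinetic.hasContactEstimate_boltzmann hd h1 hb hm⟩
  refine ⟨m₀, fun m hm => ?_⟩
  obtain ⟨K, hK0, hK⟩ := h m hm
  exact ⟨2 * K, by positivity, fun Ω T _ f hf _ hlim t ht =>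
    hf.blowup_rate (hm₀.trans hm.le) hK0 hK hlim ht⟩
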